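/- **Setting.** Let $\lambda=(n_1\ge\dots\ge n_\ell>0)$ be a partition of $N$. Vectors in $\mathbb C^N$ are written $v=(v^{(k)}_r)_{1\le k\le\ell,\,0\le r<n_k}$. Let $H_\lambda\subset GL(N)$ be the group of invertible block diagonal matrices $h=\mathrm{diag}(h^{(1)},\dots,h^{(\ell)})$ with $h^{(k)}=\sum_{0\le r<n_k}h^{(k)}_r\Lambda^r$, $\Lambda$ the shift matrix. The character of its universal covering group with parameter $\alpha\in\mathbb C^N$ is $$\chi(h;\alpha)=\prod_{k}\Big((h^{(k)}_0)^{\alpha^{(k)}_0}\exp\sum_{1\le r<n_k}\alpha^{(k)}_r\theta_r(h^{(k)})\Big),\qquad \log\Big(1+\sum_{r\ge1}\tfrac{x_r}{x_0}T^r\Big)=\sum_{r\ge1}\theta_r(x)T^r .$$ Assume that, for every $k$, $\alpha^{(k)}_{n_k-1}\ne0$ if $n_k\ge2$ and $\alpha^{(k)}_{0}\notin\mathbb Z$ if $n_k=1$, and that $\sum_k\alpha^{(k)}_0=-2$. Let $\alpha+m(\epsilon^{(i)}-\epsilon^{(j)})$ be obtained from $\alpha$ by $\alpha^{(i)}_0\mapsto\alpha^{(i)}_0+m$,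 $\alpha^{(j)}_0\mapsto\alpha^{(j)}_0-m$. Let $Z_\lambda$ be the set of $2\times N$ matrices $z$ with columns $z^{(k)}_r$ such that $\det(z^{(k)}_0,z^{(l)}_0)\ne0$ for $k\ne l$ and $\det(z^{(k)}_0,z^{(k)}_1)\neq0$ if $n_k\ge2$. Let $X\subset Z_\lambda$ be the slice of matrices $\mathbf x$ whose $k$-th block has rows $(x^{(k)}_0,\dots,x^{(k)}_{n_k-1})$ and $(1,0,\dots,0)$; put $D^{(k)}_r=\partial/\partial x^{(k)}_r$. Let $\mathcal S(\alpha)$ be the sheaf on $Z_\lambda$ of holomorphic solutions $u$ of $\left(\frac{\partial}{\partial z_{0,p}}\frac{\partial}{\partial z_{1,q}}-\frac{\partial}{\partial z_{1,p}}\frac{\partial}{\partial z_{0,q}}\right)u=0$ (all columns $p,q$) with $u(zh)=u(z)\chi(h;\alpha)$ for $h\in H_\lambda$ near $1$, and $\mathcal S^{res}(\alpha)$ its pullback to $X$. Fix $i\ne j$ with $n_i\le n_j$, and write $\mathcal S^{res}_m(\alpha)=\mathcal S^{res}(\alpha+m(\epsilon^{(i)}-\epsilon^{(j)}))$, $c_m=(\alpha^{(i)}_{n_i-1}+m\delta_{n_i,1})(\alpha^{(j)}_{n_j-1}-(m-1)\delta_{n_j,1})$,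 $$H_m=(x^{(i)}_0-x^{(j)}_0)D^{(j)}_{n_j-1}+\alpha^{(j)}_{n_j-1}-m\delta_{n_j,1},\qquad B_m=\tfrac1{c_m}\big\{(x^{(j)}_0-x^{(i)}_0)D^{(i)}_{n_i-1}+\alpha^{(i)}_{n_i-1}+m\delta_{n_i,1}\big\}.$$ Let $\Omega\subset X$ be open with a holomorphic branch of $\log(x^{(i)}_0-x^{(j)}_0)$, which is used in all powers below, and let $$g_m=(x^{(i)}_0-x^{(j)}_0)^{-(\alpha^{(i)}_0+m)}\ (n_i=1),\qquad g_m=\exp\Big(-\frac{\alpha^{(i)}_{n_i-1}x^{(i)}_{n_i-1}}{x^{(i)}_0-x^{(j)}_0}\Big)\ (n_i\ge2).$$ The 2-dimensional Toda–Hirota equation for holomorphic $\tau_m$ on $\Omega$, at the points where $\tau_m\neq0$, is $$D^{(i)}_{n_i-1}D^{(j)}_{n_j-1}\log\tau_m=\frac{\tau_{m+1}\tau_{m-1}}{\tau_m^2},\qquad m\in\mathbb Z.\tag{T}$$ **Theorem.** For every constant $A\ne0$, the following sequence $t_m$ solves (T). (i) If $n_i=n_j=1$: $t_m=(x^{(i)}_0-x^{(j)}_0)^{p(\alpha^{(i)}_0,\alpha^{(j)}_0;m)}\,T_m(\alpha^{(i)}_0,\alpha^{(j)}_0)$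 with $p(a,b;m)=(a+m)(b-m+1)$, $T_0=1$, $T_1=A$, $T_m=A^m\prod_{k=0}^{m-1}\prod_{l=1}^{k}p(a,b;l)$ for $m\ge2$, and $T_m=A^m\prod_{k=1}^{|m|}\prod_{l=-k+1}^{0}p(a,b;l)$ for $m\le-1$. (ii) If $n_i=1$, $n_j\ge2$: $$t_m=\exp\Big(\frac{(\alpha^{(i)}_0+m)\,\alpha^{(j)}_{n_j-1}\,x^{(j)}_{n_j-1}}{x^{(j)}_0-x^{(i)}_0}\Big)(x^{(i)}_0-x^{(j)}_0)^{-m(m+1)}\,T_m(\alpha^{(i)}_0,\alpha^{(j)}_{n_j-1}),$$ with $T_m(a,b)=A^m\,b^{m(m-1)/2}\prod_{k}[a]_k$, the product over the integers $k$ from $\min(0,m)$ to $\max(0,m)$, where $[a]_k=\Gamma(a+k)/\Gamma(a+1)$ for $k\ge1$, $[a]_0=1$, $[a]_k=\Gamma(a+1)/\Gamma(a+1+k)$ for $k\le-1$. (iii) If $n_i,n_j\ge2$: $$t_m=\exp\Big(\frac{\alpha^{(i)}_{n_i-1}\alpha^{(j)}_{n_j-1}x^{(i)}_{n_i-1}x^{(j)}_{n_j-1}}{(x^{(i)}_0-x^{(j)}_0)^2}\Big)(x^{(i)}_0-x^{(j)}_0)^{-m(m+1)}A^m\big(\alpha^{(i)}_{n_i-1}\alpha^{(j)}_{n_j-1}\big)^{m(m-1)/2}.$$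 Moreover: (1) Given $u_0\in\mathcal S^{res}_0(\alpha)(\Omega)$, define $u_m$ on $\Omega$ by $u_{m+1}=H_mu_m$ $(m\ge0)$ and $u_{m-1}=B_mu_m$ $(m\le0)$. Then $u_m\in\mathcal S^{res}_m(\alpha)(\Omega)$ for all $m\in\mathbb Z$, and $\tau_m=t_m\,g_m\,u_m$ solves (T). (2) Let $F(\mathbf x;\alpha)=\int_C\chi\big((1,s)\mathbf x;\alpha\big)\,ds$ be the restriction to $\Omega$ of the Gelfand hypergeometric function, where $C$ is a locally constant family of locally finite $1$-cycles in the $s$-line minus the points $-x^{(k)}_0$, with coefficients in the local system of branches of the integrand and supports along which the integrand decays rapidly at the points with $n_k\ge2$; let $F(\mathbf x;\alpha+m(\epsilon^{(i)}-\epsilon^{(j)}))$ be defined with the same $C$. Then $$\tau_m=C_m(\alpha)\,t_m\,g_m\,F\big(\mathbf x;\alpha+m(\epsilon^{(i)}-\epsilon^{(j)})\big)$$ solves (T), where $C_m(\alpha)=\Gamma(\alpha^{(j)}_0+1)/\Gamma(\alpha^{(j)}_0-m+1)$ if $n_i=n_j=1$ and $C_m(\alpha)=(\alpha^{(j)}_{n_j-1})^m$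 if $n_j\ge2$. -/

import Mathlib

open Filter Topology

noncomputable section

namespace GelfandToda

/-- A partition of `N`: a non-increasing tuple of positive integers with sum `N`. -/
structure TuplePartition (N : ℕ) where
  len : ℕ
  part : Fin len → ℕ
  part_pos : ∀ k, 0 < part k
  part_antitone : Antitone part
  sum_part : ∑ k, part k = N

variable {N : ℕ}

/-- Indices `(k, r)` with `k` a block and `0 ≤ r < n_k`. -/
abbrev Idx (lam : TuplePartition N) : Type := Σ k : Fin lam.len, Fin (lam.part k)

/-- Vectors `(v_r^{(k)})` in `ℂ^N`; used for parameters, for elements of the group `H_lam`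
(through `h^{(k)} = ∑ h_r^{(k)} Λ^r`) and for the coordinates of points of the slice. -/
abbrev Vec (lam : TuplePartition N) : Type := Idx lam → ℂ

/-- The `2 × N` matrices, with rows indexed by `0, 1`. -/
abbrev Mat2 (lam : TuplePartition N) : Type := Fin 2 → Idx lam → ℂ

/-- The index `(k, 0)`. -/
def first (lam : TuplePartition N) (k : Fin lam.len) : Idx lam := ⟨k, ⟨0, lam.part_pos k⟩⟩

/-- The index `(k, n_k - 1)`. -/
def last (lam : TuplePartition N) (k : Fin lam.len) : Idx lam :=
  ⟨k, ⟨lam.part k - 1, Nat.sub_lt (lam.part_pos k) Nat.one_pos⟩⟩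

/-- The entry `v_r^{(k)}`, extended by `0` to all natural numbers `r`. -/
def entry {lam : TuplePartition N} (v : Vec lam) (k : Fin lam.len) (r : ℕ) : ℂ :=
  if hr : r < lam.part k then v ⟨k, ⟨r, hr⟩⟩ else 0

/-! ### The group and its characters -/

/-- The upper triangular Toeplitz matrix `∑ h_r Λ^r`. -/
def jordan {n : ℕ} (h : Fin n → ℂ) : Matrix (Fin n) (Fin n) ℂ :=
  Matrix.of fun a b => if a ≤ b then h ⟨b.1 - a.1, by omega⟩ else 0

/-- The block diagonal matrix `diag(h^{(1)}, …, h^{(ℓ)})`. -/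
def groupMatrix {lam : TuplePartition N} (h : Vec lam) : Matrix (Idx lam) (Idx lam) ℂ :=
  Matrix.blockDiagonal' fun k => jordan fun r => h ⟨k, r⟩

/-- The right action `z ↦ z h`. -/
def act {lam : TuplePartition N} (z : Mat2 lam) (h : Vec lam) : Mat2 lam :=
  fun a p => (Matrix.of z * groupMatrix h) a p

/-- The vector of the unit element of `H_lam`. -/
def groupOne (lam : TuplePartition N) : Vec lam := fun p => if p.2.1 = 0 then 1 else 0

/-- `θ_r(x)`, the coefficient of `T^r` in `log (1 + ∑_{k ≥ 1} (x_k / x_0) T^k)` for `r ≥ 1`. -/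
def theta (r : ℕ) (x : ℕ → ℂ) : ℂ :=
  ∑ c : Composition r,
    (-1) ^ (c.length + 1) / (c.length : ℂ) * (c.blocks.map fun b => x b / x 0).prod

/-- The character `χ( · ; α)` of the universal cover of `H_lam`. A point of the universal cover is
given by `h` together with a choice `w_k` of `log h_0^{(k)}` for every block. -/
def character {lam : TuplePartition N} (α : Vec lam) (w : Fin lam.len → ℂ) (h : Vec lam) : ℂ :=
  ∏ k, Complex.exp (α (first lam k) * w k +
    ∑ r ∈ Finset.Ico 1 (lam.part k), entry α k r * theta r (entry h k))

/-- The character near the unit element, with `log 1 = 0`. -/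
def characterNearOne {lam : TuplePartition N} (α : Vec lam) (h : Vec lam) : ℂ :=
  character α (fun k => Complex.log (h (first lam k))) h

/-- The condition on the parameter of the character. -/
def IsGeneric {lam : TuplePartition N} (α : Vec lam) : Prop :=
  (∀ k, 2 ≤ lam.part k → α (last lam k) ≠ 0) ∧
  (∀ k, lam.part k = 1 → ∀ a : ℤ, α (last lam k) ≠ a) ∧
  ∑ k, α (first lam k) = -2

/-- `α + m (ε^{(i)} - ε^{(j)})`. -/
def shift {lam : TuplePartition N} (α : Vec lam) (i j : Fin lam.len) (m : ℤ) : Vec lam :=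
  α + (m : ℂ) • (Pi.single (first lam i) 1 - Pi.single (first lam j) 1)

/-! ### The generic stratum, the slice, and the solution spaces -/

/-- `det (z_p, z_q)` for two columns of `z`. -/
def minor {lam : TuplePartition N} (z : Mat2 lam) (p q : Idx lam) : ℂ :=
  z 0 p * z 1 q - z 1 p * z 0 q

/-- The generic stratum `Z_lam`. -/
def genericStratum (lam : TuplePartition N) : Set (Mat2 lam) :=
  {z | (∀ k l, k ≠ l → minor z (first lam k) (first lam l) ≠ 0) ∧
    ∀ k (hk : 2 ≤ lam.part k), minor z (first lam k) ⟨k, ⟨1, hk⟩⟩ ≠ 0}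

/-- The matrix with blocks `(x_0, x_1, …, x_{n-1}; 1, 0, …, 0)`. -/
def embed {lam : TuplePartition N} (x : Vec lam) : Mat2 lam :=
  fun a p => if a = 0 then x p else if p.2.1 = 0 then 1 else 0

/-- The slice `X`, in the coordinates `x_r^{(k)}`. -/
def slice (lam : TuplePartition N) : Set (Vec lam) := {x | embed x ∈ genericStratum lam}

/-- `∂ u / ∂ z_{a,p}`. -/
def dz {lam : TuplePartition N} (a : Fin 2) (p : Idx lam) (u : Mat2 lam → ℂ) : Mat2 lam → ℂ :=
  fun z => fderiv ℂ u z (Pi.single a (Pi.single p 1))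

/-- `D_p v = ∂ v / ∂ x_p`. -/
def D {lam : TuplePartition N} (p : Idx lam) (v : Vec lam → ℂ) : Vec lam → ℂ :=
  fun x => fderiv ℂ v x (Pi.single p 1)

/-- Sections over the open set `U` of the sheaf `𝒮(α)`: holomorphic functions on `U` with
`□_{p,q} u = 0` for all `p, q` and `u(z h) = u(z) χ(h; α)`. The character lives on the universal
cover and `U` need not be stable under the group, so the last identity is an identity of germs
at `(z, 1)`. -/
structure IsSection {lam : TuplePartition N} (α : Vec lam) (U : Set (Mat2 lam))
    (u : Mat2 lam → ℂ) : Prop where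
  holo : DifferentiableOn ℂ u U
  square : ∀ z ∈ U, ∀ p q : Idx lam, dz 0 p (dz 1 q u) z - dz 1 p (dz 0 q u) z = 0
  equivariant : ∀ z ∈ U, ∀ᶠ y : Mat2 lam × Vec lam in 𝓝 (z, groupOne lam),
    u (act y.1 y.2) = u y.1 * characterNearOne α y.2

/-- Sections over `Ω ⊆ X` of `𝒮^{res}(α)`, the pullback of the sheaf `𝒮(α)` to the slice. -/
def IsResSection {lam : TuplePartition N} (α : Vec lam) (Ω : Set (Vec lam))
    (v : Vec lam → ℂ) : Prop :=
  ∀ x ∈ Ω, ∃ U : Set (Mat2 lam), IsOpen U ∧ U ⊆ genericStratum lam ∧ embed x ∈ U ∧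
    ∃ u : Mat2 lam → ℂ, IsSection α U u ∧ ∀ y ∈ Ω, embed y ∈ U → v y = u (embed y)

/-! ### The contiguity operators on the slice -/

/-- The operator `(x_0^{(i)} - x_0^{(j)}) D_{n_j-1}^{(j)} + α_{n_j-1}^{(j)}`. -/
def contig {lam : TuplePartition N} (i j : Fin lam.len) (α : Vec lam) (v : Vec lam → ℂ) :
    Vec lam → ℂ :=
  fun x => (x (first lam i) - x (first lam j)) * D (last lam j) v x + α (last lam j) * v x

/-- `c_m = (α_{n_i-1}^{(i)} + m δ_{n_i,1}) (α_{n_j-1}^{(j)} - (m-1) δ_{n_j,1})`. -/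
def cConst {lam : TuplePartition N} (i j : Fin lam.len) (α : Vec lam) (m : ℤ) : ℂ :=
  (α (last lam i) + if lam.part i = 1 then (m : ℂ) else 0) *
    (α (last lam j) - if lam.part j = 1 then (m : ℂ) - 1 else 0)

/-- The raising operator `H_m`. -/
def opH {lam : TuplePartition N} (i j : Fin lam.len) (α : Vec lam) (m : ℤ) (v : Vec lam → ℂ) :
    Vec lam → ℂ :=
  contig i j (shift α i j m) v

/-- The lowering operator `B_m`. -/
def opB {lam : TuplePartition N} (i j : Fin lam.len) (α : Vec lam) (m : ℤ) (v : Vec lam → ℂ) :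
    Vec lam → ℂ :=
  fun x => 1 / cConst i j α m * contig j i (shift α i j m) v x

/-! ### The two-dimensional Toda-Hirota equation -/

/-- The sequence `τ` of holomorphic functions on `Ω` solves
`D_p D_q log τ_m = τ_{m+1} τ_{m-1} / τ_m ^ 2` for all `m ∈ ℤ`: at every point where
`τ_m ≠ 0`, and for every holomorphic branch `φ` of `log τ_m` there. -/
def SolvesToda {lam : TuplePartition N} (Ω : Set (Vec lam)) (p q : Idx lam)
    (τ : ℤ → Vec lam → ℂ) : Prop :=
  ∀ m : ℤ, DifferentiableOn ℂ (τ m) Ω ∧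
    ∀ x ∈ Ω, τ m x ≠ 0 → ∀ φ : Vec lam → ℂ,
      (∀ᶠ y in 𝓝 x, DifferentiableAt ℂ φ y ∧ Complex.exp (φ y) = τ m y) →
        D p (D q φ) x = τ (m + 1) x * τ (m - 1) x / τ m x ^ 2

/-! ### Seed solutions and gauge factors

`L` is a branch of `log (x_0^{(i)} - x_0^{(j)})`. -/

/-- `p(a, b; m) = (a + m) (b - m + 1)`. -/
def pPoly (a b : ℂ) (m : ℤ) : ℂ := (a + m) * (b - m + 1)

/-- The constants `T_m` in the case `n_i = n_j = 1`; in particular `T_0 = 1` and `T_1 = A`. -/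
def tConst₁ (A a b : ℂ) (m : ℤ) : ℂ :=
  if 0 ≤ m then
    A ^ m * ∏ k ∈ Finset.Ico (0 : ℤ) m, ∏ l ∈ Finset.Icc (1 : ℤ) k, pPoly a b l
  else
    A ^ m * ∏ k ∈ Finset.Icc (1 : ℤ) |m|, ∏ l ∈ Finset.Icc (-k + 1) (0 : ℤ), pPoly a b l

/-- The symbol `[a]_k`. -/
def gammaSymbol (a : ℂ) (k : ℤ) : ℂ :=
  if 1 ≤ k then Complex.Gamma (a + k) / Complex.Gamma (a + 1)
  else if k = 0 then 1
  else Complex.Gamma (a + 1) / Complex.Gamma (a + 1 + k)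

/-- The constants `T_m` in the case `n_i = 1`, `n_j ≥ 2`. -/
def tConst₂ (A a b : ℂ) (m : ℤ) : ℂ :=
  A ^ m * (∏ k ∈ Finset.Icc (min 0 m) (max 0 m), gammaSymbol a k) * b ^ (m * (m - 1) / 2)

/-- The constants `T_m` in the case `n_i, n_j ≥ 2`. -/
def tConst₃ (A a b : ℂ) (m : ℤ) : ℂ := A ^ m * (a * b) ^ (m * (m - 1) / 2)

/-- The seed solution `t_m`. -/
def seed {lam : TuplePartition N} (i j : Fin lam.len) (α : Vec lam) (A : ℂ) (L : Vec lam → ℂ)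
    (m : ℤ) (x : Vec lam) : ℂ :=
  if lam.part i = 1 ∧ lam.part j = 1 then
    Complex.exp (pPoly (α (first lam i)) (α (first lam j)) m * L x) *
      tConst₁ A (α (first lam i)) (α (first lam j)) m
  else if lam.part i = 1 then
    Complex.exp ((α (first lam i) + m) * α (last lam j) * x (last lam j) /
        (x (first lam j) - x (first lam i))) *
      (x (first lam i) - x (first lam j)) ^ (-(m * (m + 1))) *
      tConst₂ A (α (first lam i)) (α (last lam j)) m
  else
    Complex.exp (α (last lam i) * α (last lam j) * x (last lam i) * x (last lam j) /
        (x (first lam i) - x (first lam j)) ^ 2) *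
      (x (first lam i) - x (first lam j)) ^ (-(m * (m + 1))) *
      tConst₃ A (α (last lam i)) (α (last lam j)) m

/-- The gauge factor `g_m`. -/
def gaugeFactor {lam : TuplePartition N} (i j : Fin lam.len) (α : Vec lam) (L : Vec lam → ℂ)
    (m : ℤ) (x : Vec lam) : ℂ :=
  if lam.part i = 1 then Complex.exp (-(α (first lam i) + m) * L x)
  else Complex.exp (-(α (last lam i) * x (last lam i) / (x (first lam i) - x (first lam j))))

/-- The constant `C_m(α)`. -/
def hgfConst {lam : TuplePartition N} (i j : Fin lam.len) (α : Vec lam) (m : ℤ) : ℂ :=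
  if lam.part i = 1 ∧ lam.part j = 1 then
    Complex.Gamma (α (first lam j) + 1) / Complex.Gamma (α (first lam j) - m + 1)
  else α (last lam j) ^ m

/-! ### The Gelfand hypergeometric function on the slice -/

/-- The row vector `(1, s) z`. -/
def linForm {lam : TuplePartition N} (s : ℂ) (z : Mat2 lam) : Vec lam :=
  fun p => z 0 p + s * z 1 p

/-- The radial path from the singular point `-x_0^{(k)}` (at `t = 0`) to `q` (at `t = 1`). -/
def radialPath {lam : TuplePartition N} (k : Fin lam.len) (q : ℂ) (x : Vec lam) (t : ℝ) : ℂ :=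
  -x (first lam k) + t * (q + x (first lam k))

/-- A locally constant family, over a set `W` of points `x` of the slice, of `1`-cycles in the
`s`-plane with coefficients in the local system of the branches of `χ((1, s) x; α)` and with
supports on which `χ` decays. The singular points are `s = -x_0^{(k)}`.
The chain is a finite linear combination of
* `C¹` arcs `arc a`, parametrized by `[0, 1]`, which do not meet the singular points and do not
  move with `x`;
* segments which join a singular point `-x_0^{(k)}` with `n_k ≥ 2` (an essential singularity of
  `χ`) to a fixed point `q`, and which leave the singular point in a direction in which the
  leading term `α_{n-1} θ_{n-1} ∼ α_{n-1} (-1)^n / (n-1) (x_1 / (s + x_0))^{n-1}`, `n = n_k`,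
  of the exponent of `χ` has negative real part.
Each of them carries continuous branches of `log (s + x_0^{(k)})` for all `k`.
The field `boundary_eq_zero` says that at each point `s = p` the coefficients, which are germs of
branches of `∏ (s + x_0^{(k)}) ^ α_0^{(k)}`, add up to zero.
Near a singular point with `n_k = 1` chains are compact: as `α_0^{(k)}` is not an integer, a
locally finite chain that runs into it is replaced by its regularization. -/
structure TwistedCycle (lam : TuplePartition N) (α : Vec lam) (W : Set (Vec lam)) where
  numArc : ℕ
  arcCoeff : Fin numArc → ℂ
  arc : Fin numArc → ℝ → ℂ
  arcLog : Fin numArc → Vec lam → ℝ → Fin lam.len → ℂ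
  arc_contDiff : ∀ a, ContDiff ℝ 1 (arc a)
  arcLog_continuousOn : ∀ a, ContinuousOn (fun y : Vec lam × ℝ => arcLog a y.1 y.2)
    (W ×ˢ Set.Icc (0 : ℝ) 1)
  exp_arcLog : ∀ a, ∀ x ∈ W, ∀ t ∈ Set.Icc (0 : ℝ) 1, ∀ k,
    Complex.exp (arcLog a x t k) = arc a t + x (first lam k)
  numRay : ℕ
  rayCoeff : Fin numRay → ℂ
  rayBlock : Fin numRay → Fin lam.len
  rayEnd : Fin numRay → ℂ
  rayLog : Fin numRay → Vec lam → ℝ → Fin lam.len → ℂ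
  two_le_part : ∀ b, 2 ≤ lam.part (rayBlock b)
  rayLog_continuousOn : ∀ b, ContinuousOn (fun y : Vec lam × ℝ => rayLog b y.1 y.2)
    (W ×ˢ Set.Ioc (0 : ℝ) 1)
  exp_rayLog : ∀ b, ∀ x ∈ W, ∀ t ∈ Set.Ioc (0 : ℝ) 1, ∀ k,
    Complex.exp (rayLog b x t k) = radialPath (rayBlock b) (rayEnd b) x t + x (first lam k)
  decay : ∀ b, ∀ x ∈ W,
    (α (last lam (rayBlock b)) *
      ((-1) ^ lam.part (rayBlock b) / ((lam.part (rayBlock b) - 1 : ℕ) : ℂ)) *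
      (x ⟨rayBlock b, ⟨1, two_le_part b⟩⟩ / (rayEnd b + x (first lam (rayBlock b)))) ^
        (lam.part (rayBlock b) - 1)).re < 0
  boundary_eq_zero : ∀ x ∈ W, ∀ p : ℂ,
    (∑ a, arcCoeff a *
      ((if arc a 1 = p then Complex.exp (∑ k, α (first lam k) * arcLog a x 1 k) else 0) -
        (if arc a 0 = p then Complex.exp (∑ k, α (first lam k) * arcLog a x 0 k) else 0))) +
    ∑ b, rayCoeff b *
      (if rayEnd b = p then Complex.exp (∑ k, α (first lam k) * rayLog b x 1 k) else 0) = 0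

/-- The integral `∫_C χ((1, s) x; β) ds`. -/
def TwistedCycle.integral {lam : TuplePartition N} {α : Vec lam} {W : Set (Vec lam)}
    (C : TwistedCycle lam α W) (β : Vec lam) (x : Vec lam) : ℂ :=
  (∑ a, C.arcCoeff a * ∫ t in (0 : ℝ)..1,
    character β (C.arcLog a x t) (linForm (C.arc a t) (embed x)) * deriv (C.arc a) t) +
  ∑ b, C.rayCoeff b * ∫ t in (0 : ℝ)..1,
    character β (C.rayLog b x t)
      (linForm (radialPath (C.rayBlock b) (C.rayEnd b) x t) (embed x)) *
      deriv (radialPath (C.rayBlock b) (C.rayEnd b) x) t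

/-- `F(x; β)`, for `x ∈ Ω ⊆ X` and `β` in the orbit of `α` under the root lattice, is the
restriction to the slice of the Gelfand hypergeometric function: locally on `Ω` it is the integral
of `χ((1, s) x; β)` over a locally constant cycle, which is the same for all these `β` (their
local systems coincide). -/
def IsGelfandHGF {lam : TuplePartition N} (α : Vec lam) (Ω : Set (Vec lam))
    (F : Vec lam → Vec lam → ℂ) : Prop :=
  ∀ x ∈ Ω, ∃ W : Set (Vec lam), IsOpen W ∧ x ∈ W ∧ W ⊆ Ω ∧
    ∃ C : TwistedCycle lam α W, ∀ e : Fin lam.len → ℤ, ∑ k, e k = 0 →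
      ∀ y ∈ W,
        F (α + ∑ k, (e k : ℂ) • Pi.single (first lam k) 1) y =
          C.integral (α + ∑ k, (e k : ℂ) • Pi.single (first lam k) 1) y

end GelfandToda

end

open GelfandToda

/-!
Write `X = x_0^{(i)} - x_0^{(j)}`, let `p`, `q` be the last indices of the blocks `i`, `j`, and let
`β_m = α + m (ε^{(i)} - ε^{(j)})`. All three assertions come from one algebraic fact about a
sequence of holomorphic functions `u_m` on `Ω` with
`X D_q u_m + β_m(q) u_m = u_{m+1}` and `-X D_p u_m + β_m(p) u_m = c_m u_{m-1}` for all `m`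
(`IsLadder`). Lowering after raising is multiplication by `c_{m+1}`, which is the
Euler-Poisson-Darboux equation `X D_p D_q u_m = β_m(p) D_q u_m - β_m(q) D_p u_m`
(`contig_contig_iff`), and multiplying the two relations gives
`c_m u_{m+1} u_{m-1} = X² (u_m D_p D_q u_m - D_p u_m D_q u_m) + β_m(p) β_m(q) u_m²`
(`IsLadder.bilinear`). The seed solutions and gauge factors are constants `K_m` times exponentials
`exp ψ_m` with `K_{m+1} K_{m-1} = c_m K_m²`, with `ψ_{m+1} + ψ_{m-1} - 2 ψ_m = -2 log X`, and with
`D_p D_q ψ_m = c_m / X²` for the seed alone and `β_m(p) β_m(q) / X²` for seed and gauge factor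
together, so that `K_m exp(ψ_m) u_m`, and the seed itself, solve the bilinear form of the equation
(`solvesToda_exp_mul`).

Two sources of ladders remain. On `Z_lam` the contiguity operator is the infinitesimal right action
of the matrix unit `E_{(i,0),(j,n_j-1)}`. It preserves the system `□ u = 0`, and it shifts the
parameter because `E_{(i,0),(j,n_j-1)}` is a weight vector for the adjoint action of `H_lam`
(`IsSection.raise`). On the slice, differentiating the equivariance in the last group coordinate of
each block expresses `∂ / ∂ z_{1,p}` through `∂ / ∂ z_{0,p}`, and `□_{p,q} u = 0` becomes the
Euler-Poisson-Darboux equation (`IsResSection.epd`).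

For the integrals, the derivative of `χ((1, s) x; β)` in the last coordinate of a block `k` is `β /
(s + x_0^{(k)})` times `χ`, whatever the size of the block, and the segments of a cycle do not move
in these directions, so both ladder relations hold already for the integrands
(`IsMovingPath.contig_pathIntegral`). Differentiation under the integral sign needs only a locally
uniform bound of the integrand, by Cauchy's estimate (`hasFDerivAt_integral_of_bounded`). On a
segment that ends at an essential singularity the bound holds because `t^{n-1}` times the exponent
extends continuously to `t = 0` with negative real part (`radial_bound`).
-/

noncomputable section

namespace GelfandToda

variable {N : ℕ}

/-! ### Holomorphic functions of several variables -/

section SeveralVariables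

open MeasureTheory

variable {E : Type*} [NormedAddCommGroup E] [NormedSpace ℂ E]

/-- Cauchy's estimate for the total derivative. -/
theorem norm_fderiv_le_of_forall_ball {f : E → ℂ} {c : E} {r M : ℝ} (hr : 0 < r)
    (hf : DifferentiableOn ℂ f (Metric.ball c r)) (hM : ∀ z ∈ Metric.ball c r, ‖f z‖ ≤ M) :
    ‖fderiv ℂ f c‖ ≤ 2 * M / r := by
  refine Complex.norm_fderiv_le_div_of_mapsTo_ball hf (fun z hz => ?_) hr
  rw [mem_closedBall_iff_norm]
  have h₁ := hM z hz
  have h₂ := hM c (Metric.mem_ball_self hr)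
  linarith [norm_sub_le (f z) (f c)]

variable [FiniteDimensional ℂ E]

theorem clm_eq_sum_coord {κ : Type*} [Fintype κ] (b : Module.Basis κ ℂ E) (φ : E →L[ℂ] ℂ) :
    φ = ∑ n, φ (b n) • LinearMap.toContinuousLinearMap (b.coord n) := by
  ext v
  conv_lhs => rw [← b.sum_repr v, map_sum]
  simp only [map_smul, smul_eq_mul, sum_apply, smul_apply,
    LinearMap.coe_toContinuousLinearMap', Module.Basis.coord_apply, mul_comm]

theorem aestronglyMeasurable_clm_of_apply {T : Type*} [MeasurableSpace T] {μ : Measure T}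
    {φ : T → E →L[ℂ] ℂ} (h : ∀ v, AEStronglyMeasurable (fun t => φ t v) μ) :
    AEStronglyMeasurable φ μ := by
  let b := Module.finBasis ℂ E
  rw [show φ = fun t => ∑ n, φ t (b n) • LinearMap.toContinuousLinearMap (b.coord n) from
    funext fun t => clm_eq_sum_coord b (φ t)]
  exact Finset.aestronglyMeasurable_fun_sum _ fun n _ => (h (b n)).smul_const _

/-- The integral of a bounded family of holomorphic functions is holomorphic, and may be
differentiated under the integral sign. No bound on the derivatives is needed: Cauchy's estimate
provides one. -/
theorem hasFDerivAt_integral_of_bounded {T : Type*} [MeasurableSpace T] {μ : Measure T}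
    [IsFiniteMeasure μ] {f : E → T → ℂ} {s : Set E} {x : E} {M : ℝ} (hs : s ∈ 𝓝 x)
    (hmeas : ∀ y ∈ s, AEStronglyMeasurable (f y) μ)
    (hdiff : ∀ᵐ t ∂μ, DifferentiableOn ℂ (f · t) s)
    (hbound : ∀ᵐ t ∂μ, ∀ y ∈ s, ‖f y t‖ ≤ M) :
    Integrable (fun t => fderiv ℂ (f · t) x) μ ∧
      HasFDerivAt (fun y => ∫ t, f y t ∂μ) (∫ t, fderiv ℂ (f · t) x ∂μ) x := by
  obtain ⟨r, hr, hrs⟩ := Metric.mem_nhds_iff.1 hs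
  have hsub : ∀ y ∈ Metric.ball x (r / 2), Metric.ball y (r / 2) ⊆ s := fun y hy =>
    (Metric.ball_subset_ball' (by have := Metric.mem_ball.1 hy; linarith)).trans hrs
  have hmeas' : AEStronglyMeasurable (fun t => fderiv ℂ (f · t) x) μ := by
    refine aestronglyMeasurable_clm_of_apply fun v => ?_
    have hc : Tendsto (fun n : ℕ => ((n : ℂ))⁻¹) atTop (𝓝 0) := tendsto_inv_atTop_nhds_zero_nat
    have hev : ∀ᶠ n : ℕ in atTop, x + ((n : ℂ))⁻¹ • v ∈ s := by
      have : Tendsto (fun n : ℕ => x + ((n : ℂ))⁻¹ • v) atTop (𝓝 (x + (0 : ℂ) • v)) :=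
        tendsto_const_nhds.add (hc.smul_const v)
      rw [zero_smul, add_zero] at this
      exact this hs
    obtain ⟨K, hK⟩ := eventually_atTop.1 hev
    refine aestronglyMeasurable_of_tendsto_ae atTop
      (f := fun (n : ℕ) t => ((n + K : ℕ) : ℂ) • (f (x + (((n + K : ℕ) : ℂ))⁻¹ • v) t - f x t))
      (fun n => ((hmeas _ (hK (n + K) (by omega))).sub (hmeas x (mem_of_mem_nhds hs))).const_smul
        ((n + K : ℕ) : ℂ)) ?_
    filter_upwards [hdiff] with t ht
    refine (ht.differentiableAt hs).hasFDerivAt.lim v ?_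
    have : Tendsto (fun n : ℕ => ((n + K : ℕ) : ℝ)) atTop atTop :=
      tendsto_natCast_atTop_atTop.comp (tendsto_add_atTop_nat K)
    simpa only [Complex.norm_natCast] using this
  have hfd : ∀ᵐ t ∂μ, ∀ y ∈ Metric.ball x (r / 2), ‖fderiv ℂ (f · t) y‖ ≤ 2 * M / (r / 2) := by
    filter_upwards [hdiff, hbound] with t ht hb y hy
    exact norm_fderiv_le_of_forall_ball (by positivity) (ht.mono (hsub y hy))
      fun z hz => hb z (hsub y hy hz)
  refine ⟨Integrable.of_bound hmeas' (2 * M / (r / 2)) ?_, ?_⟩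
  · filter_upwards [hfd] with t ht using ht x (Metric.mem_ball_self (by positivity))
  · refine hasFDerivAt_integral_of_dominated_of_fderiv_le
      (F' := fun y t => fderiv ℂ (f · t) y) (bound := fun _ => 2 * M / (r / 2))
      (Metric.ball_mem_nhds x (by positivity : 0 < r / 2)) ?_ ?_ hmeas' hfd (integrable_const _) ?_
    · filter_upwards [hs] with y hy using hmeas y hy
    · refine Integrable.of_bound (hmeas x (mem_of_mem_nhds hs)) M ?_
      filter_upwards [hbound] with t ht using ht x (mem_of_mem_nhds hs)
    · filter_upwards [hdiff] with t ht y hy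
      exact (ht.differentiableAt (mem_of_superset (Metric.ball_mem_nhds y (by positivity))
        (hsub y hy))).hasFDerivAt

/-- Directional derivatives of holomorphic functions are holomorphic: by Cauchy's formula on small
discs in the given direction, such a derivative is an integral of holomorphic functions. -/
theorem differentiableOn_fderiv_apply {f : E → ℂ} {U : Set E} (hU : IsOpen U)
    (hf : DifferentiableOn ℂ f U) (v : E) : DifferentiableOn ℂ (fun z => fderiv ℂ f z v) U := by
  intro x hx
  obtain ⟨M, hM⟩ : ∃ M, ∀ᶠ y in 𝓝 x, ‖f y‖ ≤ M := by
    refine ⟨‖f x‖ + 1, ?_⟩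
    have := (hf.differentiableAt (hU.mem_nhds hx)).continuousAt.norm
    filter_upwards [this.eventually_lt_const (lt_add_one _)] with y hy using hy.le
  obtain ⟨δ, hδ, hball⟩ := Metric.mem_nhds_iff.1 (Filter.inter_mem (hU.mem_nhds hx) hM)
  obtain ⟨r, hr, hrv⟩ : ∃ r > 0, r * ‖v‖ < δ / 2 :=
    ⟨δ / 2 / (‖v‖ + 1), by positivity, by
      rw [div_mul_eq_mul_div, div_lt_iff₀ (by positivity)]; nlinarith [norm_nonneg v]⟩
  have hmem : ∀ z ∈ Metric.ball x (δ / 2), ∀ η : ℂ, ‖η‖ ≤ r → z + η • v ∈ Metric.ball x δ := by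
    intro z hz η hη
    rw [mem_ball_iff_norm] at hz ⊢
    calc ‖z + η • v - x‖ = ‖(z - x) + η • v‖ := by congr 1; abel
      _ ≤ ‖z - x‖ + ‖η‖ * ‖v‖ := (norm_add_le _ _).trans (by rw [norm_smul])
      _ < δ := by nlinarith [norm_nonneg v]
  have hfd : ∀ y ∈ Metric.ball x δ, DifferentiableAt ℂ f y := fun y hy =>
    hf.differentiableAt (hU.mem_nhds (hball hy).1)
  have hcomp : ∀ z ∈ Metric.ball x (δ / 2), ∀ η : ℂ, ‖η‖ ≤ r →
      HasDerivAt (fun η : ℂ => f (z + η • v)) (fderiv ℂ f (z + η • v) v) η := by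
    intro z hz η hη
    have h₁ : HasDerivAt (fun η : ℂ => z + η • v) v η := by
      simpa using ((hasDerivAt_id η).smul_const v).const_add z
    exact (hfd _ (hmem z hz η hη)).hasFDerivAt.comp_hasDerivAt η h₁
  have hcauchy : ∀ z ∈ Metric.ball x (δ / 2), fderiv ℂ f z v =
      (2 * Real.pi * Complex.I)⁻¹ * ∫ θ in Set.Ioc 0 (2 * Real.pi), deriv (circleMap 0 r) θ •
        ((circleMap 0 r θ - 0)⁻¹ ^ 2 • f (z + circleMap 0 r θ • v)) := by
    intro z hz
    have hd : DiffContOnCl ℂ (fun η : ℂ => f (z + η • v)) (Metric.ball 0 r) := by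
      apply DifferentiableOn.diffContOnCl
      rw [closure_ball _ hr.ne']
      intro η hη
      exact (hcomp z hz η (by simpa using hη)).differentiableAt.differentiableWithinAt
    have := hd.circleIntegral_one_div_sub_center_pow_smul hr 1
    rw [iteratedDeriv_one, (hcomp z hz 0 (by simpa using hr.le)).deriv, circleIntegral,
      intervalIntegral.integral_of_le (by positivity)] at this
    simp only [zero_smul, add_zero, one_div] at this
    simp only [inv_pow]
    rw [show (1 + 1 : ℕ) = 2 from rfl] at this
    rw [this]
    have h2 : (2 * Real.pi * Complex.I : ℂ) ≠ 0 := Complex.two_pi_I_ne_zero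
    simp only [Nat.factorial, smul_eq_mul]
    field_simp
    simp
  have hs : Metric.ball x (δ / 2) ∈ 𝓝 x := Metric.ball_mem_nhds x (by positivity)
  have key := (hasFDerivAt_integral_of_bounded
    (μ := volume.restrict (Set.Ioc (0 : ℝ) (2 * Real.pi)))
    (f := fun z θ => deriv (circleMap 0 r) θ •
        ((circleMap 0 r θ - 0)⁻¹ ^ 2 • f (z + circleMap 0 r θ • v)))
    (s := Metric.ball x (δ / 2)) (M := |r| * (|r|⁻¹ ^ 2 * M)) hs ?_ ?_ ?_).2
  · refine ((key.differentiableAt.const_mul (2 * Real.pi * Complex.I)⁻¹).congr_of_eventuallyEq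
      (f₁ := fun z => fderiv ℂ f z v) ?_).differentiableWithinAt
    filter_upwards [hs] with z hz using hcauchy z hz
  · intro z hz
    refine Continuous.aestronglyMeasurable ?_
    have h₁ : Continuous fun θ => f (z + circleMap 0 r θ • v) := by
      rw [continuous_iff_continuousAt]
      intro θ
      have : ContinuousAt (fun η : ℂ => f (z + η • v)) (circleMap 0 r θ) :=
        (hcomp z hz _ (by simp [abs_of_pos hr])).continuousAt
      exact ContinuousAt.comp (f := circleMap 0 r) this (continuous_circleMap 0 r).continuousAt
    simp only [deriv_circleMap, sub_zero]
    have h₂ : Continuous fun θ => (circleMap 0 r θ)⁻¹ :=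
      (continuous_circleMap 0 r).inv₀ fun θ => circleMap_ne_center hr.ne'
    exact ((continuous_circleMap 0 r).mul continuous_const).smul ((h₂.pow 2).smul h₁)
  · refine Eventually.of_forall fun θ z hz => ?_
    have h₁ : DifferentiableAt ℂ f (z + circleMap 0 r θ • v) :=
      hfd _ (hmem z hz _ (by simp [abs_of_pos hr]))
    have h₂ : DifferentiableAt ℂ (fun z => f (z + circleMap 0 r θ • v)) z :=
      DifferentiableAt.comp (f := fun z : E => z + circleMap 0 r θ • v) z h₁
        (differentiableAt_id.add_const _)
    exact DifferentiableAt.differentiableWithinAt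
      ((h₂.fun_const_smul _).fun_const_smul (deriv (circleMap 0 r) θ))
  · refine Eventually.of_forall fun θ z hz => ?_
    have h₁ := (hball (hmem z hz (circleMap 0 r θ) (by simp [abs_of_pos hr]))).2
    simp only [deriv_circleMap, norm_smul, norm_mul, norm_circleMap_zero, Complex.norm_I, mul_one,
      sub_zero, norm_pow, norm_inv]
    gcongr
    exact h₁

theorem differentiableOn_fderiv {f : E → ℂ} {U : Set E} (hU : IsOpen U)
    (hf : DifferentiableOn ℂ f U) : DifferentiableOn ℂ (fderiv ℂ f) U := by
  let b := Module.finBasis ℂ E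
  rw [show fderiv ℂ f =
      fun z => ∑ n, fderiv ℂ f z (b n) • LinearMap.toContinuousLinearMap (b.coord n) from
    funext fun z => clm_eq_sum_coord b (fderiv ℂ f z)]
  exact DifferentiableOn.fun_sum fun n _ =>
    (differentiableOn_fderiv_apply hU hf (b n)).smul_const _

theorem fderiv_fderiv_apply_comm {f : E → ℂ} {U : Set E} (hU : IsOpen U)
    (hf : DifferentiableOn ℂ f U) {x : E} (hx : x ∈ U) (v w : E) :
    fderiv ℂ (fun z => fderiv ℂ f z w) x v = fderiv ℂ (fun z => fderiv ℂ f z v) x w := by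
  have h₂ := ((differentiableOn_fderiv hU hf).differentiableAt (hU.mem_nhds hx)).hasFDerivAt
  have hsymm := second_derivative_symmetric_of_eventually (f := f) (f' := fderiv ℂ f)
    (by filter_upwards [hU.mem_nhds hx] with y hy
        using (hf.differentiableAt (hU.mem_nhds hy)).hasFDerivAt) h₂ v w
  have happ : ∀ w, HasFDerivAt (fun z => fderiv ℂ f z w)
      ((ContinuousLinearMap.apply ℂ ℂ w).comp (fderiv ℂ (fderiv ℂ f) x)) x := fun w =>
    (ContinuousLinearMap.apply ℂ ℂ w).hasFDerivAt.comp x h₂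
  rw [(happ w).fderiv, (happ v).fderiv]
  exact hsymm

end SeveralVariables

/-! ### Partial derivatives on the slice -/

section PartialDerivatives

variable {lam : TuplePartition N} {p q : Idx lam} {f g : Vec lam → ℂ} {x : Vec lam}

theorem D_congr (h : f =ᶠ[𝓝 x] g) : D p f x = D p g x := by
  rw [D, D, h.fderiv_eq]

theorem D_add (hf : DifferentiableAt ℂ f x) (hg : DifferentiableAt ℂ g x) :
    D p (fun y => f y + g y) x = D p f x + D p g x := by
  simp [D, fderiv_fun_add hf hg]

theorem D_sub (hf : DifferentiableAt ℂ f x) (hg : DifferentiableAt ℂ g x) :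
    D p (fun y => f y - g y) x = D p f x - D p g x := by
  simp [D, fderiv_fun_sub hf hg]

theorem D_mul (hf : DifferentiableAt ℂ f x) (hg : DifferentiableAt ℂ g x) :
    D p (fun y => f y * g y) x = D p f x * g x + f x * D p g x := by
  simp [D, fderiv_fun_mul hf hg]
  ring

theorem D_const (c : ℂ) : D p (fun _ => c) x = 0 := by
  simp [D]

theorem D_const_mul (c : ℂ) (hf : DifferentiableAt ℂ f x) :
    D p (fun y => c * f y) x = c * D p f x := by
  simp [D, fderiv_const_mul hf]

theorem D_exp (hf : DifferentiableAt ℂ f x) :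
    D p (fun y => Complex.exp (f y)) x = Complex.exp (f x) * D p f x := by
  simp [D, hf.hasFDerivAt.cexp.fderiv]

theorem D_inv (hf : DifferentiableAt ℂ f x) (h0 : f x ≠ 0) :
    D p (fun y => (f y)⁻¹) x = -D p f x / f x ^ 2 := by
  have := (hasDerivAt_inv h0).comp_hasFDerivAt x hf.hasFDerivAt
  rw [D, show (fun y => (f y)⁻¹) = Inv.inv ∘ f from rfl, this.fderiv]
  simp [D]
  field_simp

theorem D_coord (r : Idx lam) : D p (fun y => y r) x = if r = p then 1 else 0 := by
  have : HasFDerivAt (fun y : Vec lam => y r) (ContinuousLinearMap.proj r) x :=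
    (ContinuousLinearMap.proj (R := ℂ) (φ := fun _ : Idx lam => ℂ) r).hasFDerivAt
  rw [D, this.fderiv]
  simp [Pi.single_apply]

theorem differentiableOn_D {Ω : Set (Vec lam)} (hΩ : IsOpen Ω) (hf : DifferentiableOn ℂ f Ω) :
    DifferentiableOn ℂ (D p f) Ω :=
  differentiableOn_fderiv_apply hΩ hf _

theorem D_comm {Ω : Set (Vec lam)} (hΩ : IsOpen Ω) (hf : DifferentiableOn ℂ f Ω) (hx : x ∈ Ω) :
    D p (D q f) x = D q (D p f) x :=
  fderiv_fderiv_apply_comm hΩ hf hx _ _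

/-- A branch `f` of `log g` has logarithmic derivative `D g / g`. -/
theorem D_eq_div_of_exp_eq (hf : DifferentiableAt ℂ f x)
    (h : ∀ᶠ y in 𝓝 x, Complex.exp (f y) = g y) : D p f x = D p g x / g x := by
  rw [← D_congr h, D_exp hf, ← h.self_of_nhds, mul_div_cancel_left₀ _ (Complex.exp_ne_zero _)]

end PartialDerivatives

/-! ### The bilinear form of the Toda-Hirota equation -/

section Bilinear

variable {lam : TuplePartition N} {p q : Idx lam} {Ω : Set (Vec lam)}

/-- Hirota's bilinear form `τ D_p D_q τ - D_p τ D_q τ = τ_{m+1} τ_{m-1}` implies the equation for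
every branch of `log τ`. -/
theorem solvesToda_of_bilinear (hΩ : IsOpen Ω) {τ : ℤ → Vec lam → ℂ}
    (hd : ∀ m, DifferentiableOn ℂ (τ m) Ω)
    (h : ∀ m, ∀ x ∈ Ω, τ m x * D p (D q (τ m)) x - D p (τ m) x * D q (τ m) x =
      τ (m + 1) x * τ (m - 1) x) : SolvesToda Ω p q τ := by
  refine fun m => ⟨hd m, fun x hx h0 φ hφ => ?_⟩
  have hτ : ∀ᶠ y in 𝓝 x, DifferentiableAt ℂ (τ m) y := by
    filter_upwards [hΩ.mem_nhds hx] with y hy using (hd m).differentiableAt (hΩ.mem_nhds hy)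
  have hq : D q φ =ᶠ[𝓝 x] fun y => D q (τ m) y * (τ m y)⁻¹ := by
    filter_upwards [hφ.eventually_nhds] with y hy
    rw [← div_eq_mul_inv]
    exact D_eq_div_of_exp_eq hy.self_of_nhds.1 (hy.mono fun z hz => hz.2)
  have hτx := hτ.self_of_nhds
  rw [D_congr hq, D_mul ((differentiableOn_D hΩ (hd m)).differentiableAt (hΩ.mem_nhds hx))
    (hτx.fun_inv h0), D_inv hτx h0, ← h m x hx]
  field_simp
  ring

theorem SolvesToda.congr (hΩ : IsOpen Ω) {τ σ : ℤ → Vec lam → ℂ} (h : SolvesToda Ω p q τ)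
    (heq : ∀ m, ∀ x ∈ Ω, σ m x = τ m x) : SolvesToda Ω p q σ := by
  refine fun m => ⟨(h m).1.congr (heq m), fun x hx h0 φ hφ => ?_⟩
  rw [heq (m + 1) x hx, heq (m - 1) x hx, heq m x hx]
  rw [heq m x hx] at h0
  refine (h m).2 x hx h0 φ ?_
  filter_upwards [hφ, hΩ.mem_nhds hx] with y hy hyΩ
  rwa [heq m y hyΩ] at hy

/-- The gauge transformation `τ_m = K_m exp(ψ_m) u_m` for the Toda-Hirota equation. -/
theorem solvesToda_exp_mul (hΩ : IsOpen Ω) {u ψ : ℤ → Vec lam → ℂ} {K b c : ℤ → ℂ}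
    {L X : Vec lam → ℂ} (hu : ∀ m, DifferentiableOn ℂ (u m) Ω)
    (hψ : ∀ m, DifferentiableOn ℂ (ψ m) Ω) (hL : ∀ x ∈ Ω, Complex.exp (L x) = X x)
    (hpq : ∀ m, ∀ x ∈ Ω, D p (D q (ψ m)) x = b m / X x ^ 2)
    (hdiff : ∀ m, ∀ x ∈ Ω, ψ (m + 1) x + ψ (m - 1) x = 2 * ψ m x - 2 * L x)
    (hK : ∀ m, K (m + 1) * K (m - 1) = c m * K m ^ 2)
    (hbil : ∀ m, ∀ x ∈ Ω, c m * (u (m + 1) x * u (m - 1) x) =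
      X x ^ 2 * (u m x * D p (D q (u m)) x - D p (u m) x * D q (u m) x) + b m * u m x ^ 2) :
    SolvesToda Ω p q (fun m x => K m * Complex.exp (ψ m x) * u m x) := by
  have hat : ∀ {f : Vec lam → ℂ}, DifferentiableOn ℂ f Ω → ∀ {x}, x ∈ Ω → DifferentiableAt ℂ f x :=
    fun hf _ hx => hf.differentiableAt (hΩ.mem_nhds hx)
  have hexp : ∀ m, DifferentiableOn ℂ (fun x => K m * Complex.exp (ψ m x)) Ω := fun m =>
    (hψ m).cexp.const_mul _
  have hD : ∀ r m, ∀ x ∈ Ω, D r (fun x => K m * Complex.exp (ψ m x) * u m x) x =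
      K m * Complex.exp (ψ m x) * (D r (ψ m) x * u m x + D r (u m) x) := by
    intro r m x hx
    rw [D_mul (hat (hexp m) hx) (hat (hu m) hx), D_const_mul _ (hat (hψ m) hx).cexp,
      D_exp (hat (hψ m) hx)]
    ring
  refine solvesToda_of_bilinear hΩ (fun m => (hexp m).mul (hu m)) fun m x hx => ?_
  have hψq := differentiableOn_D (p := q) hΩ (hψ m)
  have huq := differentiableOn_D (p := q) hΩ (hu m)
  have hev : D q (fun x => K m * Complex.exp (ψ m x) * u m x) =ᶠ[𝓝 x]
      fun x => K m * Complex.exp (ψ m x) * (D q (ψ m) x * u m x + D q (u m) x) := by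
    filter_upwards [hΩ.mem_nhds hx] with y hy using hD q m y hy
  rw [D_congr hev, hD p m x hx, hD q m x hx,
    D_mul (hat (hexp m) hx) ((hat (hψq.fun_mul (hu m)) hx).fun_add (hat huq hx)),
    D_const_mul _ (hat (hψ m) hx).cexp, D_exp (hat (hψ m) hx),
    D_add (hat (hψq.fun_mul (hu m)) hx) (hat huq hx), D_mul (hat hψq hx) (hat (hu m) hx), hpq m x hx]
  have hX : X x ≠ 0 := by rw [← hL x hx]; exact Complex.exp_ne_zero _
  have hE : Complex.exp (ψ (m + 1) x) * Complex.exp (ψ (m - 1) x) =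
      Complex.exp (ψ m x) ^ 2 / X x ^ 2 := by
    rw [← Complex.exp_add, hdiff m x hx, Complex.exp_sub, ← hL x hx, ← Complex.exp_nat_mul,
      ← Complex.exp_nat_mul]
    norm_num
  calc _ = K m ^ 2 * Complex.exp (ψ m x) ^ 2 / X x ^ 2 *
        (X x ^ 2 * (u m x * D p (D q (u m)) x - D p (u m) x * D q (u m) x) + b m * u m x ^ 2) := by
        field_simp
        ring
    _ = (c m * K m ^ 2) * (Complex.exp (ψ m x) ^ 2 / X x ^ 2) * (u (m + 1) x * u (m - 1) x) := by
        rw [← hbil m x hx]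
        ring
    _ = _ := by
        rw [← hK, ← hE]
        ring

end Bilinear

/-! ### Indices and parameters -/

section Indices

variable {lam : TuplePartition N} {i j k l : Fin lam.len}

theorem last_ne_first (h : k ≠ l) : last lam k ≠ first lam l := fun e =>
  h (congrArg Sigma.fst e)

theorem last_ne_last (h : k ≠ l) : last lam k ≠ last lam l := fun e =>
  h (congrArg Sigma.fst e)

theorem last_eq_first_iff : last lam k = first lam k ↔ lam.part k = 1 := by
  have := lam.part_pos k
  simp only [last, first, Sigma.mk.injEq, heq_eq_eq, Fin.mk.injEq, true_and]
  omega

theorem first_eq_last_iff : first lam k = last lam k ↔ lam.part k = 1 :=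
  eq_comm.trans last_eq_first_iff

theorem eq_and_part_eq_one_of_last_eq_first (h : last lam k = first lam l) :
    k = l ∧ lam.part k = 1 := by
  obtain rfl : k = l := congrArg Sigma.fst h
  exact ⟨rfl, last_eq_first_iff.1 h⟩

theorem shift_zero (α : Vec lam) : shift α i j 0 = α := by
  simp [shift]

theorem shift_shift (α : Vec lam) (m n : ℤ) :
    shift (shift α i j m) i j n = shift α i j (m + n) := by
  simp [shift, add_smul, add_assoc]

theorem shift_swap (α : Vec lam) (m : ℤ) : shift α j i m = shift α i j (-m) := by
  simp only [shift, Int.cast_neg, neg_smul, smul_sub]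
  abel

theorem shift_last_left (hij : i ≠ j) (α : Vec lam) (m : ℤ) :
    shift α i j m (last lam i) = α (last lam i) + if lam.part i = 1 then (m : ℂ) else 0 := by
  simp [shift, Pi.single_apply, last_ne_first hij, last_eq_first_iff]

theorem shift_last_right (hij : i ≠ j) (α : Vec lam) (m : ℤ) :
    shift α i j m (last lam j) = α (last lam j) - if lam.part j = 1 then (m : ℂ) else 0 := by
  rw [shift_swap, shift_last_left hij.symm]
  split_ifs <;> simp [sub_eq_add_neg]

theorem cConst_ne_zero {α : Vec lam} (hα : IsGeneric α) (m : ℤ) : cConst i j α m ≠ 0 := by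
  have key : ∀ (k : Fin lam.len) (n : ℤ),
      α (last lam k) + (if lam.part k = 1 then (n : ℂ) else 0) ≠ 0 := by
    intro k n
    split_ifs with h
    · intro h0
      refine hα.2.1 k h (-n) ?_
      push_cast
      linear_combination h0
    · rw [add_zero]
      exact hα.1 k (by have := lam.part_pos k; omega)
  refine mul_ne_zero (key i m) ?_
  have := key j (1 - m)
  split_ifs at this ⊢
  · push_cast at this
    convert this using 1
    ring
  · simpa using this

theorem cConst_succ (hij : i ≠ j) (α : Vec lam) (m : ℤ) : cConst i j α (m + 1) =
    (shift α i j m (last lam i) + if lam.part i = 1 then 1 else 0) *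
      shift α i j m (last lam j) := by
  rw [cConst, shift_last_left hij, shift_last_right hij]
  split_ifs <;> push_cast <;> ring

end Indices

/-! ### Ladders of solutions of the Euler-Poisson-Darboux equation -/

section Ladder

variable {lam : TuplePartition N} {i j : Fin lam.len} {Ω : Set (Vec lam)}

/-- The Euler-Poisson-Darboux equation
`(x_0^{(i)} - x_0^{(j)}) D_p D_q v = β_p D_q v - β_q D_p v`, for `p`, `q` the last indices of the
blocks `i`, `j`. -/
def EPD (i j : Fin lam.len) (β : Vec lam) (v : Vec lam → ℂ) (x : Vec lam) : Prop :=
  (x (first lam i) - x (first lam j)) * D (last lam i) (D (last lam j) v) x =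
    β (last lam i) * D (last lam j) v x - β (last lam j) * D (last lam i) v x

theorem contig_congr {β : Vec lam} {u v : Vec lam → ℂ} {x : Vec lam} (h : u =ᶠ[𝓝 x] v) :
    contig i j β u x = contig i j β v x := by
  rw [contig, contig, D_congr h, h.self_of_nhds]

theorem contig_const_mul {β : Vec lam} {v : Vec lam → ℂ} {x : Vec lam} (c : ℂ)
    (hv : DifferentiableAt ℂ v x) :
    contig i j β (fun y => c * v y) x = c * contig i j β v x := by
  rw [contig, contig, D_const_mul c hv]
  ring

theorem D_last_contig (hij : i ≠ j) (hΩ : IsOpen Ω) {v : Vec lam → ℂ}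
    (hv : DifferentiableOn ℂ v Ω) (β : Vec lam) {x : Vec lam} (hx : x ∈ Ω) :
    D (last lam i) (contig i j β v) x =
      (if lam.part i = 1 then 1 else 0) * D (last lam j) v x +
      (x (first lam i) - x (first lam j)) * D (last lam i) (D (last lam j) v) x +
      β (last lam j) * D (last lam i) v x := by
  have h₁ := (differentiableOn_D (p := last lam j) hΩ hv).differentiableAt (hΩ.mem_nhds hx)
  have h₂ := hv.differentiableAt (hΩ.mem_nhds hx)
  have h₃ : DifferentiableAt ℂ (fun x : Vec lam => x (first lam i) - x (first lam j)) x := by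
    fun_prop
  unfold contig
  rw [D_add (h₃.fun_mul h₁) (h₂.const_mul _), D_mul h₃ h₁, D_const_mul _ h₂,
    D_sub (by fun_prop) (by fun_prop), D_coord, D_coord,
    if_neg (last_ne_first hij).symm]
  simp only [first_eq_last_iff, sub_zero]

/-- For `v` with parameter `β_m = α + m(ε^{(i)} - ε^{(j)})`, lowering after raising is
multiplication by `c_{m+1}` exactly when `v` solves the Euler-Poisson-Darboux equation. -/
theorem contig_contig_iff (hij : i ≠ j) (hΩ : IsOpen Ω) {v : Vec lam → ℂ}
    (hv : DifferentiableOn ℂ v Ω) (α : Vec lam) (m : ℤ) {x : Vec lam} (hx : x ∈ Ω)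
    (hX : x (first lam i) - x (first lam j) ≠ 0) :
    contig j i (shift α i j (m + 1)) (contig i j (shift α i j m) v) x =
      cConst i j α (m + 1) * v x ↔ EPD i j (shift α i j m) v x := by
  have hp : shift α i j (m + 1) (last lam i) =
      shift α i j m (last lam i) + if lam.part i = 1 then 1 else 0 := by
    rw [shift_last_left hij, shift_last_left hij]
    split_ifs <;> push_cast <;> ring
  rw [EPD, contig, D_last_contig hij hΩ hv _ hx, cConst_succ hij, hp, contig]
  constructor
  · intro h
    refine mul_left_cancel₀ hX ?_
    linear_combination -h
  · intro h
    linear_combination (-(x (first lam i) - x (first lam j))) * h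

/-- A sequence `u_m` of holomorphic functions linked by the contiguity operators:
`contig i j` raises `u_m` to `u_{m+1}`, and `contig j i` lowers it to `c_m u_{m-1}`. -/
structure IsLadder (i j : Fin lam.len) (α : Vec lam) (Ω : Set (Vec lam))
    (u : ℤ → Vec lam → ℂ) : Prop where
  holo : ∀ m, DifferentiableOn ℂ (u m) Ω
  raise : ∀ m, ∀ x ∈ Ω, contig i j (shift α i j m) (u m) x = u (m + 1) x
  lower : ∀ m, ∀ x ∈ Ω, contig j i (shift α i j m) (u m) x = cConst i j α m * u (m - 1) x

theorem IsLadder.epd {α : Vec lam} {u : ℤ → Vec lam → ℂ} (h : IsLadder i j α Ω u) (hij : i ≠ j)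
    (hΩ : IsOpen Ω) (m : ℤ) {x : Vec lam} (hx : x ∈ Ω)
    (hX : x (first lam i) - x (first lam j) ≠ 0) : EPD i j (shift α i j m) (u m) x := by
  rw [← contig_contig_iff hij hΩ (h.holo m) α m hx hX]
  have hev : contig i j (shift α i j m) (u m) =ᶠ[𝓝 x] u (m + 1) := by
    filter_upwards [hΩ.mem_nhds hx] with y hy using h.raise m y hy
  rw [contig_congr hev, h.lower (m + 1) x hx, add_sub_cancel_right]

theorem IsLadder.bilinear {α : Vec lam} {u : ℤ → Vec lam → ℂ} (h : IsLadder i j α Ω u)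
    (hij : i ≠ j) (hΩ : IsOpen Ω) (m : ℤ) {x : Vec lam} (hx : x ∈ Ω)
    (hX : x (first lam i) - x (first lam j) ≠ 0) :
    cConst i j α m * (u (m + 1) x * u (m - 1) x) =
      (x (first lam i) - x (first lam j)) ^ 2 * (u m x * D (last lam i) (D (last lam j) (u m)) x -
        D (last lam i) (u m) x * D (last lam j) (u m) x) +
      shift α i j m (last lam i) * shift α i j m (last lam j) * u m x ^ 2 := by
  have h₁ := h.raise m x hx
  have h₂ := h.lower m x hx
  have h₃ := h.epd hij hΩ m hx hX
  rw [contig] at h₁ h₂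
  rw [EPD] at h₃
  rw [← h₁, mul_left_comm, ← h₂]
  linear_combination (-(x (first lam i) - x (first lam j)) * u m x) * h₃

end Ladder

/-! ### The constants of the seed solutions -/

section Constants

/-- A sequence with consecutive ratios `R` upwards and `S` downwards from `0` satisfies
`T_{m+1} T_{m-1} = c_m T_m²` as soon as the ratios are multiplied by `c_m` at each step. -/
theorem mul_eq_mul_sq_of_ratio {T R S c : ℤ → ℂ} (hpos : ∀ m, 0 ≤ m → T (m + 1) = R m * T m)
    (hneg : ∀ m, m ≤ 0 → T (m - 1) = S m * T m) (hR : ∀ m, 1 ≤ m → R m = c m * R (m - 1))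
    (hS : ∀ m, m ≤ -1 → S m = c m * S (m + 1)) (h0 : R 0 * S 0 = c 0) (m : ℤ) :
    T (m + 1) * T (m - 1) = c m * T m ^ 2 := by
  rcases lt_trichotomy m 0 with h | rfl | h
  · have h₁ := hneg (m + 1) (by omega)
    rw [add_sub_cancel_right] at h₁
    rw [hneg m h.le, hS m (by omega), sq, h₁]
    ring
  · rw [hpos 0 le_rfl, hneg 0 le_rfl, ← h0]
    ring
  · have h₁ := hpos (m - 1) (by omega)
    rw [sub_add_cancel] at h₁
    rw [hpos m h.le, hR m (by omega), sq, h₁]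
    ring

theorem zpow_half_succ {b : ℂ} (hb : b ≠ 0) (m : ℤ) :
    b ^ ((m + 1) * (m + 1 - 1) / 2) = b ^ m * b ^ (m * (m - 1) / 2) := by
  rw [← zpow_add₀ hb, show (m + 1) * (m + 1 - 1) = m * (m - 1) + m * 2 by ring,
    Int.add_mul_ediv_right _ _ two_ne_zero, add_comm]

theorem zpow_half_pred {b : ℂ} (hb : b ≠ 0) (m : ℤ) :
    b ^ ((m - 1) * (m - 1 - 1) / 2) = b ^ (1 - m) * b ^ (m * (m - 1) / 2) := by
  rw [← zpow_add₀ hb, show (m - 1) * (m - 1 - 1) = m * (m - 1) + (1 - m) * 2 by ring,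
    Int.add_mul_ediv_right _ _ two_ne_zero, add_comm]

theorem tConst₁_mul {A : ℂ} (hA : A ≠ 0) (a b : ℂ) (m : ℤ) :
    tConst₁ A a b (m + 1) * tConst₁ A a b (m - 1) = pPoly a b m * tConst₁ A a b m ^ 2 := by
  refine mul_eq_mul_sq_of_ratio (R := fun m => A * ∏ l ∈ Finset.Icc (1 : ℤ) m, pPoly a b l)
    (S := fun m => A⁻¹ * ∏ l ∈ Finset.Icc m 0, pPoly a b l) (fun m hm => ?_) (fun m hm => ?_)
    (fun m hm => ?_) (fun m hm => ?_) ?_ m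
  · rw [tConst₁, tConst₁, if_pos hm, if_pos (by omega),
      show Finset.Ico 0 (m + 1) = insert m (Finset.Ico 0 m) by ext; simp; omega,
      Finset.prod_insert (by simp), zpow_add_one₀ hA]
    ring
  · -- The second branch of the definition also gives the value at `m = 0`.
    have hT : tConst₁ A a b m = A ^ m *
        ∏ k ∈ Finset.Icc (1 : ℤ) |m|, ∏ l ∈ Finset.Icc (-k + 1) (0 : ℤ), pPoly a b l := by
      rcases hm.lt_or_eq with h | rfl
      · rw [tConst₁, if_neg (by omega)]
      · simp [tConst₁]
    rw [hT, tConst₁, if_neg (by omega), abs_of_nonpos hm, abs_of_neg (by omega : m - 1 < 0),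
      show Finset.Icc 1 (-(m - 1)) = insert (1 - m) (Finset.Icc 1 (-m)) by ext; simp; omega,
      Finset.prod_insert (by simp), zpow_sub_one₀ hA,
      show -(1 - m) + 1 = m by ring]
    ring
  · rw [show Finset.Icc 1 m = insert m (Finset.Icc 1 (m - 1)) by ext; simp; omega,
      Finset.prod_insert (by simp)]
    ring
  · rw [show Finset.Icc m 0 = insert m (Finset.Icc (m + 1) 0) by ext; simp; omega,
      Finset.prod_insert (by simp)]
    ring
  · simp [hA]

theorem gammaSymbol_succ {a : ℂ} (ha : ∀ n : ℤ, a ≠ n) {m : ℤ} (hm : 1 ≤ m) :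
    gammaSymbol a (m + 1) = (a + m) * gammaSymbol a m := by
  have hne : a + m ≠ 0 := fun h => ha (-m) (by push_cast; linear_combination h)
  rw [gammaSymbol, gammaSymbol, if_pos hm, if_pos (by omega)]
  push_cast
  rw [← add_assoc, Complex.Gamma_add_one _ hne]
  ring

theorem gammaSymbol_pred {a : ℂ} (ha : ∀ n : ℤ, a ≠ n) {m : ℤ} (hm : m ≤ -1) :
    gammaSymbol a (m - 1) = (a + m) * gammaSymbol a m := by
  have hne : a + m ≠ 0 := fun h => ha (-m) (by push_cast; linear_combination h)
  have hG : Complex.Gamma (a + m) ≠ 0 := Complex.Gamma_ne_zero fun n h =>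
    ha (-n - m) (by push_cast; linear_combination h)
  rw [gammaSymbol, gammaSymbol, if_neg (by omega), if_neg (by omega), if_neg (by omega),
    if_neg (by omega)]
  push_cast
  rw [show a + 1 + (m - 1) = a + m by ring, show a + 1 + (m : ℂ) = a + m + 1 by ring,
    Complex.Gamma_add_one (a + m) hne]
  field_simp

theorem gammaSymbol_one_mul_neg_one {a : ℂ} (ha : ∀ n : ℤ, a ≠ n) :
    gammaSymbol a 1 * gammaSymbol a (-1) = a := by
  have hne : a ≠ 0 := by exact_mod_cast ha 0
  have hG : Complex.Gamma a ≠ 0 := Complex.Gamma_ne_zero fun n h =>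
    ha (-n) (by push_cast; exact h)
  simp only [gammaSymbol, le_refl, if_true, Int.cast_one, Int.cast_neg, add_neg_cancel_right]
  rw [if_neg (by omega), if_neg (by omega), Complex.Gamma_add_one a hne]
  field_simp

theorem tConst₂_mul {A a b : ℂ} (hA : A ≠ 0) (hb : b ≠ 0) (ha : ∀ n : ℤ, a ≠ n) (m : ℤ) :
    tConst₂ A a b (m + 1) * tConst₂ A a b (m - 1) = (a + m) * b * tConst₂ A a b m ^ 2 := by
  refine mul_eq_mul_sq_of_ratio (c := fun m => (a + m) * b)
    (R := fun m => A * gammaSymbol a (m + 1) * b ^ m)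
    (S := fun m => A⁻¹ * gammaSymbol a (m - 1) * b ^ (1 - m)) (fun m hm => ?_) (fun m hm => ?_)
    (fun m hm => ?_) (fun m hm => ?_) ?_ m
  · rw [tConst₂, tConst₂, zpow_half_succ hb, zpow_add_one₀ hA, min_eq_left hm, max_eq_right hm,
      min_eq_left (by omega), max_eq_right (by omega),
      show Finset.Icc 0 (m + 1) = insert (m + 1) (Finset.Icc 0 m) by ext; simp; omega,
      Finset.prod_insert (by simp)]
    ring
  · rw [tConst₂, tConst₂, zpow_half_pred hb, zpow_sub_one₀ hA, min_eq_right hm, max_eq_left hm,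
      min_eq_right (by omega), max_eq_left (by omega),
      show Finset.Icc (m - 1) 0 = insert (m - 1) (Finset.Icc m 0) by ext; simp; omega,
      Finset.prod_insert (by simp)]
    ring
  · rw [gammaSymbol_succ ha hm, sub_add_cancel, zpow_sub_one₀ hb]
    field_simp
  · rw [gammaSymbol_pred ha hm, add_sub_cancel_right, show 1 - (m + 1) = -m by ring,
      show 1 - m = -m + 1 by ring, zpow_add_one₀ hb]
    ring
  · simp only [zero_add, zero_sub, zpow_zero, sub_zero, zpow_one, Int.cast_zero, add_zero]
    linear_combination b * gammaSymbol_one_mul_neg_one ha +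
      b * gammaSymbol a 1 * gammaSymbol a (-1) * mul_inv_cancel₀ hA

theorem tConst₃_mul {A a b : ℂ} (hA : A ≠ 0) (hab : a * b ≠ 0) (m : ℤ) :
    tConst₃ A a b (m + 1) * tConst₃ A a b (m - 1) = a * b * tConst₃ A a b m ^ 2 := by
  rw [tConst₃, tConst₃, tConst₃, zpow_half_succ hab, zpow_half_pred hab, zpow_add_one₀ hA,
    zpow_sub_one₀ hA, sub_eq_add_neg 1 m, zpow_add₀ hab, zpow_neg, zpow_one]
  have := zpow_ne_zero m hab
  field_simp

end Constants

/-! ### Seed solutions and gauge factors as exponentials -/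

section Seed

variable {lam : TuplePartition N} {i j : Fin lam.len} {Ω : Set (Vec lam)}

/-- The constant factor of the seed solution. -/
def seedConst (i j : Fin lam.len) (α : Vec lam) (A : ℂ) (m : ℤ) : ℂ :=
  if lam.part i = 1 ∧ lam.part j = 1 then tConst₁ A (α (first lam i)) (α (first lam j)) m
  else if lam.part i = 1 then tConst₂ A (α (first lam i)) (α (last lam j)) m
  else tConst₃ A (α (last lam i)) (α (last lam j)) m

/-- The logarithm of the seed solution, up to a constant. -/
def seedExp (i j : Fin lam.len) (α : Vec lam) (L : Vec lam → ℂ) (m : ℤ) (x : Vec lam) : ℂ :=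
  if lam.part i = 1 ∧ lam.part j = 1 then
    pPoly (α (first lam i)) (α (first lam j)) m * L x
  else if lam.part i = 1 then
    -((α (first lam i) + m) * α (last lam j)) *
      (x (last lam j) * (x (first lam i) - x (first lam j))⁻¹) + -(m * (m + 1)) * L x
  else
    α (last lam i) * α (last lam j) *
      (x (last lam j) * (x (last lam i) * ((x (first lam i) - x (first lam j))⁻¹ *
        (x (first lam i) - x (first lam j))⁻¹))) + -(m * (m + 1)) * L x

/-- The logarithm of the gauge factor. -/
def gaugeExp (i j : Fin lam.len) (α : Vec lam) (L : Vec lam → ℂ) (m : ℤ) (x : Vec lam) : ℂ :=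
  if lam.part i = 1 then -(α (first lam i) + m) * L x
  else -α (last lam i) * (x (last lam i) * (x (first lam i) - x (first lam j))⁻¹)

theorem gaugeFactor_eq (α : Vec lam) (L : Vec lam → ℂ) (m : ℤ) (x : Vec lam) :
    gaugeFactor i j α L m x = Complex.exp (gaugeExp i j α L m x) := by
  rw [gaugeFactor, gaugeExp]
  split_ifs
  · rfl
  · congr 1
    ring

theorem seed_eq (α : Vec lam) (A : ℂ) {L : Vec lam → ℂ} (m : ℤ) {x : Vec lam}
    (hL : Complex.exp (L x) = x (first lam i) - x (first lam j)) :
    seed i j α A L m x = seedConst i j α A m * Complex.exp (seedExp i j α L m x) := by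
  have hpow : (x (first lam i) - x (first lam j)) ^ (-(m * (m + 1))) =
      Complex.exp (-(m * (m + 1)) * L x) := by
    rw [← hL, ← Complex.exp_int_mul]
    push_cast
    rfl
  rw [seed, seedConst, seedExp]
  split_ifs
  · ring
  · rw [hpow, ← Complex.exp_add, mul_comm, ← neg_sub (x (first lam i)), div_neg]
    congr 3
    ring
  · rw [hpow, ← Complex.exp_add, mul_comm, div_eq_mul_inv, sq, mul_inv]
    congr 3
    ring

theorem seedConst_mul {α : Vec lam} (hα : IsGeneric α) (hle : lam.part i ≤ lam.part j)
    {A : ℂ} (hA : A ≠ 0) (m : ℤ) :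
    seedConst i j α A (m + 1) * seedConst i j α A (m - 1) =
      cConst i j α m * seedConst i j α A m ^ 2 := by
  have hi := lam.part_pos i
  unfold seedConst cConst
  by_cases h₁ : lam.part i = 1
  · have hlast := last_eq_first_iff.2 h₁
    by_cases h₂ : lam.part j = 1
    · simp only [h₁, h₂, and_self, if_true, hlast, last_eq_first_iff.2 h₂]
      rw [tConst₁_mul hA, pPoly]
      ring
    · simp only [h₁, h₂, and_false, if_true, if_false, hlast]
      rw [tConst₂_mul hA (hα.1 j (by omega)) (hlast ▸ hα.2.1 i h₁)]
      ring
  · have h₂ : lam.part j ≠ 1 := by omega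
    simp only [h₁, h₂, and_false, if_false]
    rw [tConst₃_mul hA (mul_ne_zero (hα.1 i (by omega)) (hα.1 j (by omega)))]
    ring

theorem seedExp_add (α : Vec lam) (L : Vec lam → ℂ) (m : ℤ) (x : Vec lam) :
    seedExp i j α L (m + 1) x + seedExp i j α L (m - 1) x = 2 * seedExp i j α L m x - 2 * L x := by
  unfold seedExp pPoly
  split_ifs <;> push_cast <;> ring

theorem gaugeExp_add (α : Vec lam) (L : Vec lam → ℂ) (m : ℤ) (x : Vec lam) :
    gaugeExp i j α L (m + 1) x + gaugeExp i j α L (m - 1) x = 2 * gaugeExp i j α L m x := by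
  unfold gaugeExp
  split_ifs <;> push_cast <;> ring

variable {L : Vec lam → ℂ}

theorem sub_ne_zero_of_exp {x : Vec lam}
    (hL : Complex.exp (L x) = x (first lam i) - x (first lam j)) :
    x (first lam i) - x (first lam j) ≠ 0 := hL ▸ Complex.exp_ne_zero _

theorem differentiableOn_seedExp (hL : DifferentiableOn ℂ L Ω)
    (hexp : ∀ x ∈ Ω, Complex.exp (L x) = x (first lam i) - x (first lam j)) (α : Vec lam) (m : ℤ) :
    DifferentiableOn ℂ (seedExp i j α L m) Ω := by
  have hX : DifferentiableOn ℂ (fun x : Vec lam => (x (first lam i) - x (first lam j))⁻¹) Ω :=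
    DifferentiableOn.fun_inv (by fun_prop) fun x hx => sub_ne_zero_of_exp (hexp x hx)
  unfold seedExp
  split_ifs <;> fun_prop

theorem differentiableOn_gaugeExp (hL : DifferentiableOn ℂ L Ω)
    (hexp : ∀ x ∈ Ω, Complex.exp (L x) = x (first lam i) - x (first lam j)) (α : Vec lam) (m : ℤ) :
    DifferentiableOn ℂ (gaugeExp i j α L m) Ω := by
  have hX : DifferentiableOn ℂ (fun x : Vec lam => (x (first lam i) - x (first lam j))⁻¹) Ω :=
    DifferentiableOn.fun_inv (by fun_prop) fun x hx => sub_ne_zero_of_exp (hexp x hx)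
  unfold gaugeExp
  split_ifs <;> fun_prop

theorem D_inv_sub {x : Vec lam} (r : Idx lam) (hX : x (first lam i) - x (first lam j) ≠ 0) :
    D r (fun y => (y (first lam i) - y (first lam j))⁻¹) x =
      -((if first lam i = r then 1 else 0) - (if first lam j = r then 1 else 0)) /
        (x (first lam i) - x (first lam j)) ^ 2 := by
  rw [D_inv (by fun_prop) hX, D_sub (by fun_prop) (by fun_prop), D_coord, D_coord]

theorem D_log_sub (hΩ : IsOpen Ω) (hL : DifferentiableOn ℂ L Ω)
    (hexp : ∀ x ∈ Ω, Complex.exp (L x) = x (first lam i) - x (first lam j)) {x : Vec lam}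
    (hx : x ∈ Ω) (r : Idx lam) : D r L x =
      ((if first lam i = r then 1 else 0) - (if first lam j = r then 1 else 0)) *
        (x (first lam i) - x (first lam j))⁻¹ := by
  rw [D_eq_div_of_exp_eq (hL.differentiableAt (hΩ.mem_nhds hx))
    (by filter_upwards [hΩ.mem_nhds hx] with y hy using hexp y hy),
    D_sub (by fun_prop) (by fun_prop), D_coord, D_coord, div_eq_mul_inv]

theorem D_D_seedExp (hij : i ≠ j) (hle : lam.part i ≤ lam.part j) (hΩ : IsOpen Ω)
    (hL : DifferentiableOn ℂ L Ω)
    (hexp : ∀ x ∈ Ω, Complex.exp (L x) = x (first lam i) - x (first lam j)) (α : Vec lam) (m : ℤ)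
    {x : Vec lam} (hx : x ∈ Ω) : D (last lam i) (D (last lam j) (seedExp i j α L m)) x =
      cConst i j α m / (x (first lam i) - x (first lam j)) ^ 2 := by
  have hi := lam.part_pos i
  have hX : ∀ y ∈ Ω, y (first lam i) - y (first lam j) ≠ 0 := fun y hy =>
    sub_ne_zero_of_exp (hexp y hy)
  have hinv : ∀ y ∈ Ω, DifferentiableAt ℂ
      (fun x : Vec lam => (x (first lam i) - x (first lam j))⁻¹) y := fun y hy =>
    DifferentiableAt.fun_inv (by fun_prop) (hX y hy)
  have hLy : ∀ y ∈ Ω, DifferentiableAt ℂ L y := fun y hy =>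
    hL.differentiableAt (hΩ.mem_nhds hy)
  have hne₁ : first lam i ≠ last lam j := (last_ne_first hij.symm).symm
  have hne₂ : first lam j ≠ last lam i := (last_ne_first hij).symm
  have hne₃ : last lam i ≠ last lam j := last_ne_last hij
  unfold seedExp cConst
  by_cases h₁ : lam.part i = 1
  · by_cases h₂ : lam.part j = 1
    · simp only [h₁, h₂, and_self, if_true]
      have hev : D (last lam j) (fun x => pPoly (α (first lam i)) (α (first lam j)) m * L x)
          =ᶠ[𝓝 x] fun y => -pPoly (α (first lam i)) (α (first lam j)) m *
            (y (first lam i) - y (first lam j))⁻¹ := by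
        filter_upwards [hΩ.mem_nhds hx] with y hy
        rw [D_const_mul _ (hLy y hy), D_log_sub hΩ hL hexp hy, if_neg hne₁,
          if_pos (first_eq_last_iff.2 h₂)]
        ring
      rw [D_congr hev, D_const_mul _ (hinv x hx), D_inv_sub _ (hX x hx),
        if_pos (first_eq_last_iff.2 h₁), if_neg hne₂, last_eq_first_iff.2 h₁,
        last_eq_first_iff.2 h₂, pPoly]
      ring
    · simp only [h₁, h₂, and_false, if_true, if_false]
      have hev : D (last lam j) (fun x => -((α (first lam i) + m) * α (last lam j)) *
          (x (last lam j) * (x (first lam i) - x (first lam j))⁻¹) + -(m * (m + 1)) * L x)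
          =ᶠ[𝓝 x] fun y => -((α (first lam i) + m) * α (last lam j)) *
            (y (first lam i) - y (first lam j))⁻¹ := by
        filter_upwards [hΩ.mem_nhds hx] with y hy
        have h₃ := hinv y hy
        have h₄ := hLy y hy
        rw [D_add (by fun_prop) (by fun_prop), D_const_mul _ (by fun_prop),
          D_const_mul _ (by fun_prop), D_mul (by fun_prop) (by fun_prop), D_coord, if_pos rfl,
          D_inv_sub _ (hX y hy), D_log_sub hΩ hL hexp hy, if_neg hne₁,
          if_neg (mt first_eq_last_iff.1 h₂)]
        ring
      rw [D_congr hev, D_const_mul _ (hinv x hx), D_inv_sub _ (hX x hx),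
        if_pos (first_eq_last_iff.2 h₁), if_neg hne₂, last_eq_first_iff.2 h₁]
      ring
  · have h₂ : lam.part j ≠ 1 := by omega
    simp only [h₁, h₂, and_false, if_false]
    have hev : D (last lam j) (fun x => α (last lam i) * α (last lam j) *
        (x (last lam j) * (x (last lam i) * ((x (first lam i) - x (first lam j))⁻¹ *
          (x (first lam i) - x (first lam j))⁻¹))) + -(m * (m + 1)) * L x)
        =ᶠ[𝓝 x] fun y => α (last lam i) * α (last lam j) *
          (y (last lam i) * ((y (first lam i) - y (first lam j))⁻¹ *
          (y (first lam i) - y (first lam j))⁻¹)) := by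
      filter_upwards [hΩ.mem_nhds hx] with y hy
      have h₃ := hinv y hy
      have h₄ := hLy y hy
      rw [D_add (by fun_prop) (by fun_prop), D_const_mul _ (by fun_prop),
        D_const_mul _ (by fun_prop), D_mul (by fun_prop) (by fun_prop),
        D_mul (by fun_prop) (by fun_prop), D_mul (by fun_prop) (by fun_prop), D_coord, D_coord,
        if_pos rfl, if_neg hne₃, D_inv_sub _ (hX y hy), D_log_sub hΩ hL hexp hy, if_neg hne₁,
        if_neg (mt first_eq_last_iff.1 h₂)]
      ring
    have h₃ := hinv x hx
    rw [D_congr hev, D_const_mul _ (by fun_prop), D_mul (by fun_prop) (by fun_prop),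
      D_mul (by fun_prop) (by fun_prop), D_coord, if_pos rfl, D_inv_sub _ (hX x hx), if_neg hne₂,
      if_neg (mt first_eq_last_iff.1 h₁)]
    have := hX x hx
    field_simp
    ring

theorem D_D_gaugeExp (hij : i ≠ j) (hle : lam.part i ≤ lam.part j) (hΩ : IsOpen Ω)
    (hL : DifferentiableOn ℂ L Ω)
    (hexp : ∀ x ∈ Ω, Complex.exp (L x) = x (first lam i) - x (first lam j)) (α : Vec lam) (m : ℤ)
    {x : Vec lam} (hx : x ∈ Ω) : D (last lam i) (D (last lam j) (gaugeExp i j α L m)) x =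
      (shift α i j m (last lam i) * shift α i j m (last lam j) - cConst i j α m) /
        (x (first lam i) - x (first lam j)) ^ 2 := by
  have hi := lam.part_pos i
  have hX : ∀ y ∈ Ω, y (first lam i) - y (first lam j) ≠ 0 := fun y hy =>
    sub_ne_zero_of_exp (hexp y hy)
  have hinv : ∀ y ∈ Ω, DifferentiableAt ℂ
      (fun x : Vec lam => (x (first lam i) - x (first lam j))⁻¹) y := fun y hy =>
    DifferentiableAt.fun_inv (by fun_prop) (hX y hy)
  have hLy : ∀ y ∈ Ω, DifferentiableAt ℂ L y := fun y hy =>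
    hL.differentiableAt (hΩ.mem_nhds hy)
  have hne₁ : first lam i ≠ last lam j := (last_ne_first hij.symm).symm
  have hne₂ : first lam j ≠ last lam i := (last_ne_first hij).symm
  have hne₃ : last lam i ≠ last lam j := last_ne_last hij
  rw [shift_last_left hij, shift_last_right hij]
  unfold gaugeExp cConst
  by_cases h₁ : lam.part i = 1
  · simp only [h₁, if_true]
    have hev : D (last lam j) (fun x => -(α (first lam i) + m) * L x)
        =ᶠ[𝓝 x] fun y => (if lam.part j = 1 then α (first lam i) + m else 0) *
          (y (first lam i) - y (first lam j))⁻¹ := by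
      filter_upwards [hΩ.mem_nhds hx] with y hy
      rw [D_const_mul _ (hLy y hy), D_log_sub hΩ hL hexp hy, if_neg hne₁]
      simp only [first_eq_last_iff]
      split_ifs <;> ring
    rw [D_congr hev, D_const_mul _ (hinv x hx), D_inv_sub _ (hX x hx),
      if_pos (first_eq_last_iff.2 h₁), if_neg hne₂, last_eq_first_iff.2 h₁]
    split_ifs <;> ring
  · have h₂ : lam.part j ≠ 1 := by omega
    simp only [h₁, h₂, if_false]
    have hev : D (last lam j) (fun x => -α (last lam i) *
        (x (last lam i) * (x (first lam i) - x (first lam j))⁻¹)) =ᶠ[𝓝 x] fun _ => 0 := by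
      filter_upwards [hΩ.mem_nhds hx] with y hy
      have h₃ := hinv y hy
      rw [D_const_mul _ (by fun_prop), D_mul (by fun_prop) (by fun_prop), D_coord, if_neg hne₃,
        D_inv_sub _ (hX y hy), if_neg hne₁, if_neg (mt first_eq_last_iff.1 h₂)]
      ring
    rw [D_congr hev, D_const]
    ring

theorem solvesToda_seed (hij : i ≠ j) (hle : lam.part i ≤ lam.part j) {α : Vec lam}
    (hα : IsGeneric α) (hΩ : IsOpen Ω) (hL : DifferentiableOn ℂ L Ω)
    (hexp : ∀ x ∈ Ω, Complex.exp (L x) = x (first lam i) - x (first lam j))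
    {A : ℂ} (hA : A ≠ 0) : SolvesToda Ω (last lam i) (last lam j) (seed i j α A L) := by
  have key := solvesToda_exp_mul hΩ (u := fun _ _ => 1) (fun _ => differentiableOn_const _)
    (differentiableOn_seedExp hL hexp α) hexp (fun m x hx => D_D_seedExp hij hle hΩ hL hexp α m hx)
    (fun m x _ => seedExp_add α L m x) (seedConst_mul hα hle hA) ?_
  · refine key.congr hΩ fun m x hx => ?_
    rw [seed_eq α A m (hexp x hx), mul_one]
  · intro m x hx
    have : D (last lam j) (fun _ : Vec lam => (1 : ℂ)) = fun _ => 0 := funext fun _ => D_const 1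
    rw [this, D_const]
    ring

theorem solvesToda_of_isLadder (hij : i ≠ j) (hle : lam.part i ≤ lam.part j) {α : Vec lam}
    (hα : IsGeneric α) (hΩ : IsOpen Ω) (hL : DifferentiableOn ℂ L Ω)
    (hexp : ∀ x ∈ Ω, Complex.exp (L x) = x (first lam i) - x (first lam j))
    {A : ℂ} (hA : A ≠ 0) {u : ℤ → Vec lam → ℂ} (hu : IsLadder i j α Ω u) :
    SolvesToda Ω (last lam i) (last lam j)
      (fun m x => seed i j α A L m x * gaugeFactor i j α L m x * u m x) := by
  have hs := differentiableOn_seedExp hL hexp α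
  have hg := differentiableOn_gaugeExp hL hexp α
  have key := solvesToda_exp_mul hΩ (u := u)
    (ψ := fun m x => seedExp i j α L m x + gaugeExp i j α L m x)
    (b := fun m => shift α i j m (last lam i) * shift α i j m (last lam j)) hu.holo
    (fun m => (hs m).fun_add (hg m)) hexp ?_ ?_ (seedConst_mul hα hle hA)
    (fun m x hx => hu.bilinear hij hΩ m hx (sub_ne_zero_of_exp (hexp x hx)))
  · refine key.congr hΩ fun m x hx => ?_
    rw [seed_eq α A m (hexp x hx), gaugeFactor_eq, Complex.exp_add]
    ring
  · intro m x hx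
    have hev : D (last lam j) (fun x => seedExp i j α L m x + gaugeExp i j α L m x) =ᶠ[𝓝 x]
        fun y => D (last lam j) (seedExp i j α L m) y + D (last lam j) (gaugeExp i j α L m) y := by
      filter_upwards [hΩ.mem_nhds hx] with y hy
      exact D_add ((hs m).differentiableAt (hΩ.mem_nhds hy))
        ((hg m).differentiableAt (hΩ.mem_nhds hy))
    rw [D_congr hev, D_add ((differentiableOn_D hΩ (hs m)).differentiableAt (hΩ.mem_nhds hx))
      ((differentiableOn_D hΩ (hg m)).differentiableAt (hΩ.mem_nhds hx)),
      D_D_seedExp hij hle hΩ hL hexp α m hx, D_D_gaugeExp hij hle hΩ hL hexp α m hx]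
    ring
  · intro m x _
    linear_combination seedExp_add (i := i) (j := j) α L m x +
      gaugeExp_add (i := i) (j := j) α L m x

end Seed

/-! ### Characters -/

section Characters

variable {lam : TuplePartition N} {i j k : Fin lam.len}

/-- `θ_r` depends on its last variable only through the summand `x_r / x_0`. -/
theorem theta_sub_eq {r : ℕ} (hr : 0 < r) {x y : ℕ → ℂ} (h : ∀ b < r, x b = y b) :
    theta r x - x r / x 0 = theta r y - y r / y 0 := by
  have key : ∀ x : ℕ → ℂ, theta r x - x r / x 0 =
      ∑ c ∈ Finset.univ.erase (Composition.single r hr),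
        (-1) ^ (c.length + 1) / (c.length : ℂ) * (c.blocks.map fun b => x b / x 0).prod := by
    intro x
    rw [theta, ← Finset.add_sum_erase _ _ (Finset.mem_univ (Composition.single r hr))]
    simp [Composition.single_length, Composition.single_blocks]
  rw [key, key]
  refine Finset.sum_congr rfl fun c hc => ?_
  have hc' := (Composition.ne_single_iff hr).1 (Finset.ne_of_mem_erase hc)
  congr 2
  refine List.map_congr_left fun b hb => ?_
  obtain ⟨a, ha⟩ := List.mem_iff_get.1 hb
  have hlt : b < r := by
    rw [← ha]
    exact hc' a
  rw [h b hlt, h 0 hr]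

/-- The exponent of the unipotent part of the character. -/
def unipotentExp (α h : Vec lam) : ℂ :=
  ∑ k, ∑ r ∈ Finset.Ico 1 (lam.part k), entry α k r * theta r (entry h k)

theorem character_eq (α : Vec lam) (w : Fin lam.len → ℂ) (h : Vec lam) :
    character α w h = Complex.exp (∑ k, α (first lam k) * w k + unipotentExp α h) := by
  rw [character, ← Complex.exp_sum, unipotentExp, Finset.sum_add_distrib]

theorem unipotentExp_congr {α β : Vec lam}
    (h : ∀ k (r : Fin (lam.part k)), r.1 ≠ 0 → α ⟨k, r⟩ = β ⟨k, r⟩) (g : Vec lam) :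
    unipotentExp α g = unipotentExp β g := by
  refine Finset.sum_congr rfl fun k _ => Finset.sum_congr rfl fun r hr => ?_
  obtain ⟨h₁, h₂⟩ := Finset.mem_Ico.1 hr
  rw [entry, entry, dif_pos h₂, dif_pos h₂, h k ⟨r, h₂⟩ (by simp; omega)]

theorem unipotentExp_shift (α h : Vec lam) (m : ℤ) :
    unipotentExp (shift α i j m) h = unipotentExp α h := by
  refine unipotentExp_congr (fun k r hr => ?_) h
  have : ∀ l, (⟨k, r⟩ : Idx lam) ≠ first lam l := by
    intro l e
    obtain rfl : k = l := congrArg Sigma.fst e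
    rw [first, Sigma.mk.injEq] at e
    exact hr (by rw [eq_of_heq e.2])
  simp [shift, this]

theorem sum_shift_first (α : Vec lam) (w : Fin lam.len → ℂ) (m : ℤ) :
    ∑ k, shift α i j m (first lam k) * w k =
      ∑ k, α (first lam k) * w k + m * (w i - w j) := by
  have hinj : ∀ k l, first lam k = first lam l ↔ k = l := fun k l =>
    ⟨fun e => congrArg Sigma.fst e, fun e => e ▸ rfl⟩
  simp only [shift, Pi.add_apply, Pi.smul_apply, Pi.sub_apply, Pi.single_apply, hinj, smul_eq_mul,
    add_mul, Finset.sum_add_distrib, mul_assoc, sub_mul, ite_mul, one_mul, zero_mul,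
    ← Finset.mul_sum, Finset.sum_sub_distrib]
  simp

theorem character_shift (α : Vec lam) (w : Fin lam.len → ℂ) (h : Vec lam) (m : ℤ) :
    character (shift α i j m) w h = character α w h * Complex.exp (m * (w i - w j)) := by
  rw [character_eq, character_eq, sum_shift_first, unipotentExp_shift, ← Complex.exp_add]
  congr 1
  ring

theorem entry_zero (h : Vec lam) (k : Fin lam.len) : entry h k 0 = h (first lam k) := by
  rw [entry, dif_pos (lam.part_pos k), first]

theorem entry_last (h : Vec lam) (k : Fin lam.len) :
    entry h k (lam.part k - 1) = h (last lam k) := by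
  rw [entry, dif_pos (Nat.sub_lt (lam.part_pos k) Nat.one_pos), last]

theorem entry_add_single_last (h : Vec lam) (ε : ℂ) (l : Fin lam.len) {r : ℕ}
    (hr : l ≠ k ∨ r ≠ lam.part k - 1) :
    entry (h + ε • Pi.single (last lam k) 1) l r = entry h l r := by
  unfold entry
  split_ifs with h₁
  · have : (⟨l, ⟨r, h₁⟩⟩ : Idx lam) ≠ last lam k := by
      intro e
      obtain rfl : l = k := congrArg Sigma.fst e
      rw [last, Sigma.mk.injEq] at e
      rcases hr with hr | hr
      · exact hr rfl
      · exact hr (congrArg Fin.val (eq_of_heq e.2))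
    simp [this]
  · rfl

/-- Translation in the last coordinate of a block changes only the leading `θ` of this block. -/
theorem unipotentExp_add_single_last (α h : Vec lam) (k : Fin lam.len) (ε : ℂ) :
    unipotentExp α (h + ε • Pi.single (last lam k) 1) = unipotentExp α h +
      if lam.part k = 1 then 0 else α (last lam k) * ε / h (first lam k) := by
  have hk := lam.part_pos k
  have hother : ∀ l, l ≠ k → ∑ r ∈ Finset.Ico 1 (lam.part l),
      entry α l r * theta r (entry (h + ε • Pi.single (last lam k) 1) l) =
      ∑ r ∈ Finset.Ico 1 (lam.part l), entry α l r * theta r (entry h l) := by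
    intro l hl
    rw [show entry (h + ε • Pi.single (last lam k) 1) l = entry h l from
      funext fun r => entry_add_single_last h ε l (Or.inl hl)]
  have hsame : ∑ r ∈ Finset.Ico 1 (lam.part k),
      entry α k r * theta r (entry (h + ε • Pi.single (last lam k) 1) k) =
      ∑ r ∈ Finset.Ico 1 (lam.part k), entry α k r * theta r (entry h k) +
      if lam.part k = 1 then 0 else α (last lam k) * ε / h (first lam k) := by
    split_ifs with h₁
    · simp [h₁]
    · obtain ⟨n, hn⟩ : ∃ n, lam.part k = n + 1 := ⟨lam.part k - 1, by omega⟩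
      have hn' : n = lam.part k - 1 := by omega
      rw [hn, Finset.sum_Ico_succ_top (by omega), Finset.sum_Ico_succ_top (by omega), add_assoc]
      congr 1
      · refine Finset.sum_congr rfl fun r hr => ?_
        obtain ⟨h₂, h₃⟩ := Finset.mem_Ico.1 hr
        have hb : ∀ b ≤ r, entry (h + ε • Pi.single (last lam k) 1) k b = entry h k b :=
          fun b hb => entry_add_single_last h ε k (Or.inr (by omega))
        have := theta_sub_eq (r := r) (by omega) fun b hb' => hb b hb'.le
        rw [hb r le_rfl, hb 0 (by omega)] at this
        rw [sub_left_inj.1 this]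
      · have hb : ∀ b < n, entry (h + ε • Pi.single (last lam k) 1) k b = entry h k b :=
          fun b hb => entry_add_single_last h ε k (Or.inr (by omega))
        have := theta_sub_eq (r := n) (by omega) hb
        rw [hb 0 (by omega), entry_zero, sub_eq_iff_eq_add] at this
        rw [this]
        subst hn'
        rw [entry_last, entry_last, entry_last]
        simp only [Pi.add_apply, Pi.smul_apply, Pi.single_eq_same, smul_eq_mul, mul_one]
        ring
  rw [unipotentExp, unipotentExp, ← Finset.add_sum_erase _ _ (Finset.mem_univ k), hsame,
    ← Finset.add_sum_erase _ _ (Finset.mem_univ k)]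
  rw [Finset.sum_congr rfl fun l hl => hother l (Finset.ne_of_mem_erase hl)]
  ring

end Characters

/-! ### The group action on matrices -/

section Action

variable {lam : TuplePartition N} {i j k : Fin lam.len}

theorem act_apply (z : Mat2 lam) (h : Vec lam) (c : Fin 2) (k : Fin lam.len)
    (b : Fin (lam.part k)) : act z h c ⟨k, b⟩ =
      ∑ a : Fin (lam.part k), z c ⟨k, a⟩ * if a ≤ b then h ⟨k, ⟨b.1 - a.1, by omega⟩⟩ else 0 := by
  rw [act, Matrix.mul_apply, Fintype.sum_sigma, Finset.sum_eq_single k]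
  · simp [groupMatrix, jordan, Matrix.blockDiagonal'_apply]
  · intro l _ hl
    simp [groupMatrix, Matrix.blockDiagonal'_apply, hl]
  · simp

/-- The matrix with column `p` of `z` in place `q` and zeros elsewhere, i.e. `z E_{p q}`. -/
def moveColumn (p q : Idx lam) (z : Mat2 lam) : Mat2 lam :=
  fun c r => if r = q then z c p else 0

theorem act_add_smul (z : Mat2 lam) (h g : Vec lam) (ε : ℂ) :
    act z (h + ε • g) = act z h + ε • act z g := by
  funext c ⟨k, b⟩
  simp only [Pi.add_apply, Pi.smul_apply, act_apply, smul_eq_mul, Finset.mul_sum,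
    ← Finset.sum_add_distrib]
  refine Finset.sum_congr rfl fun a _ => ?_
  split_ifs <;> ring

/-- The right action of a fixed group element as a linear map. -/
def actLinear (h : Vec lam) : Mat2 lam →L[ℂ] Mat2 lam :=
  LinearMap.toContinuousLinearMap
    { toFun := fun z => act z h
      map_add' := fun z y => by
        funext c ⟨k, b⟩
        simp only [act_apply, Pi.add_apply, add_mul, Finset.sum_add_distrib]
      map_smul' := fun ε z => by
        funext c ⟨k, b⟩
        simp [act_apply, Finset.mul_sum, mul_assoc] }

theorem actLinear_apply (h : Vec lam) (z : Mat2 lam) : actLinear h z = act z h := rfl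

theorem act_groupOne (z : Mat2 lam) : act z (groupOne lam) = z := by
  funext c ⟨k, b⟩
  rw [act_apply, Finset.sum_eq_single b]
  · simp [groupOne]
  · intro a _ hab
    have : ¬ (a ≤ b ∧ b.1 - a.1 = 0) := fun h => hab (Fin.ext (by have := Fin.le_def.1 h.1; omega))
    simp only [groupOne, ← ite_and, if_neg this, mul_zero]
  · simp

theorem act_single_last (z : Mat2 lam) (k : Fin lam.len) :
    act z (Pi.single (last lam k) 1) = moveColumn (first lam k) (last lam k) z := by
  funext c ⟨l, b⟩
  rw [act_apply, moveColumn, Finset.sum_eq_single ⟨0, lam.part_pos l⟩]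
  · rw [if_pos (Fin.le_def.2 (Nat.zero_le _))]
    rw [Pi.single_apply]
    simp only [Nat.sub_zero, Fin.eta, mul_ite, mul_one, mul_zero]
    split_ifs with h
    · obtain rfl : l = k := congrArg Sigma.fst h
      rfl
    · rfl
  · intro a _ ha
    split_ifs with hab
    · rw [Pi.single_eq_of_ne, mul_zero]
      intro e
      obtain rfl : l = k := congrArg Sigma.fst e
      rw [last, Sigma.mk.injEq] at e
      have h₁ := congrArg Fin.val (eq_of_heq e.2)
      have h₂ := Fin.le_def.1 hab
      have h₃ : a.1 ≠ 0 := fun h => ha (Fin.ext h)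
      have h₄ := b.2
      simp only at h₁
      omega
    · rw [mul_zero]
  · simp

theorem moveColumn_act (z : Mat2 lam) (h : Vec lam) (q : Idx lam) :
    moveColumn (first lam i) q (act z h) = h (first lam i) • moveColumn (first lam i) q z := by
  funext c r
  simp only [moveColumn, Pi.smul_apply, smul_eq_mul, mul_ite, mul_zero]
  congr 1
  rw [first, act_apply, Finset.sum_eq_single ⟨0, lam.part_pos i⟩]
  · simp [mul_comm]
  · intro a _ ha
    have : ¬ a ≤ ⟨0, lam.part_pos i⟩ := fun h => ha (Fin.ext (Nat.le_zero.1 (Fin.le_def.1 h)))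
    rw [if_neg this, mul_zero]
  · simp

theorem act_moveColumn (z : Mat2 lam) (h : Vec lam) (p : Idx lam) :
    act (moveColumn p (last lam j) z) h = h (first lam j) • moveColumn p (last lam j) z := by
  funext c ⟨l, b⟩
  simp only [moveColumn, Pi.smul_apply, smul_eq_mul, act_apply]
  by_cases hl : l = j
  · subst hl
    rw [Finset.sum_eq_single ⟨lam.part l - 1, Nat.sub_lt (lam.part_pos l) Nat.one_pos⟩]
    · by_cases hb : b = ⟨lam.part l - 1, Nat.sub_lt (lam.part_pos l) Nat.one_pos⟩
      · subst hb
        simp [last, first, mul_comm]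
      · have : ¬ (⟨lam.part l - 1, Nat.sub_lt (lam.part_pos l) Nat.one_pos⟩ : Fin _) ≤ b := by
          intro h
          refine hb (Fin.ext ?_)
          have h₁ := Fin.le_def.1 h
          have h₂ := b.2
          simp only at h₁ ⊢
          omega
        rw [if_neg this, mul_zero, if_neg, mul_zero]
        intro e
        rw [last, Sigma.mk.injEq] at e
        exact hb (eq_of_heq e.2)
    · intro a _ ha
      rw [if_neg, zero_mul]
      intro e
      rw [last, Sigma.mk.injEq] at e
      exact ha (eq_of_heq e.2)
    · simp
  · have : ∀ b, (⟨l, b⟩ : Idx lam) ≠ last lam j := fun b e => hl (congrArg Sigma.fst e)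
    simp [this]

theorem moveColumn_eq (p q : Idx lam) (z : Mat2 lam) : moveColumn p q z =
    z 0 p • (Pi.single 0 (Pi.single q 1) : Mat2 lam) +
      z 1 p • (Pi.single 1 (Pi.single q 1) : Mat2 lam) := by
  funext c r
  fin_cases c <;> simp [moveColumn, Pi.single_apply]

end Action

/-! ### Contiguity operators on the generic stratum -/

section PartialDerivativesMat

variable {lam : TuplePartition N} {a b : Fin 2} {p q : Idx lam} {f g : Mat2 lam → ℂ}
  {z : Mat2 lam} {U : Set (Mat2 lam)}

theorem dz_congr (h : f =ᶠ[𝓝 z] g) : dz a p f z = dz a p g z := by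
  rw [dz, dz, h.fderiv_eq]

theorem dz_add (hf : DifferentiableAt ℂ f z) (hg : DifferentiableAt ℂ g z) :
    dz a p (fun y => f y + g y) z = dz a p f z + dz a p g z := by
  simp [dz, fderiv_fun_add hf hg]

theorem dz_const_mul (c : ℂ) (hf : DifferentiableAt ℂ f z) :
    dz a p (fun y => c * f y) z = c * dz a p f z := by
  simp [dz, fderiv_const_mul hf]

theorem dz_coord_mul (c : Fin 2) (r : Idx lam) (hg : DifferentiableAt ℂ g z) :
    dz a p (fun y => y c r * g y) z =
      z c r * dz a p g z + if c = a ∧ r = p then g z else 0 := by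
  have hf : HasFDerivAt (fun y : Mat2 lam => y c r)
      ((ContinuousLinearMap.proj (R := ℂ) (φ := fun _ : Idx lam => ℂ) r).comp
        (ContinuousLinearMap.proj (R := ℂ) (φ := fun _ : Fin 2 => Idx lam → ℂ) c)) z :=
    ContinuousLinearMap.hasFDerivAt
      ((ContinuousLinearMap.proj (R := ℂ) (φ := fun _ : Idx lam => ℂ) r).comp
        (ContinuousLinearMap.proj (R := ℂ) (φ := fun _ : Fin 2 => Idx lam → ℂ) c))
  rw [dz, fderiv_fun_mul hf.differentiableAt hg, hf.fderiv]
  simp only [_root_.add_apply, _root_.smul_apply, ContinuousLinearMap.comp_apply,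
    ContinuousLinearMap.proj_apply, smul_eq_mul, dz]
  congr 1
  by_cases hc : c = a
  · subst hc
    simp [Pi.single_apply]
  · simp [hc]

theorem differentiableOn_dz (hU : IsOpen U) (hf : DifferentiableOn ℂ f U) :
    DifferentiableOn ℂ (dz a p f) U :=
  differentiableOn_fderiv_apply hU hf _

theorem dz_comm (hU : IsOpen U) (hf : DifferentiableOn ℂ f U) (hz : z ∈ U) :
    dz a p (dz b q f) z = dz b q (dz a p f) z :=
  fderiv_fderiv_apply_comm hU hf hz _ _

/-- The system `□_{p,q} f = 0` is preserved by constant coefficient derivations. -/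
theorem square_dz (hU : IsOpen U) (hf : DifferentiableOn ℂ f U)
    (hsq : ∀ z ∈ U, ∀ p q : Idx lam, dz 0 p (dz 1 q f) z - dz 1 p (dz 0 q f) z = 0)
    (c : Fin 2) (s p q : Idx lam) (hz : z ∈ U) :
    dz 0 p (dz 1 q (dz c s f)) z = dz 1 p (dz 0 q (dz c s f)) z := by
  have hU' : ∀ᶠ y in 𝓝 z, y ∈ U := hU.mem_nhds hz
  have hcomm : ∀ (a b : Fin 2), dz a p (dz b q (dz c s f)) z = dz c s (dz a p (dz b q f)) z := by
    intro a b
    have : dz b q (dz c s f) =ᶠ[𝓝 z] dz c s (dz b q f) :=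
      hU'.mono fun y hy => dz_comm hU hf hy
    rw [dz_congr this, dz_comm hU (differentiableOn_dz hU hf) hz]
  rw [hcomm, hcomm]
  exact dz_congr (hU'.mono fun y hy => sub_eq_zero.1 (hsq y hy p q))

end PartialDerivativesMat

section Sections

variable {lam : TuplePartition N} {i j k : Fin lam.len} {U : Set (Mat2 lam)} {β : Vec lam}
  {u : Mat2 lam → ℂ}

/-- The infinitesimal right action of the matrix unit `E_{p q}`. -/
def matrixUnitOp (p q : Idx lam) (u : Mat2 lam → ℂ) : Mat2 lam → ℂ :=
  fun z => z 0 p * dz 0 q u z + z 1 p * dz 1 q u z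

theorem matrixUnitOp_eq (p q : Idx lam) (u : Mat2 lam → ℂ) (z : Mat2 lam) :
    matrixUnitOp p q u z = fderiv ℂ u z (moveColumn p q z) := by
  rw [moveColumn_eq, map_add, map_smul, map_smul]
  rfl

theorem characterNearOne_eq {α h : Vec lam} : characterNearOne α h =
    Complex.exp (∑ k, α (first lam k) * Complex.log (h (first lam k)) + unipotentExp α h) := by
  rw [characterNearOne, character_eq]

theorem hasDerivAt_characterNearOne (α : Vec lam) (k : Fin lam.len) :
    HasDerivAt (fun ε : ℂ => characterNearOne α (groupOne lam + ε • Pi.single (last lam k) 1))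
      (α (last lam k) * characterNearOne α (groupOne lam)) 0 := by
  have hone : ∀ l, groupOne lam (first lam l) = 1 := fun l => by simp [groupOne, first]
  have hlog : ∀ l, HasDerivAt (fun ε : ℂ => α (first lam l) *
      Complex.log ((groupOne lam + ε • Pi.single (last lam k) 1 : Vec lam) (first lam l)))
      (if l = k then (if lam.part k = 1 then α (last lam k) else 0) else 0) 0 := by
    intro l
    have h₁ : HasDerivAt (fun ε : ℂ =>
        (groupOne lam + ε • Pi.single (last lam k) 1 : Vec lam) (first lam l))
        ((Pi.single (last lam k) 1 : Vec lam) (first lam l)) 0 := by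
      simpa using ((hasDerivAt_id (0 : ℂ)).mul_const
        ((Pi.single (last lam k) 1 : Vec lam) (first lam l))).const_add
          (groupOne lam (first lam l))
    refine ((h₁.clog (by simp [hone])).const_mul (α (first lam l))).congr_deriv ?_
    simp only [zero_smul, add_zero, hone, div_one, Pi.single_apply]
    by_cases hl : l = k
    · subst hl
      rw [if_pos rfl, ite_congr (propext first_eq_last_iff) (fun _ => rfl) (fun _ => rfl)]
      split_ifs with h
      · rw [mul_one, last_eq_first_iff.2 h]
      · rw [mul_zero]
    · rw [if_neg (last_ne_first (Ne.symm hl)).symm, if_neg hl, mul_zero]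
  have huni : HasDerivAt (fun ε : ℂ =>
      unipotentExp α (groupOne lam + ε • Pi.single (last lam k) 1))
      (if lam.part k = 1 then 0 else α (last lam k)) 0 := by
    simp only [unipotentExp_add_single_last, hone, div_one]
    split_ifs
    · simpa using hasDerivAt_const (0 : ℂ) (unipotentExp α (groupOne lam))
    · simpa using ((hasDerivAt_id (0 : ℂ)).const_mul (α (last lam k))).const_add
        (unipotentExp α (groupOne lam))
  have hsum := ((HasDerivAt.fun_sum fun l (_ : l ∈ Finset.univ) => hlog l).fun_add huni).cexp
  simp only [characterNearOne_eq]
  refine hsum.congr_deriv ?_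
  rw [zero_smul, add_zero, mul_comm, Finset.sum_ite_eq' Finset.univ k, if_pos (Finset.mem_univ k)]
  congr 1
  split_ifs <;> ring

/-- The derivative of the equivariance in the last group coordinate of a block. -/
theorem IsSection.matrixUnitOp_self (hu : IsSection β U u) (hU : IsOpen U) {z : Mat2 lam}
    (hz : z ∈ U) (k : Fin lam.len) :
    matrixUnitOp (first lam k) (last lam k) u z = β (last lam k) * u z := by
  have heq := hu.equivariant z hz
  have h₀ : u z = u z * characterNearOne β (groupOne lam) := by
    simpa [act_groupOne] using heq.self_of_nhds
  have hpath : Tendsto (fun ε : ℂ => (z, groupOne lam + ε • Pi.single (last lam k) 1)) (𝓝 0)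
      (𝓝 (z, groupOne lam)) := by
    have : Continuous fun ε : ℂ => (z, (groupOne lam + ε • Pi.single (last lam k) 1 : Vec lam)) := by
      fun_prop
    simpa using this.tendsto 0
  have hev : (fun ε : ℂ => u (z + ε • moveColumn (first lam k) (last lam k) z)) =ᶠ[𝓝 0]
      fun ε => u z * characterNearOne β (groupOne lam + ε • Pi.single (last lam k) 1) := by
    filter_upwards [hpath.eventually heq] with ε hε
    rwa [act_add_smul, act_groupOne, act_single_last] at hε
  have h₁ := (hasDerivAt_characterNearOne β k).const_mul (u z)
  have h₂ : HasDerivAt (fun ε : ℂ => u (z + ε • moveColumn (first lam k) (last lam k) z))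
      (fderiv ℂ u z (moveColumn (first lam k) (last lam k) z)) 0 := by
    have hline : HasDerivAt (fun ε : ℂ => z + ε • moveColumn (first lam k) (last lam k) z)
        (moveColumn (first lam k) (last lam k) z) 0 := by
      simpa using ((hasDerivAt_id (0 : ℂ)).smul_const
        (moveColumn (first lam k) (last lam k) z)).const_add z
    have hd := (hu.holo.differentiableAt (hU.mem_nhds hz)).hasFDerivAt
    exact HasFDerivAt.comp_hasDerivAt_of_eq 0 hd hline (by simp)
  rw [matrixUnitOp_eq, h₂.unique (h₁.congr_of_eventuallyEq hev), mul_left_comm, ← h₀]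

theorem differentiableOn_matrixUnitOp (hU : IsOpen U) (hu : DifferentiableOn ℂ u U)
    (p q : Idx lam) : DifferentiableOn ℂ (matrixUnitOp p q u) U := by
  have h₀ := differentiableOn_dz (a := 0) (p := q) hU hu
  have h₁ := differentiableOn_dz (a := 1) (p := q) hU hu
  unfold matrixUnitOp
  fun_prop

/-- The system `□_{p,q} u = 0` is invariant under the Lie algebra `𝔤𝔩_N`. -/
theorem square_matrixUnitOp (hU : IsOpen U) (hu : DifferentiableOn ℂ u U)
    (hsq : ∀ z ∈ U, ∀ p q : Idx lam, dz 0 p (dz 1 q u) z - dz 1 p (dz 0 q u) z = 0)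
    (r s p q : Idx lam) {z : Mat2 lam} (hz : z ∈ U) :
    dz 0 p (dz 1 q (matrixUnitOp r s u)) z - dz 1 p (dz 0 q (matrixUnitOp r s u)) z = 0 := by
  have hat : ∀ {f : Mat2 lam → ℂ}, DifferentiableOn ℂ f U → ∀ {y}, y ∈ U → DifferentiableAt ℂ f y :=
    fun hf _ hy => hf.differentiableAt (hU.mem_nhds hy)
  have hc : ∀ c r, DifferentiableOn ℂ (fun y : Mat2 lam => y c r) U := fun c r => by fun_prop
  have hd : ∀ c s, DifferentiableOn ℂ (dz c s u) U := fun c s => differentiableOn_dz hU hu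
  have hdd : ∀ b q c s, DifferentiableOn ℂ (dz b q (dz c s u)) U := fun b q c s =>
    differentiableOn_dz hU (hd c s)
  have h₁ : ∀ b q, ∀ y ∈ U, dz b q (matrixUnitOp r s u) y =
      (y 0 r * dz b q (dz 0 s u) y + if 0 = b ∧ r = q then dz 0 s u y else 0) +
      (y 1 r * dz b q (dz 1 s u) y + if 1 = b ∧ r = q then dz 1 s u y else 0) := by
    intro b q y hy
    unfold matrixUnitOp
    rw [dz_add (hat ((hc 0 r).fun_mul (hd 0 s)) hy) (hat ((hc 1 r).fun_mul (hd 1 s)) hy),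
      dz_coord_mul _ _ (hat (hd 0 s) hy), dz_coord_mul _ _ (hat (hd 1 s) hy)]
  have hite : ∀ (P : Prop) [Decidable P] (f : Mat2 lam → ℂ) (a : Fin 2) (p : Idx lam)
      (y : Mat2 lam), dz a p (fun y => if P then f y else 0) y = if P then dz a p f y else 0 := by
    intro P _ f a p y
    split_ifs
    · rfl
    · simp [dz]
  have hited : ∀ (P : Prop) [Decidable P] (f : Mat2 lam → ℂ), DifferentiableOn ℂ f U →
      DifferentiableOn ℂ (fun y => if P then f y else 0) U := by
    intro P _ f hf
    split_ifs
    · exact hf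
    · exact differentiableOn_const _
  have h₂ : ∀ a p b q, dz a p (dz b q (matrixUnitOp r s u)) z =
      (z 0 r * dz a p (dz b q (dz 0 s u)) z + (if 0 = a ∧ r = p then dz b q (dz 0 s u) z else 0) +
        if 0 = b ∧ r = q then dz a p (dz 0 s u) z else 0) +
      (z 1 r * dz a p (dz b q (dz 1 s u)) z + (if 1 = a ∧ r = p then dz b q (dz 1 s u) z else 0) +
        if 1 = b ∧ r = q then dz a p (dz 1 s u) z else 0) := by
    intro a p b q
    have hev : dz b q (matrixUnitOp r s u) =ᶠ[𝓝 z] _ :=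
      eventually_of_mem (hU.mem_nhds hz) (h₁ b q)
    have hm : ∀ c, DifferentiableOn ℂ (fun y : Mat2 lam => y c r * dz b q (dz c s u) y) U :=
      fun c => (hc c r).fun_mul (hdd b q c s)
    have hi : ∀ c, DifferentiableOn ℂ (fun y => if c = b ∧ r = q then dz c s u y else 0) U :=
      fun c => hited _ _ (hd c s)
    rw [dz_congr hev, dz_add (hat ((hm 0).fun_add (hi 0)) hz) (hat ((hm 1).fun_add (hi 1)) hz),
      dz_add (hat (hm 0) hz) (hat (hi 0) hz), dz_add (hat (hm 1) hz) (hat (hi 1) hz),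
      dz_coord_mul _ _ (hat (hdd b q 0 s) hz), dz_coord_mul _ _ (hat (hdd b q 1 s) hz),
      hite, hite]
  rw [h₂, h₂, square_dz hU hu hsq 0 s p q hz, square_dz hU hu hsq 1 s p q hz]
  have e₁ := hsq z hz p s
  have e₂ := hsq z hz q s
  simp only [zero_ne_one, one_ne_zero, true_and, false_and, if_false]
  split_ifs
  · linear_combination e₁ - e₂
  · linear_combination -e₂
  · linear_combination e₁
  · ring

/-- The operator of `E_{(i,0),(j,n_j-1)}` raises the parameter by `ε^{(i)} - ε^{(j)}`: this matrix
unit spans a weight space of the adjoint action of `H_lam`. -/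
theorem IsSection.raise (hu : IsSection β U u) (hU : IsOpen U) (i j : Fin lam.len) :
    IsSection (shift β i j 1) U (matrixUnitOp (first lam i) (last lam j) u) where
  holo := differentiableOn_matrixUnitOp hU hu.holo _ _
  square z hz p q := square_matrixUnitOp hU hu.holo hu.square _ _ p q hz
  equivariant z hz := by
    have hfst : ∀ k, Tendsto (fun y : Mat2 lam × Vec lam => y.2 (first lam k))
        (𝓝 (z, groupOne lam)) (𝓝 1) := by
      intro k
      have : Continuous fun y : Mat2 lam × Vec lam => y.2 (first lam k) := by fun_prop
      simpa [groupOne, first] using this.tendsto (z, groupOne lam)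
    have hactc : Continuous fun y : Mat2 lam × Vec lam => act y.1 y.2 := by
      refine continuous_pi fun c => continuous_pi fun ⟨k, b⟩ => ?_
      simp only [act_apply]
      refine continuous_finsetSum _ fun a _ => ?_
      split_ifs <;> fun_prop
    have hmem : ∀ᶠ y : Mat2 lam × Vec lam in 𝓝 (z, groupOne lam), act y.1 y.2 ∈ U := by
      have := hactc.tendsto (z, groupOne lam)
      rw [act_groupOne] at this
      exact this.eventually (hU.mem_nhds hz)
    have hmem' : ∀ᶠ y : Mat2 lam × Vec lam in 𝓝 (z, groupOne lam), y.1 ∈ U :=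
      (continuous_fst.tendsto _).eventually (hU.mem_nhds hz)
    filter_upwards [(hu.equivariant z hz).eventually_nhds, hmem, hmem',
      (hfst i).eventually_ne one_ne_zero, (hfst j).eventually_ne one_ne_zero]
      with ⟨y, h⟩ heq hyh hy hi hj
    simp only at heq hyh hy hi hj ⊢
    -- For `E = E_{(i,0),(j,n_j-1)}` the derivative of `u(y h) = u(y) χ(h; β)` in the direction `y E`
    -- is the claim up to scalars, since `h E = h_0^{(i)} E` and `E h = h_0^{(j)} E`.
    have hline : (fun y' => u (act y' h)) =ᶠ[𝓝 y] fun y' => u y' * characterNearOne β h :=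
      (Continuous.tendsto (f := fun y' : Mat2 lam => (y', h)) (by fun_prop) y).eventually heq
    have h₁ : HasFDerivAt (fun y' => u (act y' h)) ((fderiv ℂ u (act y h)).comp (actLinear h)) y :=
      (hu.holo.differentiableAt (hU.mem_nhds hyh)).hasFDerivAt.comp y (actLinear h).hasFDerivAt
    have h₂ := ((hu.holo.differentiableAt (hU.mem_nhds hy)).hasFDerivAt.mul_const
      (characterNearOne β h)).congr_of_eventuallyEq hline
    have h₃ := DFunLike.congr_fun (h₁.unique h₂) (moveColumn (first lam i) (last lam j) y)
    rw [ContinuousLinearMap.comp_apply, actLinear_apply, act_moveColumn, map_smul,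
      smul_apply] at h₃
    rw [characterNearOne, character_shift, Int.cast_one, one_mul, Complex.exp_sub, Complex.exp_log hi,
      Complex.exp_log hj, matrixUnitOp_eq,
      matrixUnitOp_eq, moveColumn_act, map_smul, ← characterNearOne]
    simp only [smul_eq_mul] at h₃ ⊢
    field_simp
    linear_combination h₃

end Sections

/-! ### Sections of the restricted sheaf -/

section Restricted

variable {lam : TuplePartition N} {i j : Fin lam.len} {Ω : Set (Vec lam)} {β : Vec lam}
  {v : Vec lam → ℂ}

/-- The linear part of the embedding of the slice. -/
def embedLinear (lam : TuplePartition N) : Vec lam →L[ℂ] Mat2 lam :=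
  ContinuousLinearMap.pi fun a => if a = 0 then ContinuousLinearMap.id ℂ (Vec lam) else 0

theorem hasFDerivAt_embed (x : Vec lam) :
    HasFDerivAt (embed : Vec lam → Mat2 lam) (embedLinear lam) x := by
  have : (embed : Vec lam → Mat2 lam) = fun x => embedLinear lam x + embed 0 := by
    funext x a p
    by_cases ha : a = 0 <;> simp [embed, embedLinear, ha]
  rw [this]
  exact (embedLinear lam).hasFDerivAt.add_const _

theorem D_comp_embed {p : Idx lam} {f : Mat2 lam → ℂ} {x : Vec lam}
    (hf : DifferentiableAt ℂ f (embed x)) : D p (fun y => f (embed y)) x = dz 0 p f (embed x) := by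
  have h := hf.hasFDerivAt.comp x (hasFDerivAt_embed x)
  rw [D, show (fun y => f (embed y)) = f ∘ embed from rfl, h.fderiv, dz,
    ContinuousLinearMap.comp_apply]
  congr 1
  funext a
  by_cases ha : a = 0
  · subst ha
    simp [embedLinear]
  · simp [embedLinear, ha]

theorem IsResSection.exists_eventually (hv : IsResSection β Ω v) (hΩ : IsOpen Ω) {x : Vec lam}
    (hx : x ∈ Ω) : ∃ U : Set (Mat2 lam), IsOpen U ∧ ∃ u : Mat2 lam → ℂ, IsSection β U u ∧
      ∀ᶠ y in 𝓝 x, embed y ∈ U ∧ v y = u (embed y) := by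
  obtain ⟨U, hU, -, hxU, u, hu, heq⟩ := hv x hx
  refine ⟨U, hU, u, hu, ?_⟩
  filter_upwards [hΩ.mem_nhds hx,
    (hasFDerivAt_embed x).continuousAt.preimage_mem_nhds (hU.mem_nhds hxU)] with y hy hyU
    using ⟨hyU, heq y hy hyU⟩

theorem IsResSection.differentiableOn (hv : IsResSection β Ω v) (hΩ : IsOpen Ω) :
    DifferentiableOn ℂ v Ω := by
  intro x hx
  obtain ⟨U, hU, u, hu, hev⟩ := hv.exists_eventually hΩ hx
  have h₁ := (hu.holo.differentiableAt (hU.mem_nhds hev.self_of_nhds.1)).comp x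
    (hasFDerivAt_embed x).differentiableAt
  exact (h₁.congr_of_eventuallyEq (hev.mono fun y hy => hy.2)).differentiableWithinAt

theorem D_eventuallyEq_dz {U : Set (Mat2 lam)} (hU : IsOpen U) {u : Mat2 lam → ℂ}
    (hu : DifferentiableOn ℂ u U) {x : Vec lam} (p : Idx lam)
    (hev : ∀ᶠ y in 𝓝 x, embed y ∈ U ∧ v y = u (embed y)) :
    D p v =ᶠ[𝓝 x] fun y => dz 0 p u (embed y) := by
  filter_upwards [hev.eventually_nhds] with y hy
  rw [D_congr (hy.mono fun z hz => hz.2)]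
  exact D_comp_embed (hu.differentiableAt (hU.mem_nhds hy.self_of_nhds.1))

theorem embed_zero_apply (x : Vec lam) (p : Idx lam) : embed x 0 p = x p := by
  simp [embed]

theorem embed_one_first (x : Vec lam) (k : Fin lam.len) : embed x 1 (first lam k) = 1 := by
  simp [embed, first]

/-- On the slice the equivariance determines the derivatives in the second row. -/
theorem IsSection.dz_one_last {U : Set (Mat2 lam)} (hU : IsOpen U) {u : Mat2 lam → ℂ}
    (hu : IsSection β U u) {x : Vec lam} (hx : embed x ∈ U) (k : Fin lam.len) :
    dz 1 (last lam k) u (embed x) =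
      β (last lam k) * u (embed x) - x (first lam k) * dz 0 (last lam k) u (embed x) := by
  have := hu.matrixUnitOp_self hU hx k
  rw [matrixUnitOp, embed_zero_apply, embed_one_first] at this
  linear_combination this

theorem IsResSection.raise (hv : IsResSection β Ω v) (hΩ : IsOpen Ω) (i j : Fin lam.len) :
    IsResSection (shift β i j 1) Ω (contig i j β v) := by
  intro x hx
  obtain ⟨U, hU, hUZ, hxU, u, hu, heq⟩ := hv x hx
  refine ⟨U, hU, hUZ, hxU, matrixUnitOp (first lam i) (last lam j) u, hu.raise hU i j, ?_⟩
  intro y hy hyU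
  have hev : ∀ᶠ z in 𝓝 y, embed z ∈ U ∧ v z = u (embed z) := by
    filter_upwards [hΩ.mem_nhds hy,
      (hasFDerivAt_embed y).continuousAt.preimage_mem_nhds (hU.mem_nhds hyU)] with z hz hzU
      using ⟨hzU, heq z hz hzU⟩
  rw [contig, matrixUnitOp, (D_eventuallyEq_dz hU hu.holo (last lam j) hev).self_of_nhds,
    hev.self_of_nhds.2, hu.dz_one_last hU hyU, embed_zero_apply, embed_one_first]
  ring

theorem IsResSection.const_mul (hv : IsResSection β Ω v) (c : ℂ) :
    IsResSection β Ω fun x => c * v x := by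
  intro x hx
  obtain ⟨U, hU, hUZ, hxU, u, hu, heq⟩ := hv x hx
  have hdz : ∀ a p, ∀ y ∈ U, dz a p (fun z => c * u z) y = c * dz a p u y := fun a p y hy =>
    dz_const_mul c (hu.holo.differentiableAt (hU.mem_nhds hy))
  have hdz₂ : ∀ a p b q, ∀ y ∈ U, dz a p (dz b q fun z => c * u z) y =
      c * dz a p (dz b q u) y := by
    intro a p b q y hy
    rw [dz_congr (eventually_of_mem (hU.mem_nhds hy) (hdz b q))]
    exact dz_const_mul c ((differentiableOn_dz hU hu.holo).differentiableAt (hU.mem_nhds hy))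
  refine ⟨U, hU, hUZ, hxU, fun z => c * u z, ⟨hu.holo.const_mul c, ?_, ?_⟩, ?_⟩
  · intro z hz p q
    rw [hdz₂ _ _ _ _ z hz, hdz₂ _ _ _ _ z hz, ← mul_sub, hu.square z hz, mul_zero]
  · intro z hz
    filter_upwards [hu.equivariant z hz] with y hy
    rw [hy, mul_assoc]
  · intro y hy hyU
    simp only [heq y hy hyU]

theorem IsResSection.congr {w : Vec lam → ℂ} (hv : IsResSection β Ω v)
    (h : ∀ x ∈ Ω, w x = v x) : IsResSection β Ω w := by
  intro x hx
  obtain ⟨U, hU, hUZ, hxU, u, hu, heq⟩ := hv x hx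
  exact ⟨U, hU, hUZ, hxU, u, hu, fun y hy hyU => (h y hy).trans (heq y hy hyU)⟩

/-- On the slice the equation `□_{p,q} u = 0` for the last indices `p`, `q` of two blocks becomes
the Euler-Poisson-Darboux equation. -/
theorem IsResSection.epd (hv : IsResSection β Ω v) (hij : i ≠ j) (hΩ : IsOpen Ω) {x : Vec lam}
    (hx : x ∈ Ω) : EPD i j β v x := by
  obtain ⟨U, hU, u, hu, hev⟩ := hv.exists_eventually hΩ hx
  have hxU := hev.self_of_nhds.1
  have hdv := hv.differentiableOn hΩ
  have hat : ∀ {f : Vec lam → ℂ}, DifferentiableOn ℂ f Ω → DifferentiableAt ℂ f x :=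
    fun hf => hf.differentiableAt (hΩ.mem_nhds hx)
  have hone : ∀ k p, p ≠ first lam k → dz 0 p (dz 1 (last lam k) u) (embed x) =
      β (last lam k) * D p v x - x (first lam k) * D p (D (last lam k) v) x := by
    intro k p hp
    have hrow : (fun y => dz 1 (last lam k) u (embed y)) =ᶠ[𝓝 x]
        fun y => β (last lam k) * v y - y (first lam k) * D (last lam k) v y := by
      filter_upwards [hev, D_eventuallyEq_dz hU hu.holo (last lam k) hev] with y hy hyD
      rw [hu.dz_one_last hU hy.1, hy.2, hyD]
    have hDk := hat (differentiableOn_D (p := last lam k) hΩ hdv)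
    have hcoord : DifferentiableAt ℂ (fun y : Vec lam => y (first lam k)) x := by fun_prop
    rw [← D_comp_embed ((differentiableOn_dz hU hu.holo).differentiableAt (hU.mem_nhds hxU)),
      D_congr hrow, D_sub ((hat hdv).const_mul _) (hcoord.fun_mul hDk), D_const_mul _ (hat hdv),
      D_mul hcoord hDk, D_coord, if_neg hp.symm]
    ring
  have h₁ := hone j (last lam i) (last_ne_first hij)
  have h₂ := hone i (last lam j) (last_ne_first hij.symm)
  have h₃ := hu.square _ hxU (last lam i) (last lam j)
  rw [dz_comm (a := 1) hU hu.holo hxU, h₁, h₂, D_comm (p := last lam j) hΩ hdv hx] at h₃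
  rw [EPD]
  linear_combination h₃

end Restricted

section RestrictedLadder

variable {lam : TuplePartition N} {i j : Fin lam.len} {Ω : Set (Vec lam)} {α : Vec lam}

theorem isResSection_of_operators (hΩ : IsOpen Ω) {u : ℤ → Vec lam → ℂ}
    (h₀ : IsResSection α Ω (u 0))
    (hH : ∀ m : ℤ, 0 ≤ m → ∀ x ∈ Ω, u (m + 1) x = opH i j α m (u m) x)
    (hB : ∀ m : ℤ, m ≤ 0 → ∀ x ∈ Ω, u (m - 1) x = opB i j α m (u m) x) (m : ℤ) :
    IsResSection (shift α i j m) Ω (u m) := by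
  induction m using Int.induction_on with
  | zero => rwa [shift_zero]
  | succ n ih =>
    rw [← shift_shift]
    exact (ih.raise hΩ i j).congr (hH n (by positivity))
  | pred n ih =>
    rw [sub_eq_add_neg, ← shift_shift, ← shift_swap]
    exact ((ih.raise hΩ j i).const_mul _).congr (hB (-n) (by omega))

theorem isLadder_of_operators (hij : i ≠ j) (hα : IsGeneric α) (hΩ : IsOpen Ω)
    (hX : ∀ x ∈ Ω, x (first lam i) - x (first lam j) ≠ 0) {u : ℤ → Vec lam → ℂ}
    (hu : ∀ m, IsResSection (shift α i j m) Ω (u m))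
    (hH : ∀ m : ℤ, 0 ≤ m → ∀ x ∈ Ω, u (m + 1) x = opH i j α m (u m) x)
    (hB : ∀ m : ℤ, m ≤ 0 → ∀ x ∈ Ω, u (m - 1) x = opB i j α m (u m) x) :
    IsLadder i j α Ω u where
  holo m := (hu m).differentiableOn hΩ
  raise m x hx := by
    rcases le_or_gt 0 m with hm | hm
    · exact (hH m hm x hx).symm
    · -- `u_m = B_{m+1} u_{m+1}`, and raising this is the ladder relation with `i`, `j` exchanged.
      have hc := cConst_ne_zero (i := i) (j := j) hα (m + 1)
      have hd := (hu (m + 1)).differentiableOn hΩ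
      have hev : u m =ᶠ[𝓝 x] fun y => 1 / cConst i j α (m + 1) *
          contig j i (shift α i j (m + 1)) (u (m + 1)) y := by
        filter_upwards [hΩ.mem_nhds hx] with y hy
        have := hB (m + 1) (by omega) y hy
        rwa [add_sub_cancel_right] at this
      have hcd : DifferentiableAt ℂ (contig j i (shift α i j (m + 1)) (u (m + 1))) x :=
        (((hu (m + 1)).raise hΩ j i).differentiableOn hΩ).differentiableAt (hΩ.mem_nhds hx)
      have hXx : x (first lam j) - x (first lam i) ≠ 0 := by
        rw [← neg_sub]
        exact neg_ne_zero.2 (hX x hx)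
      have hcc : cConst j i α (-m) = cConst i j α (m + 1) := by
        rw [cConst, cConst]
        split_ifs <;> push_cast <;> ring
      have key := (contig_contig_iff hij.symm hΩ hd α (-(m + 1)) hx hXx).2
      rw [show -(m + 1) + 1 = -m by ring, shift_swap (i := i) (j := j) α (-m),
        shift_swap (i := i) (j := j) α (-(m + 1)), neg_neg, neg_neg, hcc] at key
      rw [contig_congr hev, contig_const_mul _ hcd, key ((hu (m + 1)).epd hij.symm hΩ hx)]
      field_simp
  lower m x hx := by
    rcases le_or_gt m 0 with hm | hm
    · have hc := cConst_ne_zero (i := i) (j := j) hα m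
      rw [hB m hm x hx, opB]
      field_simp
    · have hev : u m =ᶠ[𝓝 x] contig i j (shift α i j (m - 1)) (u (m - 1)) := by
        filter_upwards [hΩ.mem_nhds hx] with y hy
        have := hH (m - 1) (by omega) y hy
        rwa [sub_add_cancel] at this
      have key := (contig_contig_iff hij hΩ ((hu (m - 1)).differentiableOn hΩ) α (m - 1) hx
        (hX x hx)).2 ((hu (m - 1)).epd hij hΩ hx)
      rw [sub_add_cancel] at key
      rw [contig_congr hev, key]

end RestrictedLadder

/-! ### Regularity of the characters -/

section Regularity

variable {lam : TuplePartition N}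

theorem theta_eq_sum (r : ℕ) (x : ℕ → ℂ) : theta r x = ∑ c : Composition r,
    (-1) ^ (c.length + 1) / (c.length : ℂ) * ∏ n : Fin c.length, x (c.blocksFun n) / x 0 := by
  refine Finset.sum_congr rfl fun c _ => ?_
  rw [← Composition.ofFn_blocksFun, List.map_ofFn, List.prod_ofFn]
  rfl

theorem differentiable_entry (k : Fin lam.len) (r : ℕ) :
    Differentiable ℂ fun h : Vec lam => entry h k r := by
  unfold entry
  split_ifs <;> fun_prop

theorem continuousOn_block_theta {Y : Type*} [TopologicalSpace Y] {S : Set Y} {h : Y → Vec lam}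
    (β : Vec lam) (k : Fin lam.len) (hh : ContinuousOn h S) (h0 : ∀ y ∈ S, h y (first lam k) ≠ 0) :
    ContinuousOn (fun y => ∑ r ∈ Finset.Ico 1 (lam.part k),
      entry β k r * theta r (entry (h y) k)) S := by
  simp only [theta_eq_sum, entry_zero]
  have he : ∀ r, ContinuousOn (fun y => entry (h y) k r) S := fun r =>
    (differentiable_entry k r).continuous.comp_continuousOn hh
  have h1 : ContinuousOn (fun y => h y (first lam k)) S :=
    (continuous_apply (first lam k)).comp_continuousOn hh
  refine continuousOn_finsetSum _ fun r _ => continuousOn_const.mul ?_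
  refine continuousOn_finsetSum _ fun c _ => continuousOn_const.mul ?_
  exact continuousOn_finsetProd _ fun n _ => (he _).div h1 h0

theorem differentiableAt_unipotentExp {E : Type*} [NormedAddCommGroup E] [NormedSpace ℂ E]
    {h : E → Vec lam} {x : E} (β : Vec lam) (hh : DifferentiableAt ℂ h x)
    (h0 : ∀ k, h x (first lam k) ≠ 0) : DifferentiableAt ℂ (fun y => unipotentExp β (h y)) x := by
  simp only [unipotentExp, theta_eq_sum, entry_zero, div_eq_mul_inv]
  have he : ∀ k r, DifferentiableAt ℂ (fun y => entry (h y) k r) x := fun k r =>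
    (differentiable_entry k r).differentiableAt.comp x hh
  have h1 : ∀ k, DifferentiableAt ℂ (fun y => h y (first lam k)) x := fun k =>
    differentiableAt_pi.1 hh (first lam k)
  refine DifferentiableAt.fun_sum fun k _ => DifferentiableAt.fun_sum fun r _ => ?_
  refine (DifferentiableAt.fun_sum fun c _ => ?_).const_mul _
  refine DifferentiableAt.const_mul ?_ _
  exact (HasFDerivAt.finsetProd fun n _ =>
    ((he k _).fun_mul ((h1 k).fun_inv (h0 k))).hasFDerivAt).differentiableAt

/-- A continuous branch of the logarithm of a holomorphic function is holomorphic. -/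
theorem differentiableAt_of_exp_eq {E : Type*} [NormedAddCommGroup E] [NormedSpace ℂ E]
    {f g : E → ℂ} {x : E} (hf : ContinuousAt f x) (hg : DifferentiableAt ℂ g x)
    (h : ∀ᶠ y in 𝓝 x, Complex.exp (f y) = g y) : DifferentiableAt ℂ f x := by
  have hgx : g x ≠ 0 := h.self_of_nhds ▸ Complex.exp_ne_zero _
  -- Near `x` the branch differs from the principal branch of `log (g y / g x)` by a constant.
  have hd : DifferentiableAt ℂ (fun y => Complex.log (g y * (g x)⁻¹) + f x) x :=
    ((hg.mul_const (g x)⁻¹).clog (by simp [hgx])).add_const _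
  refine hd.congr_of_eventuallyEq ?_
  have him : ∀ᶠ y in 𝓝 x, |(f y - f x).im| < Real.pi := by
    have : ContinuousAt (fun y => |(f y - f x).im|) x := by fun_prop
    exact this.eventually_lt_const (by simpa using Real.pi_pos)
  filter_upwards [h, him] with y hy hyim
  obtain ⟨h₁, h₂⟩ := abs_lt.1 hyim
  rw [← hy, ← h.self_of_nhds, ← div_eq_mul_inv, ← Complex.exp_sub, Complex.log_exp h₁ h₂.le, sub_add_cancel]

theorem linForm_embed_first (s : ℂ) (x : Vec lam) (k : Fin lam.len) :
    linForm s (embed x) (first lam k) = s + x (first lam k) := by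
  simp [linForm, embed, first, add_comm]

theorem linForm_embed_add_single (s : ℂ) (x : Vec lam) (q : Idx lam) (ε : ℂ) :
    linForm s (embed (x + ε • Pi.single q 1)) = linForm s (embed x) + ε • Pi.single q 1 := by
  funext p
  simp only [linForm, embed, if_true, Pi.add_apply]
  ring_nf
  simp

theorem linForm_embed_eq (s : ℂ) (x : Vec lam) :
    linForm s (embed x) = fun p => x p + s * embed (0 : Vec lam) 1 p := by
  funext p
  simp [linForm, embed]

theorem D_eq_of_affine {p : Idx lam} {f : Vec lam → ℂ} {x : Vec lam} {c : ℂ}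
    (hf : DifferentiableAt ℂ f x)
    (h : ∀ ε : ℂ, f (x + ε • Pi.single p 1) = f x + c * ε) : D p f x = c := by
  have hline : HasDerivAt (fun ε : ℂ => x + ε • (Pi.single p 1 : Vec lam)) (Pi.single p 1) 0 := by
    simpa using ((hasDerivAt_id (0 : ℂ)).smul_const (Pi.single p 1 : Vec lam)).const_add x
  have h₁ := HasFDerivAt.comp_hasDerivAt_of_eq 0 hf.hasFDerivAt hline (by simp)
  have h₂ : HasDerivAt (fun ε : ℂ => f x + c * ε) c 0 := by
    simpa using ((hasDerivAt_id (0 : ℂ)).const_mul c).const_add (f x)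
  rw [show f ∘ (fun ε : ℂ => x + ε • (Pi.single p 1 : Vec lam)) = fun ε => f x + c * ε from
    funext h] at h₁
  exact h₁.unique h₂

theorem D_sum {κ : Type*} (s : Finset κ) {p : Idx lam} {f : κ → Vec lam → ℂ} {x : Vec lam}
    (hf : ∀ n ∈ s, DifferentiableAt ℂ (f n) x) :
    D p (fun y => ∑ n ∈ s, f n y) x = ∑ n ∈ s, D p (f n) x := by
  simp [D, fderiv_fun_sum hf]

end Regularity

/-! ### Integrals of the character over moving paths -/

section MovingPath

open MeasureTheory

variable {lam : TuplePartition N} {W : Set (Vec lam)}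

/-- A path `t ↦ σ(x, t)`, `0 < t ≤ 1`, in the `s`-line with density `ρ(x, t)`, together with
branches `w_k` of `log (s + x_0^{(k)})` along it. It depends holomorphically on `x`, and does not
depend on the last coordinate of any block. -/
structure IsMovingPath (W : Set (Vec lam)) (w : Vec lam → ℝ → Fin lam.len → ℂ)
    (σ ρ : Vec lam → ℝ → ℂ) : Prop where
  continuousOn_log : ∀ t ∈ Set.Ioc (0 : ℝ) 1, ∀ k, ContinuousOn (fun x => w x t k) W
  exp_log : ∀ x ∈ W, ∀ t ∈ Set.Ioc (0 : ℝ) 1, ∀ k,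
    Complex.exp (w x t k) = σ x t + x (first lam k)
  differentiable_path : ∀ t, Differentiable ℂ fun x => σ x t
  differentiable_density : ∀ t, Differentiable ℂ fun x => ρ x t
  path_add : ∀ x t k (ε : ℂ), σ (x + ε • Pi.single (last lam k) 1) t = σ x t
  density_add : ∀ x t k (ε : ℂ), ρ (x + ε • Pi.single (last lam k) 1) t = ρ x t

/-- The pullback of `χ((1, s) x; β) ds` to the path. -/
def pathIntegrand (β : Vec lam) (w : Vec lam → ℝ → Fin lam.len → ℂ) (σ ρ : Vec lam → ℝ → ℂ)
    (x : Vec lam) (t : ℝ) : ℂ :=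
  character β (w x t) (linForm (σ x t) (embed x)) * ρ x t

variable {w : Vec lam → ℝ → Fin lam.len → ℂ} {σ ρ : Vec lam → ℝ → ℂ}

theorem IsMovingPath.path_add_ne_zero (h : IsMovingPath W w σ ρ) {x : Vec lam} (hx : x ∈ W)
    {t : ℝ} (ht : t ∈ Set.Ioc (0 : ℝ) 1) (k : Fin lam.len) : σ x t + x (first lam k) ≠ 0 :=
  h.exp_log x hx t ht k ▸ Complex.exp_ne_zero _

theorem IsMovingPath.differentiableAt_log (h : IsMovingPath W w σ ρ) (hW : IsOpen W) {x : Vec lam}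
    (hx : x ∈ W) {t : ℝ} (ht : t ∈ Set.Ioc (0 : ℝ) 1) (k : Fin lam.len) :
    DifferentiableAt ℂ (fun x => w x t k) x := by
  refine differentiableAt_of_exp_eq (g := fun x => σ x t + x (first lam k))
    ((h.continuousOn_log t ht k).continuousAt (hW.mem_nhds hx)) ?_ ?_
  · have := h.differentiable_path t
    fun_prop
  · filter_upwards [hW.mem_nhds hx] with y hy using h.exp_log y hy t ht k

theorem IsMovingPath.differentiableAt_unipotentExp (h : IsMovingPath W w σ ρ) (β : Vec lam)
    {x : Vec lam} (hx : x ∈ W) {t : ℝ} (ht : t ∈ Set.Ioc (0 : ℝ) 1) :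
    DifferentiableAt ℂ (fun x => unipotentExp β (linForm (σ x t) (embed x))) x := by
  refine GelfandToda.differentiableAt_unipotentExp β ?_ fun k => ?_
  · simp only [linForm_embed_eq]
    have := h.differentiable_path t
    fun_prop
  · rw [linForm_embed_first]
    exact h.path_add_ne_zero hx ht k

theorem IsMovingPath.differentiableAt_pathIntegrand (h : IsMovingPath W w σ ρ) (hW : IsOpen W)
    (β : Vec lam) {x : Vec lam} (hx : x ∈ W) {t : ℝ} (ht : t ∈ Set.Ioc (0 : ℝ) 1) :
    DifferentiableAt ℂ (fun x => pathIntegrand β w σ ρ x t) x := by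
  have h₁ := h.differentiableAt_log hW hx ht
  have h₂ := h.differentiableAt_unipotentExp β hx ht
  have h₃ := h.differentiable_density t
  simp only [pathIntegrand, character_eq]
  fun_prop

/-- The derivative of the integrand in the last coordinate of a block is the integrand times
`β / (s + x_0)`, for blocks of any size. -/
theorem IsMovingPath.D_pathIntegrand (h : IsMovingPath W w σ ρ) (hW : IsOpen W)
    (β : Vec lam) {x : Vec lam} (hx : x ∈ W) {t : ℝ} (ht : t ∈ Set.Ioc (0 : ℝ) 1)
    (k : Fin lam.len) : D (last lam k) (fun x => pathIntegrand β w σ ρ x t) x =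
      β (last lam k) / (σ x t + x (first lam k)) * pathIntegrand β w σ ρ x t := by
  have h₁ := h.differentiableAt_log hW hx ht
  have h₂ := h.differentiableAt_unipotentExp β hx ht
  have h₃ := h.differentiable_density t
  have h₄ : ∀ l, DifferentiableAt ℂ (fun x => β (first lam l) * w x t l) x := fun l =>
    (h₁ l).const_mul _
  have hlog : ∀ l, D (last lam k) (fun x => w x t l) x =
      (if first lam l = last lam k then 1 else 0) / (σ x t + x (first lam l)) := by
    intro l
    rw [D_eq_div_of_exp_eq (h₁ l) (g := fun x => σ x t + x (first lam l))
      (by filter_upwards [hW.mem_nhds hx] with y hy using h.exp_log y hy t ht l),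
      D_add (h.differentiable_path t).differentiableAt (by fun_prop), D_coord,
      D_eq_of_affine (c := 0) (h.differentiable_path t).differentiableAt
        (fun ε => by rw [h.path_add, zero_mul, add_zero]), zero_add]
  have huni : D (last lam k) (fun x => unipotentExp β (linForm (σ x t) (embed x))) x =
      if lam.part k = 1 then 0 else β (last lam k) / (σ x t + x (first lam k)) := by
    refine D_eq_of_affine h₂ fun ε => ?_
    simp only [h.path_add, linForm_embed_add_single, unipotentExp_add_single_last,
      linForm_embed_first]
    split_ifs <;> ring
  have hsum : ∑ l, β (first lam l) * D (last lam k) (fun x => w x t l) x =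
      if lam.part k = 1 then β (last lam k) / (σ x t + x (first lam k)) else 0 := by
    simp only [hlog]
    rw [Finset.sum_eq_single k]
    · simp only [first_eq_last_iff]
      split_ifs with hk
      · rw [last_eq_first_iff.2 hk, mul_one_div]
      · rw [zero_div, mul_zero]
    · intro l _ hl
      rw [if_neg (last_ne_first (Ne.symm hl)).symm, zero_div, mul_zero]
    · simp
  simp only [pathIntegrand, character_eq]
  rw [D_mul (by fun_prop) (by fun_prop), D_exp (by fun_prop), D_add (by fun_prop) (by fun_prop),
    D_sum _ fun l _ => h₄ l, huni,
    D_eq_of_affine (f := fun x => ρ x t) (c := 0) h₃.differentiableAt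
      (fun ε => by rw [h.density_add, zero_mul, add_zero])]
  simp only [D_const_mul _ (h₁ _), hsum]
  split_ifs <;> ring

/-- The integral of the character over a path. -/
def pathIntegral (β : Vec lam) (w : Vec lam → ℝ → Fin lam.len → ℂ) (σ ρ : Vec lam → ℝ → ℂ)
    (x : Vec lam) : ℂ :=
  ∫ t in (0 : ℝ)..1, pathIntegrand β w σ ρ x t

/-- The integrand is measurable, and bounded locally uniformly in `x`. -/
def IsLocallyBounded (β : Vec lam) (W : Set (Vec lam)) (w : Vec lam → ℝ → Fin lam.len → ℂ)
    (σ ρ : Vec lam → ℝ → ℂ) : Prop :=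
  (∀ x ∈ W, ContinuousOn (pathIntegrand β w σ ρ x) (Set.Ioc 0 1)) ∧
  ∀ x ∈ W, ∃ M : ℝ, ∀ᶠ y in 𝓝 x, ∀ t ∈ Set.Ioc (0 : ℝ) 1, ‖pathIntegrand β w σ ρ y t‖ ≤ M

/-- Contiguity for integrals over a path. It holds for the integrands: with `s = σ(x, t)`,
`(x_0^{(i)} - x_0^{(j)}) / (s + x_0^{(j)}) + 1 = (s + x_0^{(i)}) / (s + x_0^{(j)})`. -/
theorem IsMovingPath.contig_pathIntegral (h : IsMovingPath W w σ ρ) (hW : IsOpen W) {β : Vec lam}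
    (hb : IsLocallyBounded β W w σ ρ) {x : Vec lam} (hx : x ∈ W) (i j : Fin lam.len) :
    DifferentiableAt ℂ (pathIntegral β w σ ρ) x ∧
      contig i j β (pathIntegral β w σ ρ) x =
        β (last lam j) * pathIntegral (shift β i j 1) w σ ρ x := by
  obtain ⟨M, hM⟩ := hb.2 x hx
  have hs : {y | y ∈ W ∧ ∀ t ∈ Set.Ioc (0 : ℝ) 1, ‖pathIntegrand β w σ ρ y t‖ ≤ M} ∈ 𝓝 x :=
    Filter.inter_mem (hW.mem_nhds hx) hM
  have hmeas : ∀ y ∈ W, AEStronglyMeasurable (pathIntegrand β w σ ρ y)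
      (volume.restrict (Set.Ioc (0 : ℝ) 1)) := fun y hy =>
    (hb.1 y hy).aestronglyMeasurable measurableSet_Ioc
  obtain ⟨hint, hder⟩ := hasFDerivAt_integral_of_bounded
    (μ := volume.restrict (Set.Ioc (0 : ℝ) 1)) (f := pathIntegrand β w σ ρ) (M := M) hs
    (fun y hy => hmeas y hy.1)
    (by
      filter_upwards [ae_restrict_mem measurableSet_Ioc] with t ht y hy
      exact (h.differentiableAt_pathIntegrand hW β hy.1 ht).differentiableWithinAt)
    (by
      filter_upwards [ae_restrict_mem measurableSet_Ioc] with t ht y hy using hy.2 t ht)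
  have hG : pathIntegral β w σ ρ =
      fun y => ∫ t in Set.Ioc (0 : ℝ) 1, pathIntegrand β w σ ρ y t :=
    funext fun y => intervalIntegral.integral_of_le zero_le_one
  rw [hG]
  refine ⟨hder.differentiableAt, ?_⟩
  have hInt : Integrable (pathIntegrand β w σ ρ x) (volume.restrict (Set.Ioc (0 : ℝ) 1)) := by
    refine Integrable.of_bound (hmeas x hx) M ?_
    filter_upwards [ae_restrict_mem measurableSet_Ioc] with t ht using hM.self_of_nhds t ht
  rw [contig, D, hder.fderiv, ContinuousLinearMap.integral_apply hint, ← integral_const_mul,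
    ← integral_const_mul, ← integral_add ((hint.apply_continuousLinearMap _).const_mul _)
      (hInt.const_mul _), pathIntegral, intervalIntegral.integral_of_le zero_le_one,
    ← integral_const_mul]
  refine setIntegral_congr_fun measurableSet_Ioc fun t ht => ?_
  have hD := h.D_pathIntegrand hW β hx ht j
  have hj := h.path_add_ne_zero hx ht j
  rw [D] at hD
  simp only [hD]
  have hshift : pathIntegrand (shift β i j 1) w σ ρ x t = pathIntegrand β w σ ρ x t *
      ((σ x t + x (first lam i)) / (σ x t + x (first lam j))) := by
    rw [pathIntegrand, character_shift, Int.cast_one, one_mul, Complex.exp_sub,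
      h.exp_log x hx t ht, h.exp_log x hx t ht, pathIntegrand]
    ring
  rw [hshift]
  field_simp
  ring

end MovingPath

/-! ### Bounds for the integrands of twisted cycles -/

section Bounds

variable {lam : TuplePartition N} {W : Set (Vec lam)}

theorem exists_eventually_norm_le {f : Vec lam × ℝ → ℂ} {I : Set ℝ} (hW : IsOpen W)
    (hI : IsCompact I) (hf : ContinuousOn f (W ×ˢ I)) {x : Vec lam} (hx : x ∈ W) :
    ∃ M : ℝ, ∀ᶠ y in 𝓝 x, ∀ t ∈ I, ‖f (y, t)‖ ≤ M := by
  obtain ⟨K, hK, hxK, hKW⟩ := exists_compact_subset hW hx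
  obtain ⟨M, hM⟩ := (hK.prod hI).exists_bound_of_continuousOn
    (hf.mono (Set.prod_mono hKW le_rfl))
  refine ⟨M, ?_⟩
  filter_upwards [mem_interior_iff_mem_nhds.1 hxK] with y hy t ht using hM (y, t) ⟨hy, ht⟩

theorem continuous_linForm_embed : Continuous fun y : ℂ × Vec lam => linForm y.1 (embed y.2) := by
  simp only [linForm_embed_eq]
  fun_prop

theorem continuousOn_pathIntegrand {S : Set (Vec lam × ℝ)} {w : Vec lam → ℝ → Fin lam.len → ℂ}
    {σ ρ : Vec lam → ℝ → ℂ} (β : Vec lam) (hw : ContinuousOn (fun y => w y.1 y.2) S)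
    (hσ : ContinuousOn (fun y => σ y.1 y.2) S) (hρ : ContinuousOn (fun y => ρ y.1 y.2) S)
    (hexp : ∀ y ∈ S, ∀ k, Complex.exp (w y.1 y.2 k) = σ y.1 y.2 + y.1 (first lam k)) :
    ContinuousOn (fun y => pathIntegrand β w σ ρ y.1 y.2) S := by
  have hlin : ContinuousOn (fun y : Vec lam × ℝ => linForm (σ y.1 y.2) (embed y.1)) S :=
    continuous_linForm_embed.comp_continuousOn (hσ.prodMk continuousOn_fst)
  have huni : ContinuousOn
      (fun y : Vec lam × ℝ => unipotentExp β (linForm (σ y.1 y.2) (embed y.1))) S := by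
    refine continuousOn_finsetSum _ fun k _ => continuousOn_block_theta β k hlin fun y hy => ?_
    rw [linForm_embed_first, ← hexp y hy k]
    exact Complex.exp_ne_zero _
  have hlog : ∀ k, ContinuousOn (fun y : Vec lam × ℝ => w y.1 y.2 k) S := fun k =>
    (continuous_apply k).comp_continuousOn hw
  simp only [pathIntegrand, character_eq]
  fun_prop

/-- A continuous branch of the logarithm of a differentiable curve is differentiable. -/
theorem hasDerivWithinAt_of_exp_eq {f g : ℝ → ℂ} {g' : ℂ} {S : Set ℝ} {t : ℝ} (ht : t ∈ S)
    (hf : ContinuousWithinAt f S t) (hg : HasDerivAt g g' t)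
    (h : ∀ s ∈ S, Complex.exp (f s) = g s) : HasDerivWithinAt f (g' / g t) S t := by
  have hgt : g t ≠ 0 := h t ht ▸ Complex.exp_ne_zero _
  have hd : HasDerivAt (fun s => Complex.log (g s / g t) + f t) (g' / g t) t := by
    have := ((hg.div_const (g t)).clog_real (by simp [hgt])).add_const (f t)
    rwa [div_self hgt, div_one] at this
  refine hd.hasDerivWithinAt.congr_of_eventuallyEq ?_ (by simp [hgt])
  have him : ∀ᶠ s in 𝓝[S] t, |(f s - f t).im| < Real.pi := by
    have : ContinuousWithinAt (fun s => |(f s - f t).im|) S t :=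
      (Complex.continuous_im.continuousAt.comp_continuousWithinAt
        (hf.sub continuousWithinAt_const)).abs
    exact this.eventually_lt_const (by simpa using Real.pi_pos)
  filter_upwards [him, self_mem_nhdsWithin] with s hs hsS
  obtain ⟨h₁, h₂⟩ := abs_lt.1 hs
  rw [← h s hsS, ← h t ht, ← Complex.exp_sub, Complex.log_exp h₁ h₂.le, sub_add_cancel]

/-- Exponential decay beats a power at the singular point. -/
theorem exists_neg_log_sub_div_le {b δ : ℝ} (hb : 0 ≤ b) (hδ : 0 < δ) :
    ∃ C : ℝ, ∀ t ∈ Set.Ioc (0 : ℝ) 1, b * (-Real.log t) - δ / t ≤ C := by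
  refine ⟨(b + 1) * (Real.log ((b + 1) / δ) - 1), fun t ht => ?_⟩
  have ht0 : 0 < t := ht.1
  have h₁ : 0 ≤ -Real.log t := neg_nonneg.2 (Real.log_nonpos ht.1.le ht.2)
  -- `log s ≤ s - 1` at `s = δ / (t (b + 1))`; the shift to `b + 1` covers `b = 0`.
  have h₂ := Real.log_le_sub_one_of_pos (x := δ / t / (b + 1)) (by positivity)
  have h₃ : Real.log (δ / t / (b + 1)) = -Real.log t - Real.log ((b + 1) / δ) := by
    rw [Real.log_div (by positivity) (by positivity), Real.log_div hδ.ne' ht0.ne',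
      Real.log_div (by positivity) hδ.ne']
    ring
  have h₄ : (b + 1) * (δ / t / (b + 1)) = δ / t := by field_simp
  nlinarith [mul_le_mul_of_nonneg_left h₂ (by positivity : 0 ≤ b + 1)]

theorem entry_linForm_embed (s : ℂ) (x : Vec lam) (k : Fin lam.len) {b : ℕ} (hb : b ≠ 0) :
    entry (linForm s (embed x)) k b = entry x k b := by
  unfold entry
  split_ifs
  · simp [linForm, embed, hb]
  · rfl

theorem radialPath_add (k l : Fin lam.len) (q : ℂ) (x : Vec lam) (t : ℝ) :
    radialPath k q x t + x (first lam l) =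
      x (first lam l) - x (first lam k) + t * (q + x (first lam k)) := by
  rw [radialPath]
  ring

theorem hasDerivAt_radialPath (k : Fin lam.len) (q : ℂ) (x : Vec lam) (t : ℝ) :
    HasDerivAt (radialPath k q x) (q + x (first lam k)) t := by
  exact (((hasDerivAt_id t).ofReal_comp.mul_const (q + x (first lam k))).const_add
    (-x (first lam k))).congr_deriv (by simp)

theorem continuous_radialPath (k : Fin lam.len) (q : ℂ) :
    Continuous fun y : Vec lam × ℝ => radialPath k q y.1 y.2 := by
  unfold radialPath
  fun_prop

/-- `t^{n_k - 1}` times the exponent of the `k`-th block of the character at the point with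
parameter `t` of the segment from `-x_0^{(k)}` to `q`, as a polynomial in `t`. -/
def radialExp (β : Vec lam) (k : Fin lam.len) (q : ℂ) (y : Vec lam × ℝ) : ℂ :=
  ∑ r ∈ Finset.Ico 1 (lam.part k), entry β k r * ∑ c : Composition r,
    (-1) ^ (c.length + 1) / (c.length : ℂ) * ((y.2 : ℂ) ^ (lam.part k - 1 - c.length) *
      ∏ n : Fin c.length, entry y.1 k (c.blocksFun n) / (q + y.1 (first lam k)))

theorem continuousAt_radialExp (β : Vec lam) (k : Fin lam.len) (q : ℂ) {y : Vec lam × ℝ}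
    (hy : q + y.1 (first lam k) ≠ 0) : ContinuousAt (radialExp β k q) y := by
  have he : ∀ r, Continuous fun y : Vec lam × ℝ => entry y.1 k r := fun r =>
    (differentiable_entry k r).continuous.comp continuous_fst
  have hc : Continuous fun y : Vec lam × ℝ => q + y.1 (first lam k) := by fun_prop
  have ht : Continuous fun y : Vec lam × ℝ => (y.2 : ℂ) := by fun_prop
  unfold radialExp
  refine tendsto_finsetSum _ fun r _ => tendsto_const_nhds.mul ?_
  refine tendsto_finsetSum _ fun c _ => tendsto_const_nhds.mul ?_
  refine ((ht.pow _).tendsto y).mul ?_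
  exact tendsto_finsetProd _ fun n _ => ((he _).tendsto y).div (hc.tendsto y) hy

theorem sum_theta_radialPath (β : Vec lam) (k : Fin lam.len) (q : ℂ) (x : Vec lam) {t : ℝ}
    (ht : t ≠ 0) : ∑ r ∈ Finset.Ico 1 (lam.part k),
      entry β k r * theta r (entry (linForm (radialPath k q x t) (embed x)) k) =
        radialExp β k q (x, t) / (t : ℂ) ^ (lam.part k - 1) := by
  have ht' : (t : ℂ) ≠ 0 := by exact_mod_cast ht
  rw [radialExp, Finset.sum_div]
  refine Finset.sum_congr rfl fun r hr => ?_
  rw [mul_div_assoc, theta_eq_sum, Finset.sum_div]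
  congr 1
  refine Finset.sum_congr rfl fun c _ => ?_
  rw [mul_div_assoc]
  congr 1
  have hlen : c.length ≤ lam.part k - 1 := by
    have := c.length_le
    have := (Finset.mem_Ico.1 hr).2
    omega
  have hprod : ∏ n : Fin c.length,
      entry (linForm (radialPath k q x t) (embed x)) k (c.blocksFun n) /
        entry (linForm (radialPath k q x t) (embed x)) k 0 =
      (∏ n : Fin c.length, entry x k (c.blocksFun n) / (q + x (first lam k))) *
        ((t : ℂ) ^ c.length)⁻¹ := by
    rw [← inv_pow, show ((t : ℂ)⁻¹) ^ c.length = ∏ _n : Fin c.length, (t : ℂ)⁻¹ by simp,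
      ← Finset.prod_mul_distrib]
    refine Finset.prod_congr rfl fun n _ => ?_
    rw [entry_linForm_embed _ _ _ (by have := c.one_le_blocksFun n; omega), entry_zero,
      linForm_embed_first, radialPath_add, sub_self, zero_add]
    rw [div_eq_mul_inv, div_eq_mul_inv, mul_inv]
    ring
  rw [hprod, pow_sub₀ _ ht' hlen]
  have := pow_ne_zero (lam.part k - 1) ht'
  field_simp

/-- The leading coefficient of the exponent comes from the composition `1 + ⋯ + 1`. -/
theorem radialExp_zero (β : Vec lam) (k : Fin lam.len) (q : ℂ) (x : Vec lam)
    (hk : 2 ≤ lam.part k) : radialExp β k q (x, 0) =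
      β (last lam k) * ((-1) ^ lam.part k / ((lam.part k - 1 : ℕ) : ℂ)) *
        (x ⟨k, ⟨1, hk⟩⟩ / (q + x (first lam k))) ^ (lam.part k - 1) := by
  rw [radialExp, Finset.sum_eq_single (lam.part k - 1),
    Finset.sum_eq_single (Composition.ones (lam.part k - 1)), entry_last]
  · have h1 : entry x k 1 = x ⟨k, ⟨1, hk⟩⟩ := by rw [entry, dif_pos]
    simp [h1, Composition.ones_length, Nat.sub_add_cancel (lam.part_pos k), mul_assoc, div_pow]
  · intro c _ hc
    have := c.length_le
    have : c.length ≠ lam.part k - 1 := fun h => hc (Composition.eq_ones_iff_length.2 h)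
    rw [Complex.ofReal_zero, zero_pow (by omega), zero_mul, mul_zero]
  · simp
  · intro r hr hne
    rw [Finset.sum_eq_zero, mul_zero]
    intro c _
    have := c.length_le
    have := Finset.mem_Ico.1 hr
    rw [Complex.ofReal_zero, zero_pow (by omega), zero_mul, mul_zero]
  · intro h
    exact absurd (Finset.mem_Ico.2 (by omega)) h

end Bounds

section Rays

variable {lam : TuplePartition N} {W : Set (Vec lam)} {k : Fin lam.len} {q : ℂ}
  {w : Vec lam → ℝ → Fin lam.len → ℂ}

theorem add_ne_zero_of_exp_radialPath
    (hexp : ∀ x ∈ W, ∀ t ∈ Set.Ioc (0 : ℝ) 1, ∀ l,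
      Complex.exp (w x t l) = radialPath k q x t + x (first lam l))
    {x : Vec lam} (hx : x ∈ W) : q + x (first lam k) ≠ 0 := by
  have := hexp x hx 1 ⟨one_pos, le_rfl⟩ k
  rw [radialPath_add, sub_self, zero_add, Complex.ofReal_one, one_mul] at this
  rw [← this]
  exact Complex.exp_ne_zero _

theorem radialPath_add_ne_zero (hsep : ∀ x ∈ W, ∀ l, l ≠ k → x (first lam l) ≠ x (first lam k))
    (hexp : ∀ x ∈ W, ∀ t ∈ Set.Ioc (0 : ℝ) 1, ∀ l,
      Complex.exp (w x t l) = radialPath k q x t + x (first lam l))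
    {x : Vec lam} (hx : x ∈ W) {t : ℝ} (ht : t ∈ Set.Icc (0 : ℝ) 1) {l : Fin lam.len}
    (hl : l ≠ k) : radialPath k q x t + x (first lam l) ≠ 0 := by
  rcases ht.1.eq_or_lt with rfl | h
  · rw [radialPath_add, Complex.ofReal_zero, zero_mul, add_zero]
    exact sub_ne_zero.2 (hsep x hx l hl)
  · rw [← hexp x hx t ⟨h, ht.2⟩]
    exact Complex.exp_ne_zero _

theorem continuousOn_log_slice (hw : ContinuousOn (fun y : Vec lam × ℝ => w y.1 y.2)
    (W ×ˢ Set.Ioc (0 : ℝ) 1)) {x : Vec lam} (hx : x ∈ W) (l : Fin lam.len) :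
    ContinuousOn (fun t => w x t l) (Set.Ioc 0 1) := by
  have h₁ : ContinuousOn (fun t : ℝ => (x, t)) (Set.Ioc 0 1) := by fun_prop
  exact (continuous_apply l).comp_continuousOn (hw.comp h₁ fun t ht => ⟨hx, ht⟩)

theorem continuousOn_log_one (hw : ContinuousOn (fun y : Vec lam × ℝ => w y.1 y.2)
    (W ×ˢ Set.Ioc (0 : ℝ) 1)) (l : Fin lam.len) :
    ContinuousOn (fun y : Vec lam × ℝ => w y.1 1 l) (W ×ˢ Set.Icc (0 : ℝ) 1) := by
  have h₁ : ContinuousOn (fun y : Vec lam × ℝ => (y.1, (1 : ℝ))) (W ×ˢ Set.Icc (0 : ℝ) 1) := by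
    fun_prop
  exact (continuous_apply l).comp_continuousOn
    (hw.comp h₁ fun y hy => ⟨hy.1, one_pos, le_rfl⟩)

/-- Along the segment, `log (s + x_0^{(k)})` at the singular point of the segment is `log t` up to
a constant. -/
theorem radial_log_self (hw : ContinuousOn (fun y : Vec lam × ℝ => w y.1 y.2)
    (W ×ˢ Set.Ioc (0 : ℝ) 1))
    (hexp : ∀ x ∈ W, ∀ t ∈ Set.Ioc (0 : ℝ) 1, ∀ l,
      Complex.exp (w x t l) = radialPath k q x t + x (first lam l))
    {x : Vec lam} (hx : x ∈ W) {t : ℝ} (ht : t ∈ Set.Ioc (0 : ℝ) 1) :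
    w x t k = w x 1 k + Real.log t := by
  have hc := add_ne_zero_of_exp_radialPath hexp hx
  have hderiv : ∀ s ∈ Set.Ioc (0 : ℝ) 1,
      HasDerivWithinAt (fun s : ℝ => w x s k - Real.log s) 0 (Set.Ioc 0 1) s := by
    intro s hs
    have hs0 : (s : ℂ) ≠ 0 := by exact_mod_cast hs.1.ne'
    have h₁ := hasDerivWithinAt_of_exp_eq hs (continuousOn_log_slice hw hx k s hs)
      ((hasDerivAt_radialPath k q x s).add_const (x (first lam k)))
      (fun r hr => hexp x hx r hr k)
    have h₂ := (Real.hasDerivAt_log hs.1.ne').ofReal_comp.hasDerivWithinAt (s := Set.Ioc 0 1)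
    refine (h₁.sub h₂).congr_deriv ?_
    rw [radialPath_add, sub_self, zero_add, Complex.ofReal_inv]
    field_simp
    ring
  have := (convex_Ioc (0 : ℝ) 1).norm_image_sub_le_of_norm_hasDerivWithin_le (C := 0) hderiv
    (fun s _ => by simp) (Set.right_mem_Ioc.2 one_pos) ht
  rw [zero_mul, norm_le_zero_iff] at this
  simp only [Real.log_one, Complex.ofReal_zero] at this
  linear_combination this

/-- Along the segment, `log (s + x_0^{(l)})` at the other singular points is bounded: its
derivative in `t` is. -/
theorem radial_log_bound (hW : IsOpen W) (hw : ContinuousOn (fun y : Vec lam × ℝ => w y.1 y.2)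
    (W ×ˢ Set.Ioc (0 : ℝ) 1))
    (hsep : ∀ x ∈ W, ∀ l, l ≠ k → x (first lam l) ≠ x (first lam k))
    (hexp : ∀ x ∈ W, ∀ t ∈ Set.Ioc (0 : ℝ) 1, ∀ l,
      Complex.exp (w x t l) = radialPath k q x t + x (first lam l))
    {x : Vec lam} (hx : x ∈ W) {l : Fin lam.len} (hl : l ≠ k) :
    ∃ M : ℝ, ∀ᶠ y in 𝓝 x, ∀ t ∈ Set.Ioc (0 : ℝ) 1, ‖w y t l‖ ≤ M := by
  have hquot : ContinuousOn (fun y : Vec lam × ℝ =>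
      (q + y.1 (first lam k)) / (radialPath k q y.1 y.2 + y.1 (first lam l)))
      (W ×ˢ Set.Icc (0 : ℝ) 1) := by
    refine ContinuousOn.div (by fun_prop) ?_ fun y hy =>
      radialPath_add_ne_zero hsep hexp hy.1 hy.2 hl
    have := continuous_radialPath (lam := lam) k q
    fun_prop
  obtain ⟨M₁, hM₁⟩ := exists_eventually_norm_le hW isCompact_Icc hquot hx
  obtain ⟨M₂, hM₂⟩ := exists_eventually_norm_le hW isCompact_Icc (continuousOn_log_one hw l) hx
  refine ⟨M₁ + M₂, ?_⟩
  filter_upwards [hM₁, hM₂, hW.mem_nhds hx] with y h₁ h₂ hy t ht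
  have hderiv : ∀ s ∈ Set.Ioc (0 : ℝ) 1, HasDerivWithinAt (fun s => w y s l)
      ((q + y (first lam k)) / (radialPath k q y s + y (first lam l))) (Set.Ioc 0 1) s :=
    fun s hs => hasDerivWithinAt_of_exp_eq
      (g := fun s => radialPath k q y s + y (first lam l)) hs (continuousOn_log_slice hw hy l s hs)
      ((hasDerivAt_radialPath k q y s).add_const (y (first lam l))) fun r hr => hexp y hy r hr l
  have := (convex_Ioc (0 : ℝ) 1).norm_image_sub_le_of_norm_hasDerivWithin_le (C := M₁) hderiv
    (fun s hs => h₁ s ⟨hs.1.le, hs.2⟩) (Set.right_mem_Ioc.2 one_pos) ht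
  have hM₁0 : 0 ≤ M₁ := (norm_nonneg _).trans (h₁ 1 ⟨zero_le_one, le_rfl⟩)
  have ht1 : ‖t - 1‖ ≤ 1 := by
    rw [Real.norm_eq_abs, abs_le]
    constructor <;> linarith [ht.1, ht.2]
  have h₃ := h₂ 1 ⟨zero_le_one, le_rfl⟩
  calc ‖w y t l‖ = ‖(w y t l - w y 1 l) + w y 1 l‖ := by rw [sub_add_cancel]
    _ ≤ ‖w y t l - w y 1 l‖ + ‖w y 1 l‖ := norm_add_le _ _
    _ ≤ M₁ + M₂ := add_le_add (this.trans (mul_le_of_le_one_right hM₁0 ht1)) h₃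

/-- The integrand is bounded along a segment that leaves an essential singularity of the character
in a direction of decay. -/
theorem radial_bound (hW : IsOpen W) (hk : 2 ≤ lam.part k)
    (hw : ContinuousOn (fun y : Vec lam × ℝ => w y.1 y.2) (W ×ˢ Set.Ioc (0 : ℝ) 1))
    (hsep : ∀ x ∈ W, ∀ l, l ≠ k → x (first lam l) ≠ x (first lam k))
    (hexp : ∀ x ∈ W, ∀ t ∈ Set.Ioc (0 : ℝ) 1, ∀ l,
      Complex.exp (w x t l) = radialPath k q x t + x (first lam l))
    (β : Vec lam) {x : Vec lam} (hx : x ∈ W) (hdecay : (radialExp β k q (x, 0)).re < 0) :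
    ∃ M : ℝ, ∀ᶠ y in 𝓝 x, ∀ t ∈ Set.Ioc (0 : ℝ) 1,
      ‖pathIntegrand β w (radialPath k q) (fun y _ => q + y (first lam k)) y t‖ ≤ M := by
  have hrad := continuous_radialPath (lam := lam) k q
  -- Away from the singular point the bound follows from compactness.
  have hfar : ∀ ε > 0, ∃ M : ℝ, ∀ᶠ y in 𝓝 x, ∀ t ∈ Set.Icc ε 1,
      ‖pathIntegrand β w (radialPath k q) (fun y _ => q + y (first lam k)) y t‖ ≤ M := by
    intro ε hε
    have hsub : W ×ˢ Set.Icc ε 1 ⊆ W ×ˢ Set.Ioc (0 : ℝ) 1 :=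
      Set.prod_mono le_rfl fun t ht => ⟨hε.trans_le ht.1, ht.2⟩
    refine exists_eventually_norm_le (f := fun y =>
      pathIntegrand β w (radialPath k q) (fun y _ => q + y (first lam k)) y.1 y.2) hW
      isCompact_Icc ?_ hx
    exact continuousOn_pathIntegrand β (hw.mono hsub) hrad.continuousOn (by fun_prop)
      fun y hy l => hexp y.1 hy.1 y.2 (hsub hy).2 l
  -- Near the singular point the leading term of the exponent has negative real part.
  obtain ⟨δ, hδ, hδx⟩ : ∃ δ > 0, (radialExp β k q (x, 0)).re < -δ :=
    ⟨-(radialExp β k q (x, 0)).re / 2, by linarith, by linarith⟩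
  have hnear : ∀ᶠ y in 𝓝 (x, (0 : ℝ)), (radialExp β k q y).re < -δ :=
    (Complex.continuous_re.continuousAt.comp (continuousAt_radialExp β k q
      (y := (x, 0)) (add_ne_zero_of_exp_radialPath hexp hx))).eventually_lt_const hδx
  rw [nhds_prod_eq] at hnear
  obtain ⟨P, hP, Q, hQ, hPQ⟩ := eventually_prod_iff.1 hnear
  obtain ⟨ε, hε, hεQ⟩ := Metric.eventually_nhds_iff.1 hQ
  obtain ⟨Mfar, hMfar⟩ := hfar ε hε
  have hlin : ContinuousOn (fun y : Vec lam × ℝ => linForm (radialPath k q y.1 y.2) (embed y.1))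
      (W ×ˢ Set.Icc (0 : ℝ) 1) :=
    continuous_linForm_embed.comp_continuousOn (hrad.continuousOn.prodMk continuousOn_fst)
  have hblock : ∀ l, ∃ M : ℝ, l ≠ k → ∀ᶠ y in 𝓝 x, ∀ t ∈ Set.Ioc (0 : ℝ) 1,
      ‖β (first lam l) * w y t l + ∑ r ∈ Finset.Ico 1 (lam.part l),
        entry β l r * theta r (entry (linForm (radialPath k q y t) (embed y)) l)‖ ≤ M := by
    intro l
    by_cases hl : l = k
    · exact ⟨0, fun h => absurd hl h⟩
    obtain ⟨M₁, hM₁⟩ := radial_log_bound hW hw hsep hexp hx hl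
    obtain ⟨M₂, hM₂⟩ := exists_eventually_norm_le hW isCompact_Icc
      (continuousOn_block_theta β l hlin fun y hy => by
        rw [linForm_embed_first]
        exact radialPath_add_ne_zero hsep hexp hy.1 hy.2 hl) hx
    refine ⟨‖β (first lam l)‖ * M₁ + M₂, fun _ => ?_⟩
    filter_upwards [hM₁, hM₂] with y h₁ h₂ t ht
    refine (norm_add_le _ _).trans (add_le_add ?_ (h₂ t ⟨ht.1.le, ht.2⟩))
    rw [norm_mul]
    exact mul_le_mul_of_nonneg_left (h₁ t ht) (norm_nonneg _)
  choose Mb hMb using hblock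
  have hMb' : ∀ᶠ y in 𝓝 x, ∀ l, l ≠ k → ∀ t ∈ Set.Ioc (0 : ℝ) 1,
      ‖β (first lam l) * w y t l + ∑ r ∈ Finset.Ico 1 (lam.part l),
        entry β l r * theta r (entry (linForm (radialPath k q y t) (embed y)) l)‖ ≤ Mb l := by
    rw [eventually_all]
    intro l
    by_cases hl : l = k
    · exact Eventually.of_forall fun y h => absurd hl h
    · exact (hMb l hl).mono fun y hy _ => hy
  obtain ⟨M₁, hM₁⟩ := exists_eventually_norm_le hW isCompact_Icc (continuousOn_log_one hw k) hx
  obtain ⟨M₂, hM₂⟩ := exists_eventually_norm_le (f := fun y => q + y.1 (first lam k)) hW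
    (isCompact_Icc (a := (0 : ℝ)) (b := 1)) (by fun_prop) hx
  obtain ⟨C, hC⟩ := exists_neg_log_sub_div_le (norm_nonneg (β (first lam k))) hδ
  refine ⟨max Mfar (Real.exp (∑ l ∈ Finset.univ.erase k, Mb l + ‖β (first lam k)‖ * M₁ + C) * M₂),
    ?_⟩
  filter_upwards [hMfar, hP, hMb', hM₁, hM₂, hW.mem_nhds hx] with y hfar hPy hby h₁ h₂ hy t ht
  rcases le_or_gt ε t with hεt | htε
  · exact (hfar t ⟨hεt, ht.2⟩).trans (le_max_left _ _)
  refine le_max_of_le_right ?_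
  have ht0 : 0 < t := ht.1
  have hG : (radialExp β k q (y, t)).re < -δ :=
    hPQ hPy (hεQ (by rwa [Real.dist_eq, sub_zero, abs_of_pos ht0]))
  rw [pathIntegrand, norm_mul, character_eq, Complex.norm_exp]
  refine mul_le_mul (Real.exp_le_exp.2 ?_) (h₂ t ⟨ht.1.le, ht.2⟩) (norm_nonneg _)
    (Real.exp_nonneg _)
  have hsplit : ∑ l, β (first lam l) * w y t l +
      unipotentExp β (linForm (radialPath k q y t) (embed y)) =
      ∑ l ∈ Finset.univ.erase k, (β (first lam l) * w y t l + ∑ r ∈ Finset.Ico 1 (lam.part l),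
        entry β l r * theta r (entry (linForm (radialPath k q y t) (embed y)) l)) +
      β (first lam k) * w y 1 k + β (first lam k) * ((Real.log t : ℝ) : ℂ) +
      radialExp β k q (y, t) / (((t ^ (lam.part k - 1) : ℝ)) : ℂ) := by
    rw [unipotentExp, ← Finset.sum_add_distrib, ← Finset.add_sum_erase _ _ (Finset.mem_univ k),
      sum_theta_radialPath β k q y ht0.ne', radial_log_self hw hexp hy ht]
    push_cast
    ring
  rw [hsplit, Complex.add_re, Complex.add_re, Complex.add_re, Complex.div_ofReal_re,
    Complex.re_mul_ofReal]
  have e₁ : (∑ l ∈ Finset.univ.erase k, (β (first lam l) * w y t l +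
      ∑ r ∈ Finset.Ico 1 (lam.part l), entry β l r *
        theta r (entry (linForm (radialPath k q y t) (embed y)) l))).re ≤
      ∑ l ∈ Finset.univ.erase k, Mb l :=
    (Complex.re_le_norm _).trans (norm_sum_le_of_le _ fun l hl =>
      hby l (Finset.ne_of_mem_erase hl) t ht)
  have e₂ : (β (first lam k) * w y 1 k).re ≤ ‖β (first lam k)‖ * M₁ := by
    refine (Complex.re_le_norm _).trans ?_
    rw [norm_mul]
    exact mul_le_mul_of_nonneg_left (h₁ t ⟨ht.1.le, ht.2⟩) (norm_nonneg _)
  have e₃ : (β (first lam k)).re * Real.log t ≤ ‖β (first lam k)‖ * (-Real.log t) := by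
    have hlog : Real.log t ≤ 0 := Real.log_nonpos ht0.le ht.2
    have := neg_le_of_abs_le (Complex.abs_re_le_norm (β (first lam k)))
    nlinarith
  have e₄ : (radialExp β k q (y, t)).re / t ^ (lam.part k - 1) ≤ -δ / t := by
    have hpow : t ^ (lam.part k - 1) ≤ t := pow_le_of_le_one ht0.le ht.2 (by omega)
    rw [div_le_div_iff₀ (by positivity) ht0]
    have := pow_pos ht0 (lam.part k - 1)
    nlinarith
  have e₅ := hC t ht
  rw [neg_div] at e₄
  linarith

end Rays

/-! ### Contiguity of the Gelfand hypergeometric function -/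

section Hypergeometric

variable {lam : TuplePartition N} {W : Set (Vec lam)} {α : Vec lam}

theorem contig_sum_mul {κ : Type*} (s : Finset κ) (c : κ → ℂ) {f : κ → Vec lam → ℂ} {x : Vec lam}
    (hf : ∀ n ∈ s, DifferentiableAt ℂ (f n) x) (i j : Fin lam.len) (β : Vec lam) :
    contig i j β (fun y => ∑ n ∈ s, c n * f n y) x = ∑ n ∈ s, c n * contig i j β (f n) x := by
  simp only [contig]
  rw [D_sum s fun n hn => (hf n hn).const_mul (c n), Finset.mul_sum, Finset.mul_sum,
    ← Finset.sum_add_distrib]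
  refine Finset.sum_congr rfl fun n hn => ?_
  rw [D_const_mul _ (hf n hn)]
  ring

theorem contig_add {f g : Vec lam → ℂ} {x : Vec lam} (hf : DifferentiableAt ℂ f x)
    (hg : DifferentiableAt ℂ g x) (i j : Fin lam.len) (β : Vec lam) :
    contig i j β (fun y => f y + g y) x = contig i j β f x + contig i j β g x := by
  rw [contig, contig, contig, D_add hf hg]
  ring

theorem first_ne_first_of_mem_slice {x : Vec lam} (hx : x ∈ slice lam) {k l : Fin lam.len}
    (hkl : k ≠ l) : x (first lam k) ≠ x (first lam l) := by
  have h := hx.1 k l hkl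
  rw [minor, embed_zero_apply, embed_zero_apply, embed_one_first, embed_one_first] at h
  exact fun e => h (by rw [e]; ring)

theorem TwistedCycle.isMovingPath_arc (C : TwistedCycle lam α W) (a : Fin C.numArc) :
    IsMovingPath W (C.arcLog a) (fun _ t => C.arc a t) (fun _ t => deriv (C.arc a) t) where
  continuousOn_log t ht k := by
    have h₁ : ContinuousOn (fun x : Vec lam => (x, t)) W := by fun_prop
    exact (continuous_apply k).comp_continuousOn
      ((C.arcLog_continuousOn a).comp h₁ fun x hx => ⟨hx, ht.1.le, ht.2⟩)
  exp_log x hx t ht k := C.exp_arcLog a x hx t ⟨ht.1.le, ht.2⟩ k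
  differentiable_path _ := differentiable_const _
  differentiable_density _ := differentiable_const _
  path_add _ _ _ _ := rfl
  density_add _ _ _ _ := rfl

theorem TwistedCycle.isLocallyBounded_arc (C : TwistedCycle lam α W) (hW : IsOpen W)
    (a : Fin C.numArc) (β : Vec lam) :
    IsLocallyBounded β W (C.arcLog a) (fun _ t => C.arc a t) fun _ t => deriv (C.arc a) t := by
  have h₁ : Continuous fun y : Vec lam × ℝ => C.arc a y.2 :=
    (C.arc_contDiff a).continuous.comp continuous_snd
  have h₂ : Continuous fun y : Vec lam × ℝ => deriv (C.arc a) y.2 :=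
    ((C.arc_contDiff a).continuous_deriv le_rfl).comp continuous_snd
  have hcont := continuousOn_pathIntegrand (σ := fun _ t => C.arc a t)
    (ρ := fun _ t => deriv (C.arc a) t) β (C.arcLog_continuousOn a) h₁.continuousOn
    h₂.continuousOn fun y hy k => C.exp_arcLog a y.1 hy.1 y.2 hy.2 k
  refine ⟨fun x hx => ?_, fun x hx => ?_⟩
  · exact (ContinuousOn.uncurry_left x hx hcont).mono Set.Ioc_subset_Icc_self
  · obtain ⟨M, hM⟩ := exists_eventually_norm_le hW isCompact_Icc hcont hx
    exact ⟨M, hM.mono fun y hy t ht => hy t ⟨ht.1.le, ht.2⟩⟩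

theorem TwistedCycle.isMovingPath_ray (C : TwistedCycle lam α W) (b : Fin C.numRay) :
    IsMovingPath W (C.rayLog b) (radialPath (C.rayBlock b) (C.rayEnd b))
      fun x _ => C.rayEnd b + x (first lam (C.rayBlock b)) where
  continuousOn_log t ht k := by
    have h₁ : ContinuousOn (fun x : Vec lam => (x, t)) W := by fun_prop
    exact (continuous_apply k).comp_continuousOn
      ((C.rayLog_continuousOn b).comp h₁ fun x hx => ⟨hx, ht⟩)
  exp_log x hx t ht k := C.exp_rayLog b x hx t ht k
  differentiable_path t := by
    unfold radialPath
    fun_prop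
  differentiable_density t := by fun_prop
  path_add x t k ε := by
    have : first lam (C.rayBlock b) ≠ last lam k := by
      intro e
      obtain ⟨rfl, h₁⟩ := eq_and_part_eq_one_of_last_eq_first e.symm
      have h₂ := C.two_le_part b
      omega
    simp [radialPath, this]
  density_add x t k ε := by
    have : first lam (C.rayBlock b) ≠ last lam k := by
      intro e
      obtain ⟨rfl, h₁⟩ := eq_and_part_eq_one_of_last_eq_first e.symm
      have h₂ := C.two_le_part b
      omega
    simp [this]

theorem TwistedCycle.isLocallyBounded_ray (C : TwistedCycle lam α W) (hW : IsOpen W)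
    (hWX : W ⊆ slice lam) (b : Fin C.numRay) {β : Vec lam}
    (hβ : β (last lam (C.rayBlock b)) = α (last lam (C.rayBlock b))) :
    IsLocallyBounded β W (C.rayLog b) (radialPath (C.rayBlock b) (C.rayEnd b))
      fun x _ => C.rayEnd b + x (first lam (C.rayBlock b)) := by
  refine ⟨fun x hx => ?_, fun x hx => ?_⟩
  · have hcont := continuousOn_pathIntegrand
      (ρ := fun x _ => C.rayEnd b + x (first lam (C.rayBlock b))) β (C.rayLog_continuousOn b)
      (continuous_radialPath (C.rayBlock b) (C.rayEnd b)).continuousOn (by fun_prop)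
      fun y hy k => C.exp_rayLog b y.1 hy.1 y.2 hy.2 k
    exact ContinuousOn.uncurry_left x hx hcont
  · refine radial_bound hW (C.two_le_part b) (C.rayLog_continuousOn b)
      (fun y hy l hl => first_ne_first_of_mem_slice (hWX hy) hl) (C.exp_rayLog b) β hx ?_
    rw [radialExp_zero _ _ _ _ (C.two_le_part b), hβ]
    exact C.decay b x hx

theorem TwistedCycle.integral_eq (C : TwistedCycle lam α W) (β : Vec lam) :
    C.integral β = fun x =>
      ∑ a, C.arcCoeff a *
        pathIntegral β (C.arcLog a) (fun _ t => C.arc a t) (fun _ t => deriv (C.arc a) t) x +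
      ∑ b, C.rayCoeff b *
        pathIntegral β (C.rayLog b) (radialPath (C.rayBlock b) (C.rayEnd b))
          (fun x _ => C.rayEnd b + x (first lam (C.rayBlock b))) x := by
  funext x
  simp only [TwistedCycle.integral, pathIntegral, pathIntegrand,
    (hasDerivAt_radialPath _ _ _ _).deriv]

theorem TwistedCycle.contig_integral (C : TwistedCycle lam α W) (hW : IsOpen W)
    (hWX : W ⊆ slice lam) {β : Vec lam}
    (hβ : ∀ k, 2 ≤ lam.part k → β (last lam k) = α (last lam k)) {x : Vec lam} (hx : x ∈ W)
    (i j : Fin lam.len) : DifferentiableAt ℂ (C.integral β) x ∧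
      contig i j β (C.integral β) x = β (last lam j) * C.integral (shift β i j 1) x := by
  have harc := fun a => (C.isMovingPath_arc a).contig_pathIntegral hW
    (C.isLocallyBounded_arc hW a β) hx i j
  have hray := fun b => (C.isMovingPath_ray b).contig_pathIntegral hW
    (C.isLocallyBounded_ray hW hWX b (hβ _ (C.two_le_part b))) hx i j
  have h₁ := DifferentiableAt.fun_sum (u := Finset.univ) fun a _ =>
    (harc a).1.const_mul (C.arcCoeff a)
  have h₂ := DifferentiableAt.fun_sum (u := Finset.univ) fun b _ =>
    (hray b).1.const_mul (C.rayCoeff b)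
  rw [C.integral_eq β, C.integral_eq (shift β i j 1)]
  refine ⟨h₁.fun_add h₂, ?_⟩
  rw [contig_add h₁ h₂, contig_sum_mul _ _ fun a _ => (harc a).1,
    contig_sum_mul _ _ fun b _ => (hray b).1, mul_add, Finset.mul_sum, Finset.mul_sum]
  congr 1
  · exact Finset.sum_congr rfl fun a _ => by rw [(harc a).2]; ring
  · exact Finset.sum_congr rfl fun b _ => by rw [(hray b).2]; ring

variable {i j : Fin lam.len} {Ω : Set (Vec lam)}

theorem IsGelfandHGF.exists_cycle {F : Vec lam → Vec lam → ℂ} (hF : IsGelfandHGF α Ω F)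
    {x : Vec lam} (hx : x ∈ Ω) (i j : Fin lam.len) : ∃ W : Set (Vec lam), IsOpen W ∧ x ∈ W ∧
      W ⊆ Ω ∧ ∃ C : TwistedCycle lam α W, ∀ m : ℤ, ∀ y ∈ W,
        F (shift α i j m) y = C.integral (shift α i j m) y := by
  obtain ⟨W, hW, hxW, hWΩ, C, hC⟩ := hF x hx
  refine ⟨W, hW, hxW, hWΩ, C, fun m y hy => ?_⟩
  have hsum : ∀ k : Fin lam.len, ∑ l, ((Pi.single k m : Fin lam.len → ℤ) l : ℂ) •
      (Pi.single (first lam l) 1 : Vec lam) = (m : ℂ) • Pi.single (first lam k) 1 := by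
    intro k
    rw [Finset.sum_eq_single k]
    · rw [Pi.single_eq_same]
    · intro l _ hl
      rw [Pi.single_eq_of_ne hl, Int.cast_zero, zero_smul]
    · simp
  have he : shift α i j m = α + ∑ k, (((Pi.single i m - Pi.single j m : Fin lam.len → ℤ) k : ℤ) : ℂ)
      • (Pi.single (first lam k) 1 : Vec lam) := by
    simp only [Pi.sub_apply, Int.cast_sub, sub_smul, Finset.sum_sub_distrib, hsum]
    rw [shift, smul_sub]
  rw [he]
  exact hC _ (by simp) y hy

theorem hgfConst_succ (hij : i ≠ j) (hle : lam.part i ≤ lam.part j) (hα : IsGeneric α) (m : ℤ) :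
    hgfConst i j α (m + 1) = hgfConst i j α m * shift α i j m (last lam j) := by
  have hi := lam.part_pos i
  rw [hgfConst, hgfConst, shift_last_right hij]
  by_cases h : lam.part i = 1 ∧ lam.part j = 1
  · rw [if_pos h, if_pos h, if_pos h.2, last_eq_first_iff.2 h.2]
    have hb := hα.2.1 j h.2
    rw [last_eq_first_iff.2 h.2] at hb
    have hne : α (first lam j) - m ≠ 0 := fun e => hb m (by linear_combination e)
    rw [Complex.Gamma_add_one _ hne]
    push_cast
    rw [show α (first lam j) - (m + 1) + 1 = α (first lam j) - m by ring]
    have hG : Complex.Gamma (α (first lam j) - m) ≠ 0 := Complex.Gamma_ne_zero fun n e =>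
      hb (m - n) (by push_cast; linear_combination e)
    field_simp
  · have hj : lam.part j ≠ 1 := fun hj => h ⟨by omega, hj⟩
    rw [if_neg h, if_neg h, if_neg hj, sub_zero, zpow_add_one₀ (hα.1 j (by omega))]

theorem IsGelfandHGF.isLadder (hij : i ≠ j) (hle : lam.part i ≤ lam.part j) (hα : IsGeneric α)
    (hΩX : Ω ⊆ slice lam) {F : Vec lam → Vec lam → ℂ} (hF : IsGelfandHGF α Ω F) :
    IsLadder i j α Ω fun m x => hgfConst i j α m * F (shift α i j m) x := by
  have hβ : ∀ (m : ℤ) k, 2 ≤ lam.part k → shift α i j m (last lam k) = α (last lam k) := by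
    intro m k hk
    have : ∀ l, last lam k ≠ first lam l := by
      intro l e
      have := (eq_and_part_eq_one_of_last_eq_first e).2
      omega
    simp [shift, this]
  have key : ∀ m : ℤ, ∀ x ∈ Ω, DifferentiableAt ℂ (F (shift α i j m)) x ∧
      contig i j (shift α i j m) (F (shift α i j m)) x =
        shift α i j m (last lam j) * F (shift α i j (m + 1)) x ∧
      contig j i (shift α i j m) (F (shift α i j m)) x =
        shift α i j m (last lam i) * F (shift α i j (m - 1)) x := by
    intro m x hx
    obtain ⟨W, hW, hxW, hWΩ, C, hC⟩ := hF.exists_cycle hx i j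
    have hev : F (shift α i j m) =ᶠ[𝓝 x] C.integral (shift α i j m) :=
      eventually_of_mem (hW.mem_nhds hxW) (hC m)
    have h₁ := C.contig_integral hW (hWΩ.trans hΩX) (hβ m) hxW i j
    have h₂ := C.contig_integral hW (hWΩ.trans hΩX) (hβ m) hxW j i
    rw [shift_shift] at h₁
    rw [shift_swap (shift α i j m), shift_shift, ← sub_eq_add_neg] at h₂
    refine ⟨h₁.1.congr_of_eventuallyEq hev, ?_, ?_⟩
    · rw [contig_congr hev, h₁.2, hC _ x hxW]
    · rw [contig_congr hev, h₂.2, hC _ x hxW]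
  refine ⟨fun m x hx => ((key m x hx).1.const_mul _).differentiableWithinAt, fun m x hx => ?_,
    fun m x hx => ?_⟩
  · rw [contig_const_mul _ (key m x hx).1, (key m x hx).2.1, hgfConst_succ hij hle hα]
    ring
  · have hc := cConst_succ hij α (m - 1)
    have hp : shift α i j m (last lam i) =
        shift α i j (m - 1) (last lam i) + if lam.part i = 1 then 1 else 0 := by
      rw [shift_last_left hij, shift_last_left hij]
      split_ifs <;> push_cast <;> ring
    have hs := hgfConst_succ hij hle hα (m - 1)
    rw [sub_add_cancel] at hc hs
    rw [contig_const_mul _ (key m x hx).1, (key m x hx).2.2, hc, hs, ← hp]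
    ring

end Hypergeometric

end GelfandToda

end

open GelfandToda
theorem theorem1 {N : ℕ} (lam : TuplePartition N) (i j : Fin lam.len) (hij : i ≠ j)
    (hle : lam.part i ≤ lam.part j) (α : Vec lam) (hα : IsGeneric α)
    (Ω : Set (Vec lam)) (hΩ : IsOpen Ω) (hΩX : Ω ⊆ slice lam)
    (L : Vec lam → ℂ) (hL : DifferentiableOn ℂ L Ω)
    (hexp : ∀ x ∈ Ω, Complex.exp (L x) = x (first lam i) - x (first lam j))
    (A : ℂ) (hA : A ≠ 0) :
    SolvesToda Ω (last lam i) (last lam j) (seed i j α A L) ∧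
    (∀ u : ℤ → Vec lam → ℂ, IsResSection α Ω (u 0) →
      (∀ m : ℤ, 0 ≤ m → ∀ x ∈ Ω, u (m + 1) x = opH i j α m (u m) x) →
      (∀ m : ℤ, m ≤ 0 → ∀ x ∈ Ω, u (m - 1) x = opB i j α m (u m) x) →
      (∀ m : ℤ, IsResSection (shift α i j m) Ω (u m)) ∧
      SolvesToda Ω (last lam i) (last lam j)
        (fun m x => seed i j α A L m x * gaugeFactor i j α L m x * u m x)) ∧
    (∀ F : Vec lam → Vec lam → ℂ, IsGelfandHGF α Ω F →
      SolvesToda Ω (last lam i) (last lam j)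
        (fun m x => hgfConst i j α m * seed i j α A L m x * gaugeFactor i j α L m x *
          F (shift α i j m) x)) := by
  refine ⟨solvesToda_seed hij hle hα hΩ hL hexp hA, fun u h₀ hH hB => ?_, fun F hF => ?_⟩
  · have hu := isResSection_of_operators hΩ h₀ hH hB
    exact ⟨hu, solvesToda_of_isLadder hij hle hα hΩ hL hexp hA
      (isLadder_of_operators hij hα hΩ (fun x hx => sub_ne_zero_of_exp (hexp x hx)) hu hH hB)⟩
  · refine (solvesToda_of_isLadder hij hle hα hΩ hL hexp hA
      (hF.isLadder hij hle hα hΩX)).congr hΩ fun m x _ => ?_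
    ring
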